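/- Let $\overset{\circ}{\mathfrak g}$ be a finite dimensional simple complex Lie algebra with Cartan subalgebra $\overset{\circ}{\mathfrak h}$, simple roots $\alpha_1,\dots,\alpha_n$, highest root $\theta$, and a non-degenerate symmetric invariant bilinear form $\langle\cdot,\cdot\rangle$. Let $A$ be a finitely generated commutative associative unital $\mathbb C$-algebra. Let $\mathfrak L = (\overset{\circ}{\mathfrak g}\otimes\mathbb C[t,t^{-1}]\oplus\mathbb C K)\rtimes \mathrm{Vir}$, where $\mathrm{Vir}$ has basis $\{d_n, C: n\in\mathbb Z\}$, with brackets $$[x\otimes t^n,y\otimes t^m]=[x,y]\otimes t^{n+m}+n\,\delta_{n+m,0}\langle x,y\rangle K,\qquad [d_n,x\otimes t^m]=m\,x\otimes t^{n+m},$$ $$[d_n,d_m]=(m-n)d_{n+m}+\delta_{n+m,0}\tfrac{n^3-n}{12}C,\qquad K, C \text{ central},$$ and let $\mathfrak L(A)=\mathfrak L\otimes A$ with $[X\otimes a,Y\otimes b]=[X,Y]\otimes ab$. Put $\mathfrak h'=\overset{\circ}{\mathfrak h}\oplus\mathbb C K$ and $\bar{\mathfrak h}=\mathfrak h'\oplus\mathbb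 C d_0\oplus\mathbb C C$. Let $\mathfrak L^+$ be the span of the positive root vectors $x\otimes t^0$ of $\overset{\circ}{\mathfrak g}$ and of all $x\otimes t^n$ ($x\in\overset{\circ}{\mathfrak g}$) and $d_n$ with $n>0$. For a linear map $\psi:\bar{\mathfrak h}\otimes A\to\mathbb C$, let $M(\psi)$ be the $\mathfrak L(A)$-module induced from the one-dimensional module $\mathbb C v_\psi$ of $(\bar{\mathfrak h}\oplus\mathfrak L^+)\otimes A$ on which $\mathfrak L^+\otimes A$ acts by $0$ and $\bar{\mathfrak h}\otimes A$ by $\psi$, and let $V(\psi)$ be the quotient of $M(\psi)$ by its largest proper submodule. It is the irreducible highest weight module with highest weight $\psi$. An $\mathfrak L(A)$-module $V$ is called integrable if it is the direct sum of its weight spaces $V_\mu=\{v: (h\otimes 1)v=\mu(h)v \ \forall h\in\bar{\mathfrak h}\}$, $\mu\in\bar{\mathfrak h}^*$, these are finite dimensional, and for every root $\alpha$ of $\overset{\circ}{\mathfrak g}$, $x\in\overset{\circ}{\mathfrak g}_\alpha$, $n\in\mathbb Z$ and $a\in A$ the element $(x\otimes t^n)\otimes a$ acts locally nilpotently on $V$.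 A linear functional $\mu$ on $\mathfrak h'$ is called dominant integral if $\mu(\alpha_i^\vee)\in\mathbb Z_{\ge 0}$ for $0\le i\le n$, where $\alpha_1^\vee,\dots,\alpha_n^\vee$ are the simple coroots of $\overset{\circ}{\mathfrak g}$ and $\alpha_0^\vee=-\theta^\vee+\frac{2}{\langle\theta,\theta\rangle}K$. Let $I$ be a cofinite ideal of $A$, i.e. $\dim_{\mathbb C} A/I<\infty$. Then $\sqrt I$ is the intersection of the finitely many maximal ideals $\mathcal M_1,\dots,\mathcal M_s$ that contain it, and $\mathfrak h'\otimes A/\sqrt I\cong\bigoplus_{i=1}^s\mathfrak h'_i$ with $\mathfrak h'_i=\mathfrak h'\otimes A/\mathcal M_i\cong\mathfrak h'$. If $\psi(\mathfrak h'\otimes\sqrt I)=0$, then $\psi$ is called dominant integral with respect to $\sqrt I$ if the restriction to each $\mathfrak h'_i$ of the functional induced by $\psi$ on $\mathfrak h'\otimes A/\sqrt I$ is dominant integral. **Theorem.** Let $\psi:\bar{\mathfrak h}\otimes A\to\mathbb C$ be linear. Suppose there is a cofinite ideal $I$ of $A$ such that $\psi(d_0\otimes I)=0$, $\psi(C\otimes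 I)=0$, $\psi((\overset{\circ}{\mathfrak h}\oplus\mathbb C K)\otimes\sqrt I)=0$, and $\psi$ is dominant integral with respect to $\sqrt I$. Then $V(\psi)$ is integrable; in particular its weight spaces are finite dimensional. -/

import Mathlib

open scoped TensorProduct

noncomputable section

namespace LoopAffineVirasoro

/-- A non-degenerate symmetric invariant bilinear form on a complex Lie algebra. -/
structure InvariantForm (g : Type*) [LieRing g] [LieAlgebra ℂ g] where
  form : LinearMap.BilinForm ℂ g
  symm : ∀ x y : g, form x y = form y x
  nondegenerate : form.Nondegenerate
  invariant : ∀ x y z : g, form ⁅x, y⁆ z = form x ⁅y, z⁆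

section FinsuppBilinear

variable {M N P : Type*} [AddCommGroup M] [Module ℂ M] [AddCommGroup N] [Module ℂ N]
  [AddCommGroup P] [Module ℂ P]

/-- The bilinear map with `(single n x, single m y) ↦ φ n m x y`. -/
def bilin (φ : ℤ → ℤ → M →ₗ[ℂ] N →ₗ[ℂ] P) : (ℤ →₀ M) →ₗ[ℂ] (ℤ →₀ N) →ₗ[ℂ] P :=
  Finsupp.lsum ℂ fun n => LinearMap.flip (Finsupp.lsum ℂ fun m => (φ n m).flip)

@[simp]
theorem bilin_single (φ : ℤ → ℤ → M →ₗ[ℂ] N →ₗ[ℂ] P) (n m : ℤ) (x : M) (y : N) :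
    bilin φ (Finsupp.single n x) (Finsupp.single m y) = φ n m x y := by
  simp [bilin]

theorem eq_zero_of_eq_neg {x : M} (hx : x = -x) : x = 0 := by
  have h2 : (2 : ℂ) • x = 0 := by rw [two_smul]; exact add_eq_zero_iff_eq_neg.mpr hx
  exact (smul_eq_zero.mp h2).resolve_left two_ne_zero

end FinsuppBilinear

section Algebra

set_option linter.unusedSimpArgs false

variable {g : Type*} [LieRing g] [LieAlgebra ℂ g]

/-- The underlying space of `(g ⊗ ℂ[t, t⁻¹] ⊕ ℂ K) ⋊ Vir`: the element with components `f, k, u, c`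
stands for `∑ₙ f n ⊗ tⁿ + k K + ∑ₙ u n dₙ + c C`. -/
@[ext]
structure AffVir (B : InvariantForm g) where
  loopPart : ℤ →₀ g
  kPart : ℂ
  virPart : ℤ →₀ ℂ
  cPart : ℂ

variable (B : InvariantForm g)

namespace AffVir

/-- Elements as quadruples; the vector space structure is transported along this. -/
def equivProd : AffVir B ≃ (ℤ →₀ g) × ℂ × (ℤ →₀ ℂ) × ℂ where
  toFun X := (X.loopPart, X.kPart, X.virPart, X.cPart)
  invFun p := ⟨p.1, p.2.1, p.2.2.1, p.2.2.2⟩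
  left_inv _ := rfl
  right_inv _ := rfl

instance : AddCommGroup (AffVir B) := (equivProd B).addCommGroup

instance : Module ℂ (AffVir B) := (equivProd B).module ℂ

@[simp] theorem add_loopPart (X Y : AffVir B) : (X + Y).loopPart = X.loopPart + Y.loopPart := rfl
@[simp] theorem add_kPart (X Y : AffVir B) : (X + Y).kPart = X.kPart + Y.kPart := rfl
@[simp] theorem add_virPart (X Y : AffVir B) : (X + Y).virPart = X.virPart + Y.virPart := rfl
@[simp] theorem add_cPart (X Y : AffVir B) : (X + Y).cPart = X.cPart + Y.cPart := rfl
@[simp] theorem smul_loopPart (r : ℂ) (X : AffVir B) : (r • X).loopPart = r • X.loopPart := rfl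
@[simp] theorem smul_kPart (r : ℂ) (X : AffVir B) : (r • X).kPart = r * X.kPart := rfl
@[simp] theorem smul_virPart (r : ℂ) (X : AffVir B) : (r • X).virPart = r • X.virPart := rfl
@[simp] theorem smul_cPart (r : ℂ) (X : AffVir B) : (r • X).cPart = r * X.cPart := rfl
@[simp] theorem zero_loopPart : (0 : AffVir B).loopPart = 0 := rfl
@[simp] theorem zero_kPart : (0 : AffVir B).kPart = 0 := rfl
@[simp] theorem zero_virPart : (0 : AffVir B).virPart = 0 := rfl
@[simp] theorem zero_cPart : (0 : AffVir B).cPart = 0 := rfl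

/-- The element `x ⊗ tⁿ`, linear in `x`. -/
@[simps]
def loop (n : ℤ) : g →ₗ[ℂ] AffVir B where
  toFun x := ⟨Finsupp.single n x, 0, 0, 0⟩
  map_add' x y := by ext1 <;> simp
  map_smul' r x := by ext1 <;> simp

/-- The affine central element `K`. -/
@[simps]
def K : AffVir B := ⟨0, 1, 0, 0⟩

/-- The Virasoro element `dₙ`. -/
@[simps]
def d (n : ℤ) : AffVir B := ⟨0, 0, Finsupp.single n 1, 0⟩

/-- The Virasoro central element `C`. -/
@[simps]
def C : AffVir B := ⟨0, 0, 0, 1⟩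

/-- `(x ⊗ tⁿ, y ⊗ tᵐ) ↦ [x, y] ⊗ tⁿ⁺ᵐ` -/
def loopLoop (g : Type*) [LieRing g] [LieAlgebra ℂ g] :
    (ℤ →₀ g) →ₗ[ℂ] (ℤ →₀ g) →ₗ[ℂ] (ℤ →₀ g) :=
  bilin fun n m => (LieModule.toEnd ℂ g g : g →ₗ[ℂ] g →ₗ[ℂ] g).compr₂ (Finsupp.lsingle (n + m))

/-- `(x ⊗ tⁿ, y ⊗ tᵐ) ↦ n δ_{n+m,0} ⟨x, y⟩` -/
def loopK : (ℤ →₀ g) →ₗ[ℂ] (ℤ →₀ g) →ₗ[ℂ] ℂ :=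
  bilin fun n m => if n + m = 0 then (n : ℂ) • B.form else 0

/-- `(dₙ, x ⊗ tᵐ) ↦ m x ⊗ tⁿ⁺ᵐ` -/
def virLoop (g : Type*) [LieRing g] [LieAlgebra ℂ g] :
    (ℤ →₀ ℂ) →ₗ[ℂ] (ℤ →₀ g) →ₗ[ℂ] (ℤ →₀ g) :=
  bilin fun n m => (m : ℂ) • (LinearMap.lsmul ℂ g).compr₂ (Finsupp.lsingle (n + m))

/-- `(dₙ, dₘ) ↦ (m - n) dₙ₊ₘ` -/
def virVir : (ℤ →₀ ℂ) →ₗ[ℂ] (ℤ →₀ ℂ) →ₗ[ℂ] (ℤ →₀ ℂ) :=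
  bilin fun n m => ((m : ℂ) - n) • (LinearMap.lsmul ℂ ℂ).compr₂ (Finsupp.lsingle (n + m))

/-- `(dₙ, dₘ) ↦ δ_{n+m,0} (n³ - n) / 12` -/
def virC : (ℤ →₀ ℂ) →ₗ[ℂ] (ℤ →₀ ℂ) →ₗ[ℂ] ℂ :=
  bilin fun n m => if n + m = 0 then (((n : ℂ) ^ 3 - n) / 12) • LinearMap.mul ℂ ℂ else 0

@[simp]
theorem loopLoop_single (n m : ℤ) (x y : g) :
    loopLoop g (Finsupp.single n x) (Finsupp.single m y) = Finsupp.single (n + m) ⁅x, y⁆ := by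
  simp [loopLoop]

@[simp]
theorem loopK_single (n m : ℤ) (x y : g) :
    loopK B (Finsupp.single n x) (Finsupp.single m y) =
      if n + m = 0 then (n : ℂ) * B.form x y else 0 := by
  simp only [loopK, bilin_single]
  split_ifs <;> simp

@[simp]
theorem virLoop_single (n m : ℤ) (a : ℂ) (x : g) :
    virLoop g (Finsupp.single n a) (Finsupp.single m x) =
      Finsupp.single (n + m) (((m : ℂ) * a) • x) := by
  simp [virLoop, mul_smul]

@[simp]
theorem virVir_single (n m : ℤ) (a b : ℂ) :
    virVir (Finsupp.single n a) (Finsupp.single m b) =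
      Finsupp.single (n + m) (((m : ℂ) - n) * (a * b)) := by
  simp only [virVir, bilin_single, LinearMap.smul_apply, LinearMap.compr₂_apply,
    LinearMap.lsmul_apply, Finsupp.lsingle_apply, Finsupp.smul_single, smul_eq_mul]

@[simp]
theorem virC_single (n m : ℤ) (a b : ℂ) :
    virC (Finsupp.single n a) (Finsupp.single m b) =
      if n + m = 0 then ((n : ℂ) ^ 3 - n) / 12 * (a * b) else 0 := by
  simp only [virC, bilin_single]
  split_ifs <;> simp

theorem loopLoop_skew (f h : ℤ →₀ g) : loopLoop g f h = -loopLoop g h f := by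
  induction f using Finsupp.induction_linear with
  | zero => simp
  | add f₁ f₂ h₁ h₂ => simp only [map_add, LinearMap.add_apply, h₁, h₂, neg_add]
  | single n x =>
    induction h using Finsupp.induction_linear with
    | zero => simp
    | add f₁ f₂ h₁ h₂ => simp only [map_add, LinearMap.add_apply, h₁, h₂, neg_add]
    | single m y =>
      rw [loopLoop_single, loopLoop_single, add_comm n m, ← lie_skew, Finsupp.single_neg]

theorem loopK_skew (f h : ℤ →₀ g) : loopK B f h = -loopK B h f := by
  induction f using Finsupp.induction_linear with
  | zero => simp
  | add f₁ f₂ h₁ h₂ => simp only [map_add, LinearMap.add_apply, h₁, h₂, neg_add]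
  | single n x =>
    induction h using Finsupp.induction_linear with
    | zero => simp
    | add f₁ f₂ h₁ h₂ => simp only [map_add, LinearMap.add_apply, h₁, h₂, neg_add]
    | single m y =>
      rw [loopK_single, loopK_single, add_comm n m, B.symm x y]
      split_ifs with hnm
      · obtain rfl : n = -m := by omega
        push_cast; ring
      · simp

theorem virVir_skew (u v : ℤ →₀ ℂ) : virVir u v = -virVir v u := by
  induction u using Finsupp.induction_linear with
  | zero => simp
  | add f₁ f₂ h₁ h₂ => simp only [map_add, LinearMap.add_apply, h₁, h₂, neg_add]
  | single n x =>
    induction v using Finsupp.induction_linear with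
    | zero => simp
    | add f₁ f₂ h₁ h₂ => simp only [map_add, LinearMap.add_apply, h₁, h₂, neg_add]
    | single m y =>
      rw [virVir_single, virVir_single, add_comm n m, ← Finsupp.single_neg]
      congr 1; ring

theorem virC_skew (u v : ℤ →₀ ℂ) : virC u v = -virC v u := by
  induction u using Finsupp.induction_linear with
  | zero => simp
  | add f₁ f₂ h₁ h₂ => simp only [map_add, LinearMap.add_apply, h₁, h₂, neg_add]
  | single n x =>
    induction v using Finsupp.induction_linear with
    | zero => simp
    | add f₁ f₂ h₁ h₂ => simp only [map_add, LinearMap.add_apply, h₁, h₂, neg_add]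
    | single m y =>
      rw [virC_single, virC_single, add_comm n m]
      split_ifs with hnm
      · obtain rfl : n = -m := by omega
        push_cast; ring
      · simp

theorem loopLoop_jacobi (f h k : ℤ →₀ g) :
    loopLoop g f (loopLoop g h k) =
      loopLoop g (loopLoop g f h) k + loopLoop g h (loopLoop g f k) := by
  induction f using Finsupp.induction_linear with
  | zero => simp
  | add f₁ f₂ h₁ h₂ =>
    simp only [map_add, LinearMap.add_apply, h₁, h₂]; abel
  | single n x =>
    induction h using Finsupp.induction_linear with
    | zero => simp
    | add f₁ f₂ h₁ h₂ =>
      simp only [map_add, LinearMap.add_apply, h₁, h₂]; abel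
    | single m y =>
      induction k using Finsupp.induction_linear with
      | zero => simp
      | add f₁ f₂ h₁ h₂ =>
        simp only [map_add, LinearMap.add_apply, h₁, h₂]; abel
      | single l z =>
        simp only [loopLoop_single]
        rw [← add_assoc, ← add_assoc, add_comm m n, ← Finsupp.single_add, leibniz_lie]

theorem virLoop_loopLoop (u : ℤ →₀ ℂ) (f h : ℤ →₀ g) :
    virLoop g u (loopLoop g f h) =
      loopLoop g (virLoop g u f) h + loopLoop g f (virLoop g u h) := by
  induction u using Finsupp.induction_linear with
  | zero => simp
  | add f₁ f₂ h₁ h₂ =>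
    simp only [map_add, LinearMap.add_apply, h₁, h₂]; abel
  | single n x =>
    induction f using Finsupp.induction_linear with
    | zero => simp
    | add f₁ f₂ h₁ h₂ =>
      simp only [map_add, LinearMap.add_apply, h₁, h₂]; abel
    | single m y =>
      induction h using Finsupp.induction_linear with
      | zero => simp
      | add f₁ f₂ h₁ h₂ =>
        simp only [map_add, LinearMap.add_apply, h₁, h₂]; abel
      | single l z =>
        simp only [loopLoop_single, virLoop_single, smul_lie, lie_smul]
        rw [add_left_comm m n l, ← add_assoc, ← Finsupp.single_add, ← add_smul]
        push_cast
        congr 2; ring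

theorem virLoop_virLoop (u v : ℤ →₀ ℂ) (f : ℤ →₀ g) :
    virLoop g u (virLoop g v f) =
      virLoop g (virVir u v) f + virLoop g v (virLoop g u f) := by
  induction u using Finsupp.induction_linear with
  | zero => simp
  | add f₁ f₂ h₁ h₂ =>
    simp only [map_add, LinearMap.add_apply, h₁, h₂]; abel
  | single n x =>
    induction v using Finsupp.induction_linear with
    | zero => simp
    | add f₁ f₂ h₁ h₂ =>
      simp only [map_add, LinearMap.add_apply, h₁, h₂]; abel
    | single m y =>
      induction f using Finsupp.induction_linear with
      | zero => simp
      | add f₁ f₂ h₁ h₂ =>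
        simp only [map_add, LinearMap.add_apply, h₁, h₂]; abel
      | single l z =>
        simp only [virVir_single, virLoop_single, smul_smul]
        rw [add_left_comm m n l, ← add_assoc, ← Finsupp.single_add, ← add_smul]
        push_cast
        congr 2; ring

theorem virVir_jacobi (u v w : ℤ →₀ ℂ) :
    virVir u (virVir v w) = virVir (virVir u v) w + virVir v (virVir u w) := by
  induction u using Finsupp.induction_linear with
  | zero => simp
  | add f₁ f₂ h₁ h₂ =>
    simp only [map_add, LinearMap.add_apply, h₁, h₂]; abel
  | single n x =>
    induction v using Finsupp.induction_linear with
    | zero => simp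
    | add f₁ f₂ h₁ h₂ =>
      simp only [map_add, LinearMap.add_apply, h₁, h₂]; abel
    | single m y =>
      induction w using Finsupp.induction_linear with
      | zero => simp
      | add f₁ f₂ h₁ h₂ =>
        simp only [map_add, LinearMap.add_apply, h₁, h₂]; abel
      | single l z =>
        simp only [virVir_single]
        rw [add_left_comm m n l, ← add_assoc, ← Finsupp.single_add]
        push_cast
        congr 1; ring

theorem loopK_jacobi (f h k : ℤ →₀ g) :
    loopK B f (loopLoop g h k) = loopK B (loopLoop g f h) k + loopK B h (loopLoop g f k) := by
  induction f using Finsupp.induction_linear with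
  | zero => simp
  | add f₁ f₂ h₁ h₂ =>
    simp only [map_add, LinearMap.add_apply, h₁, h₂]; abel
  | single n x =>
    induction h using Finsupp.induction_linear with
    | zero => simp
    | add f₁ f₂ h₁ h₂ =>
      simp only [map_add, LinearMap.add_apply, h₁, h₂]; abel
    | single m y =>
      induction k using Finsupp.induction_linear with
      | zero => simp
      | add f₁ f₂ h₁ h₂ =>
        simp only [map_add, LinearMap.add_apply, h₁, h₂]; abel
      | single l z =>
        simp only [loopLoop_single, loopK_single]
        rw [add_left_comm m n l, ← add_assoc]
        split_ifs with hs
        · have e₁ : B.form ⁅x, y⁆ z = B.form x ⁅y, z⁆ := B.invariant x y z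
          have e₂ : B.form y ⁅x, z⁆ = -B.form x ⁅y, z⁆ := by
            rw [← B.invariant, ← lie_skew, map_neg, LinearMap.neg_apply, e₁]
          rw [e₁, e₂]; push_cast; ring
        · simp

theorem loopK_virLoop (u : ℤ →₀ ℂ) (f h : ℤ →₀ g) :
    loopK B (virLoop g u f) h + loopK B f (virLoop g u h) = 0 := by
  induction u using Finsupp.induction_linear with
  | zero => simp
  | add f₁ f₂ h₁ h₂ =>
    simp only [map_add, LinearMap.add_apply, h₁, h₂]; grind
  | single n x =>
    induction f using Finsupp.induction_linear with
    | zero => simp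
    | add f₁ f₂ h₁ h₂ =>
      simp only [map_add, LinearMap.add_apply, h₁, h₂]; grind
    | single m y =>
      induction h using Finsupp.induction_linear with
      | zero => simp
      | add f₁ f₂ h₁ h₂ =>
        simp only [map_add, LinearMap.add_apply, h₁, h₂]; grind
      | single l z =>
        simp only [virLoop_single, loopK_single, map_smul, LinearMap.smul_apply, smul_eq_mul]
        rw [add_left_comm m n l, ← add_assoc]
        split_ifs with hs
        · obtain rfl : l = -(n + m) := by omega
          push_cast; ring
        · simp

theorem virC_jacobi (u v w : ℤ →₀ ℂ) :
    virC u (virVir v w) = virC (virVir u v) w + virC v (virVir u w) := by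
  induction u using Finsupp.induction_linear with
  | zero => simp
  | add f₁ f₂ h₁ h₂ =>
    simp only [map_add, LinearMap.add_apply, h₁, h₂]; abel
  | single n x =>
    induction v using Finsupp.induction_linear with
    | zero => simp
    | add f₁ f₂ h₁ h₂ =>
      simp only [map_add, LinearMap.add_apply, h₁, h₂]; abel
    | single m y =>
      induction w using Finsupp.induction_linear with
      | zero => simp
      | add f₁ f₂ h₁ h₂ =>
        simp only [map_add, LinearMap.add_apply, h₁, h₂]; abel
      | single l z =>
        simp only [virVir_single, virC_single]
        rw [add_left_comm m n l, ← add_assoc]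
        split_ifs with hs
        · obtain rfl : l = -(n + m) := by omega
          push_cast; ring
        · simp

instance : Bracket (AffVir B) (AffVir B) where
  bracket X Y :=
    ⟨loopLoop g X.loopPart Y.loopPart + virLoop g X.virPart Y.loopPart
        - virLoop g Y.virPart X.loopPart,
      loopK B X.loopPart Y.loopPart,
      virVir X.virPart Y.virPart,
      virC X.virPart Y.virPart⟩

@[simp] theorem lie_loopPart (X Y : AffVir B) : ⁅X, Y⁆.loopPart =
    loopLoop g X.loopPart Y.loopPart + virLoop g X.virPart Y.loopPart
      - virLoop g Y.virPart X.loopPart := rfl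
@[simp] theorem lie_kPart (X Y : AffVir B) : ⁅X, Y⁆.kPart = loopK B X.loopPart Y.loopPart := rfl
@[simp] theorem lie_virPart (X Y : AffVir B) : ⁅X, Y⁆.virPart = virVir X.virPart Y.virPart := rfl
@[simp] theorem lie_cPart (X Y : AffVir B) : ⁅X, Y⁆.cPart = virC X.virPart Y.virPart := rfl

instance : LieRing (AffVir B) where
  add_lie X Y Z := by
    ext1 <;> simp only [lie_loopPart, lie_kPart, lie_virPart, lie_cPart, add_loopPart, add_kPart,
      add_virPart, add_cPart, map_add, LinearMap.add_apply]
    abel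
  lie_add X Y Z := by
    ext1 <;> simp only [lie_loopPart, lie_kPart, lie_virPart, lie_cPart, add_loopPart, add_kPart,
      add_virPart, add_cPart, map_add, LinearMap.add_apply]
    abel
  lie_self X := by
    ext1
    · simp [eq_zero_of_eq_neg (loopLoop_skew X.loopPart X.loopPart)]
    · exact eq_zero_of_eq_neg (loopK_skew B X.loopPart X.loopPart)
    · exact eq_zero_of_eq_neg (virVir_skew X.virPart X.virPart)
    · exact eq_zero_of_eq_neg (virC_skew X.virPart X.virPart)
  leibniz_lie X Y Z := by
    ext1
    · simp only [lie_loopPart, lie_virPart, add_loopPart, map_add, map_sub, LinearMap.add_apply,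
        LinearMap.sub_apply]
      rw [loopLoop_jacobi X.loopPart, virLoop_loopLoop, virLoop_loopLoop, virLoop_loopLoop,
        virLoop_virLoop X.virPart Y.virPart, virLoop_virLoop X.virPart Z.virPart,
        virLoop_virLoop Y.virPart Z.virPart,
        loopLoop_skew Y.loopPart (virLoop g Z.virPart X.loopPart)]
      abel
    · simp only [lie_loopPart, lie_kPart, add_kPart, map_add, map_sub, LinearMap.add_apply,
        LinearMap.sub_apply]
      have e₁ := loopK_jacobi B X.loopPart Y.loopPart Z.loopPart
      have e₂ := loopK_virLoop B X.virPart Y.loopPart Z.loopPart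
      have e₃ := loopK_virLoop B Y.virPart X.loopPart Z.loopPart
      have e₄ := loopK_virLoop B Z.virPart X.loopPart Y.loopPart
      have e₅ := loopK_skew B Y.loopPart (virLoop g Z.virPart X.loopPart)
      linear_combination e₁ - e₂ + e₃ - e₄ + e₅
    · exact virVir_jacobi _ _ _
    · exact virC_jacobi _ _ _

instance : LieAlgebra ℂ (AffVir B) where
  lie_smul r X Y := by
    ext1 <;> simp [smul_sub]

/-! The defining brackets. -/

theorem loop_lie_loop (n m : ℤ) (x y : g) : ⁅loop B n x, loop B m y⁆ =
    loop B (n + m) ⁅x, y⁆ + (if n + m = 0 then (n : ℂ) * B.form x y else 0) • K B := by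
  ext1 <;> simp [-ite_smul]

theorem d_lie_loop (n m : ℤ) (x : g) : ⁅d B n, loop B m x⁆ = (m : ℂ) • loop B (n + m) x := by
  ext1 <;> simp

theorem d_lie_d (n m : ℤ) : ⁅d B n, d B m⁆ =
    ((m : ℂ) - n) • d B (n + m) + (if n + m = 0 then ((n : ℂ) ^ 3 - n) / 12 else 0) • C B := by
  ext1 <;> simp [-ite_smul]

theorem K_lie (X : AffVir B) : ⁅K B, X⁆ = 0 := by
  ext1 <;> simp

theorem C_lie (X : AffVir B) : ⁅C B, X⁆ = 0 := by
  ext1 <;> simp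

end AffVir
end Algebra

section Modules

open LieAlgebra.IsKilling

attribute [local instance 100] LieRing.ofAssociativeRing

variable {g : Type*} [LieRing g] [LieAlgebra ℂ g] [FiniteDimensional ℂ g] [LieAlgebra.IsSimple ℂ g]
  (B : InvariantForm g) {H : LieSubalgebra ℂ g} [H.IsCartanSubalgebra]
  (A : Type*) [CommRing A] [Algebra ℂ A]

/-- The loop affine-Virasoro algebra: the tensor product of `AffVir B` with `A`, with bracket
`[a ⊗ X, b ⊗ Y] = ab ⊗ [X, Y]`. -/
abbrev LoopAffVir : Type _ := A ⊗[ℂ] AffVir B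

/-- `h' = H ⊕ ℂ K`; the pair `(h, k)` stands for `h + k K`. -/
abbrev DerivedCartan (H : LieSubalgebra ℂ g) : Type _ := H × ℂ

/-- `h̄ = h' ⊕ ℂ d₀ ⊕ ℂ C`; the triple `(x, s, c)` stands for `x + s d₀ + c C`. -/
abbrev ExtCartan (H : LieSubalgebra ℂ g) : Type _ := DerivedCartan H × ℂ × ℂ

/-- The inclusion of `h̄` in `AffVir B`. -/
def cartanIncl : ExtCartan H →ₗ[ℂ] AffVir B where
  toFun x := AffVir.loop B 0 (x.1.1 : g) + x.1.2 • AffVir.K B + x.2.1 • AffVir.d B 0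
    + x.2.2 • AffVir.C B
  map_add' x y := by
    have e : ((x + y).1.1 : g) = (x.1.1 : g) + (y.1.1 : g) := rfl
    rw [e]
    simp only [Prod.fst_add, Prod.snd_add, map_add, add_smul]; abel
  map_smul' r x := by
    have e : ((r • x).1.1 : g) = r • (x.1.1 : g) := rfl
    rw [e]
    simp only [Prod.smul_fst, Prod.smul_snd, map_smul, smul_eq_mul, mul_smul, smul_add,
      RingHom.id_apply]

/-- The space `n₊ ⊕ Vir⁺`, where the positive system of `g` is the one given by the base `b`:
it is spanned by the `x ⊗ t⁰` with `x` a positive root vector of `g`, and by the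
`x ⊗ tⁿ` with `x` in `g` and the `dₙ` for `n > 0`. -/
def posPart (b : (rootSystem H).Base) : Submodule ℂ (AffVir B) :=
  Submodule.span ℂ
    ({X | ∃ α : H.root, b.IsPos α ∧ ∃ x ∈ LieAlgebra.rootSpace H α.1, X = AffVir.loop B 0 x} ∪
     {X | ∃ n : ℤ, 0 < n ∧ ∃ x : g, X = AffVir.loop B n x} ∪
     {X | ∃ n : ℤ, 0 < n ∧ X = AffVir.d B n})

section HighestWeightModule

variable {A} (b : (rootSystem H).Base) (ψ : A ⊗[ℂ] ExtCartan H →ₗ[ℂ] ℂ)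

/-- The left ideal of the enveloping algebra of `LoopAffVir B A` generated by `A ⊗ (n₊ ⊕ Vir⁺)`
and by the elements `y - ψ(y)` with `y` in `A ⊗ h̄`. -/
def vermaIdeal : Submodule (UniversalEnvelopingAlgebra ℂ (LoopAffVir B A))
    (UniversalEnvelopingAlgebra ℂ (LoopAffVir B A)) :=
  Submodule.span _
    ({u | ∃ a : A, ∃ X ∈ posPart B b, u = UniversalEnvelopingAlgebra.ι ℂ (a ⊗ₜ[ℂ] X)} ∪
     {u | ∃ y : A ⊗[ℂ] ExtCartan H,
        u = UniversalEnvelopingAlgebra.ι ℂ ((cartanIncl B).lTensor A y) -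
          algebraMap ℂ (UniversalEnvelopingAlgebra ℂ (LoopAffVir B A)) (ψ y)})

/-- The Verma module `M(ψ)`: the module induced from the one-dimensional module of
`A ⊗ (h̄ ⊕ n₊ ⊕ Vir⁺)` given by `ψ`, as a quotient of the enveloping algebra. -/
abbrev Verma : Type _ := UniversalEnvelopingAlgebra ℂ (LoopAffVir B A) ⧸ vermaIdeal B b ψ

/-- The largest proper submodule of `M(ψ)`: the sum of all proper submodules. -/
def vermaMax : Submodule (UniversalEnvelopingAlgebra ℂ (LoopAffVir B A)) (Verma B b ψ) :=
  sSup {N | N ≠ ⊤}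

/-- The irreducible highest weight module `V(ψ)`. -/
abbrev IrrHW : Type _ := Verma B b ψ ⧸ vermaMax B b ψ

/-- The action of `LoopAffVir B A` on `V(ψ)`. -/
def irrHWAction : LoopAffVir B A →ₗ⁅ℂ⁆ Module.End ℂ (IrrHW B b ψ) :=
  ((Algebra.lsmul ℂ ℂ (IrrHW B b ψ) : UniversalEnvelopingAlgebra ℂ (LoopAffVir B A) →ₐ[ℂ]
    Module.End ℂ (IrrHW B b ψ)) : UniversalEnvelopingAlgebra ℂ (LoopAffVir B A) →ₗ⁅ℂ⁆
    Module.End ℂ (IrrHW B b ψ)).comp (UniversalEnvelopingAlgebra.ι ℂ)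

end HighestWeightModule

section Integrable

variable {A} {V : Type*} [AddCommGroup V] [Module ℂ V]

/-- The weight space `V_μ = {v | h v = μ(h) v for all h in h̄}`. -/
def weightSpace (ρ : LoopAffVir B A →ₗ⁅ℂ⁆ Module.End ℂ V) (μ : Module.Dual ℂ (ExtCartan H)) :
    Submodule ℂ V where
  carrier := {v | ∀ h : ExtCartan H, ρ ((1 : A) ⊗ₜ[ℂ] cartanIncl B h) v = μ h • v}
  add_mem' hv hw h := by rw [map_add, hv h, hw h, smul_add]
  zero_mem' h := by simp
  smul_mem' r v hv h := by rw [map_smul, hv h, smul_comm]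

open Classical in
/-- Integrable representations. The real root vectors are the `x ⊗ tⁿ` with `x` a root vector
of `g` and `n` any integer. -/
structure IsIntegrable (H : LieSubalgebra ℂ g) [H.IsCartanSubalgebra]
    (ρ : LoopAffVir B A →ₗ⁅ℂ⁆ Module.End ℂ V) : Prop where
  isWeightModule : DirectSum.IsInternal
    (fun μ : Module.Dual ℂ (ExtCartan H) => weightSpace B ρ μ)
  finiteDimensional : ∀ μ : Module.Dual ℂ (ExtCartan H), FiniteDimensional ℂ (weightSpace B ρ μ)
  locallyNilpotent : ∀ α : H.root, ∀ x ∈ LieAlgebra.rootSpace H α.1, ∀ (n : ℤ) (a : A) (v : V),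
    ∃ N : ℕ, (ρ (a ⊗ₜ[ℂ] AffVir.loop B n x) ^ N) v = 0

end Integrable

section DominantIntegral

/-- `θ` is the highest root: `θ - β` is a sum of simple roots for every root `β`. -/
def IsHighestRoot (b : (rootSystem H).Base) (θ : H.root) : Prop :=
  ∀ β : H.root, (rootSystem H).root θ - (rootSystem H).root β ∈
    AddSubmonoid.closure ((rootSystem H).root '' b.support)

/-- The simple coroot `α₀^∨ = -θ^∨ + (2 / ⟨θ, θ⟩) K` of the affine algebra, for `θ` the highest
root. The factor is written through the coroot: `⟨θ^∨, θ^∨⟩ = 4 / ⟨θ, θ⟩`. -/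
def affineCoroot (θ : H.root) : DerivedCartan H :=
  (-(rootSystem H).coroot θ,
    B.form ((rootSystem H).coroot θ : H) ((rootSystem H).coroot θ : H) / 2)

/-- A linear functional on `h'` is dominant integral if it takes values in the non-negative
integers on the simple coroots `α₀^∨, …, αₙ^∨` of the affine algebra. -/
def IsDominantIntegral (b : (rootSystem H).Base) (μ : DerivedCartan H →ₗ[ℂ] ℂ) : Prop :=
  (∀ i ∈ b.support, ∃ k : ℕ, μ ((rootSystem H).coroot i, 0) = k) ∧
  ∀ θ : H.root, IsHighestRoot b θ → ∃ k : ℕ, μ (affineCoroot B θ) = k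

/-- For `J` a finite intersection of maximal ideals, `M` one of them: `e` represents in `A ⧸ J` the
unit of the factor `A ⧸ M` of `A ⧸ J ≅ ∏ A ⧸ Mᵢ`. -/
def IsFactorUnit {A : Type*} [CommRing A] (J M : Ideal A) (e : A) : Prop :=
  e - 1 ∈ M ∧ ∀ N : Ideal A, N.IsMaximal → J ≤ N → N ≠ M → e ∈ N

/-- Such representatives exist when `J` is the radical of a cofinite ideal. -/
theorem exists_isFactorUnit {A : Type*} [CommRing A] [Algebra ℂ A] (I : Ideal A)
    (hI : FiniteDimensional ℂ (A ⧸ I)) (M : Ideal A) (hM : M.IsMaximal) (hIM : I.radical ≤ M) :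
    ∃ e : A, IsFactorUnit I.radical M e := by
  have hR : FiniteDimensional ℂ (A ⧸ I.radical) :=
    Module.Finite.of_surjective (Ideal.Quotient.factorₐ ℂ (Ideal.le_radical (I := I))).toLinearMap
      (Ideal.Quotient.factor_surjective Ideal.le_radical)
  have : IsArtinianRing (A ⧸ I.radical) := IsArtinianRing.of_finite ℂ _
  have hfin : {N : Ideal A | N.IsMaximal ∧ I.radical ≤ N}.Finite := by
    refine ((IsArtinianRing.setOfPred_isMaximal_finite (A ⧸ I.radical)).image
      (Ideal.comap (Ideal.Quotient.mk I.radical))).subset ?_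
    rintro N ⟨hN, hle⟩
    have hker : RingHom.ker (Ideal.Quotient.mk I.radical) ≤ N := by rwa [Ideal.mk_ker]
    refine ⟨N.map (Ideal.Quotient.mk I.radical), ?_, ?_⟩
    · exact Ideal.IsMaximal.map_of_surjective_of_ker_le Ideal.Quotient.mk_surjective hker
    · rw [Ideal.comap_map_of_surjective' _ Ideal.Quotient.mk_surjective]
      exact sup_eq_left.mpr hker
  classical
  have := hfin.to_subtype
  obtain ⟨e, he⟩ := Ideal.exists_forall_sub_mem_ideal
    (I := fun N : {N : Ideal A | N.IsMaximal ∧ I.radical ≤ N} => N.1)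
    (fun N N' hne => Ideal.isCoprime_iff_sup_eq.mpr
      (N.2.1.coprime_of_ne N'.2.1 (fun h => hne (Subtype.ext h))))
    (fun N => if N.1 = M then 1 else 0)
  refine ⟨e, ?_, fun N hN hle hne => ?_⟩
  · simpa using he ⟨M, hM, hIM⟩
  · simpa [hne] using he ⟨N, hN, hle⟩

variable {A}

/-- The restriction `x ↦ ψ(e ⊗ x)` of `ψ` to `e ⊗ h'`. -/
def restrictFactor (ψ : A ⊗[ℂ] ExtCartan H →ₗ[ℂ] ℂ) (e : A) : DerivedCartan H →ₗ[ℂ] ℂ :=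
  ψ ∘ₗ TensorProduct.mk ℂ A (ExtCartan H) e ∘ₗ LinearMap.inl ℂ (DerivedCartan H) (ℂ × ℂ)

/-- For `ψ` vanishing on `J ⊗ h'`, where `J` is the radical of a cofinite ideal: the restriction
of `ψ` to each factor of `A ⧸ J ⊗ h' = ⊕ᵢ h'ᵢ` is dominant integral. -/
def IsDominantIntegralWrt (b : (rootSystem H).Base) (ψ : A ⊗[ℂ] ExtCartan H →ₗ[ℂ] ℂ)
    (J : Ideal A) : Prop :=
  ∀ M : Ideal A, M.IsMaximal → J ≤ M → ∀ e : A, IsFactorUnit J M e →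
    IsDominantIntegral B b (restrictFactor ψ e)

end DominantIntegral

end Modules

end LoopAffineVirasoro

end

/-! Let `v` be the highest weight vector of `V = V(ψ)`. Irreducibility is used through one criterion
(`eq_bot_of_borel_stable`): a subspace that is stable under `A ⊗ (h̄ ⊕ 𝔏⁺)` and lies in degrees
strictly below that of `v` is zero, since the submodule it generates stays in those degrees. That
this submodule is reached by negative elements alone follows from `exists_stable_of_triangular`,
which plays the role of the PBW theorem.

For an ideal `J` of `A` and a graded ideal `P` of `𝔏`, the criterion applied to `(J ⊗ P)v` shows
that `J ⊗ P` acts by zero as soon as `ψ` kills `J ⊗ (P ∩ h̄)` (`apply_eq_zero_of_ideal`). So `I ⊗ 𝔏`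
acts by zero, and `√I` tensored with the affine part `g ⊗ ℂ[t, t⁻¹] ⊕ ℂ K` does too. By the first
fact, `V` is spanned by words in negative elements with coefficients from a finite dimensional
subspace of `A`. The words of a given principal degree span a finite dimensional space, which bounds
the weight spaces.

By the second fact, the affine part acts through `A/√I`, a finite product of copies of `ℂ`: `a ⊗ X`
acts as the sum of the commuting operators `χ_M(a) (e_M ⊗ X)`. Hence local nilpotency is needed only
for `e ⊗ X` with `e` one of the `e_M`. The action of these elements is that of one affine Lie
algebra, for which `v` has a dominant integral weight. For an affine simple root with negative root
vector `F`, the vector `F^(k+1) v` is killed by all of `A ⊗ 𝔏⁺`, hence is zero by the criterion. As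
`ad F` is locally nilpotent, `F` is then locally nilpotent on all of `V`.

For the other real roots, call a direction `γ` bounded if each `μ + N γ` is a weight for finitely
many `N` only. Positive roots are bounded, a root vector of bounded weight is locally nilpotent, and
by `sl₂` theory the reflection in a real root whose two root vectors are locally nilpotent preserves
bounded directions (`isBoundedDirection_reflect`). The reflections in `θ` and `δ - θ` compose to a
translation along `δ` that carries every root not orthogonal to `θ` to positive level.
Irreducibility of the root system takes care of the roots orthogonal to `θ`. -/

noncomputable section

namespace LoopAffineVirasoro

/-! ### Locally nilpotent operators and stable subspaces. -/

section LinearAlgebra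

attribute [local instance 100] LieRing.ofAssociativeRing

variable {V : Type*} [AddCommGroup V] [Module ℂ V]

/-- An operator is locally nilpotent if each vector is killed by one of its powers. -/
def IsLocNilpotent (E : Module.End ℂ V) : Prop := ∀ w : V, ∃ N : ℕ, (E ^ N) w = 0

theorem pow_apply_eq_zero_of_le {E : Module.End ℂ V} {w : V} {m n : ℕ} (hmn : m ≤ n)
    (h : (E ^ m) w = 0) : (E ^ n) w = 0 := by
  obtain ⟨k, rfl⟩ := Nat.exists_eq_add_of_le' hmn
  rw [pow_add, Module.End.mul_apply, h, map_zero]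

theorem IsLocNilpotent.add {S T : Module.End ℂ V} (hS : IsLocNilpotent S) (hT : IsLocNilpotent T)
    (hST : Commute S T) : IsLocNilpotent (S + T) := by
  intro w
  obtain ⟨m, hm⟩ := hS w
  obtain ⟨n, hn⟩ := hT w
  refine ⟨m + n, ?_⟩
  rw [hST.add_pow', LinearMap.sum_apply]
  refine Finset.sum_eq_zero fun p hp => ?_
  rw [Finset.HasAntidiagonal.mem_antidiagonal] at hp
  rw [LinearMap.smul_apply]
  rcases le_or_gt n p.2 with h | h
  · rw [Module.End.mul_apply, pow_apply_eq_zero_of_le h hn, map_zero, smul_zero]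
  · rw [(hST.pow_pow p.1 p.2).eq, Module.End.mul_apply,
      pow_apply_eq_zero_of_le (by omega : m ≤ p.1) hm, map_zero, smul_zero]

theorem IsLocNilpotent.smul {S : Module.End ℂ V} (hS : IsLocNilpotent S) (r : ℂ) :
    IsLocNilpotent (r • S) := by
  intro w
  obtain ⟨m, hm⟩ := hS w
  exact ⟨m, by rw [smul_pow, LinearMap.smul_apply, hm, smul_zero]⟩

theorem isLocNilpotent_zero : IsLocNilpotent (0 : Module.End ℂ V) := fun w => ⟨1, by simp⟩

/-- The vectors killed by a power of `E` form a subspace that is stable under each operator killed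
by a power of `ad E`. -/
theorem mem_maxGenEigenspace_of_ad_pow {E X : Module.End ℂ V} {w : V}
    (hX : ∃ n : ℕ, ((LieAlgebra.ad ℂ (Module.End ℂ V) E) ^ n) X = 0)
    (hw : w ∈ E.maxGenEigenspace 0) : X w ∈ E.maxGenEigenspace 0 := by
  have h1 : X ∈ ((LieModule.toEnd ℂ (Module.End ℂ V) (Module.End ℂ V)) E).maxGenEigenspace 0 := by
    rw [Module.End.mem_maxGenEigenspace]
    obtain ⟨n, hn⟩ := hX
    exact ⟨n, by rw [zero_smul, sub_zero]; exact hn⟩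
  -- By the Leibniz formula generalized eigenvalues add up, here `0 + 0`.
  have h2 := LieModule.lie_mem_maxGenEigenspace_toEnd (R := ℂ) (L := Module.End ℂ V)
    (M := V) (x := E) (y := X) (m := w) (χ₁ := 0) (χ₂ := 0) h1 hw
  simpa using h2

/-- Let `𝓛 = N + b`. If `W` is stable under `b`, then the smallest subspace that contains `W` and is
stable under `N` is stable under `𝓛`. -/
theorem exists_stable_of_triangular {𝓛 : Type*} [LieRing 𝓛] [LieAlgebra ℂ 𝓛]
    (ρ : 𝓛 →ₗ⁅ℂ⁆ Module.End ℂ V) (N b : Submodule ℂ 𝓛) (hNb : N ⊔ b = ⊤) (W T : Submodule ℂ V)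
    (hW : ∀ x ∈ b, ∀ w ∈ W, ρ x w ∈ W) (hWT : W ≤ T) (hT : ∀ x ∈ N, ∀ w ∈ T, ρ x w ∈ T) :
    ∃ U : Submodule ℂ V, W ≤ U ∧ U ≤ T ∧ ∀ x, ∀ u ∈ U, ρ x u ∈ U := by
  let S : Set (Submodule ℂ V) := {T | W ≤ T ∧ ∀ x ∈ N, ∀ w ∈ T, ρ x w ∈ T}
  have hWU : W ≤ sInf S := le_sInf fun T hT => hT.1
  have hNU : ∀ x ∈ N, ∀ w ∈ sInf S, ρ x w ∈ sInf S := fun x hx w hw =>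
    (Submodule.mem_sInf).2 fun T hT => hT.2 x hx w ((Submodule.mem_sInf).1 hw T hT)
  -- `sInf S` is the smallest `N`-stable subspace containing `W`. The vectors of it that `b` does
  -- not move out form another member of `S`, hence are all of it. Neither `N` nor `b` has to be a
  -- subalgebra: `⁅y, x⁆` is only split along `N ⊔ b`.
  let U' : Submodule ℂ V :=
    { carrier := {u | u ∈ sInf S ∧ ∀ x ∈ b, ρ x u ∈ sInf S}
      add_mem' := fun hu hw => ⟨add_mem hu.1 hw.1, fun x hx => by
        rw [map_add]; exact add_mem (hu.2 x hx) (hw.2 x hx)⟩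
      zero_mem' := ⟨zero_mem _, fun x _ => by rw [map_zero]; exact zero_mem _⟩
      smul_mem' := fun r u hu => ⟨Submodule.smul_mem _ r hu.1, fun x hx => by
        rw [map_smul]; exact Submodule.smul_mem _ r (hu.2 x hx)⟩ }
  have hU' : sInf S ≤ U' := by
    refine sInf_le ⟨fun w hw => ⟨hWU hw, fun x hx => hWU (hW x hx w hw)⟩, ?_⟩
    rintro x hx u ⟨hu, hbu⟩
    refine ⟨hNU x hx u hu, fun y hy => ?_⟩
    have e : ρ y (ρ x u) = ρ ⁅y, x⁆ u + ρ x (ρ y u) := by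
      rw [LieHom.map_lie, Ring.lie_def, LinearMap.sub_apply]; simp
    rw [e]
    refine add_mem ?_ (hNU x hx _ (hbu y hy))
    obtain ⟨n, hn, z, hz, h⟩ := Submodule.mem_sup.1 (hNb.symm ▸ Submodule.mem_top : ⁅y, x⁆ ∈ N ⊔ b)
    rw [← h, map_add, LinearMap.add_apply]
    exact add_mem (hNU n hn u hu) (hbu z hz)
  refine ⟨sInf S, hWU, sInf_le ⟨hWT, hT⟩, fun x u hu => ?_⟩
  obtain ⟨n, hn, z, hz, rfl⟩ := Submodule.mem_sup.1 (hNb.symm ▸ Submodule.mem_top : x ∈ N ⊔ b)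
  rw [map_add, LinearMap.add_apply]
  exact add_mem (hNU n hn u hu) ((hU' hu).2 z hz)

/-! ### Strings in locally nilpotent `sl₂`-modules. -/

section Sl2

variable {E F Z : Module.End ℂ V}

theorem apply_pow_of_weight (hZF : ⁅Z, F⁆ = -((2 : ℂ) • F)) {w : V} {z : ℂ} (hw : Z w = z • w)
    (n : ℕ) : Z ((F ^ n) w) = (z - 2 * n) • (F ^ n) w := by
  induction n with
  | zero => simpa using hw
  | succ n ih =>
    have e : Z (F ((F ^ n) w)) = ⁅Z, F⁆ ((F ^ n) w) + F (Z ((F ^ n) w)) := by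
      rw [Ring.lie_def, LinearMap.sub_apply]; simp
    rw [pow_succ', Module.End.mul_apply, e, ih, hZF, map_smul, LinearMap.neg_apply,
      LinearMap.smul_apply, ← neg_smul, ← add_smul]
    congr 1; push_cast; ring

theorem apply_pow_succ_of_primitive (hEF : ⁅E, F⁆ = Z) (hZF : ⁅Z, F⁆ = -((2 : ℂ) • F)) {w : V}
    {z : ℂ} (hw : Z w = z • w) (hE : E w = 0) (n : ℕ) :
    E ((F ^ (n + 1)) w) = ((n + 1) * (z - n)) • (F ^ n) w := by
  induction n with
  | zero =>
    have e : E (F w) = ⁅E, F⁆ w + F (E w) := by rw [Ring.lie_def, LinearMap.sub_apply]; simp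
    simp [e, hEF, hw, hE]
  | succ n ih =>
    have e : E (F ((F ^ (n + 1)) w)) = ⁅E, F⁆ ((F ^ (n + 1)) w) + F (E ((F ^ (n + 1)) w)) := by
      rw [Ring.lie_def, LinearMap.sub_apply]; simp
    rw [pow_succ', Module.End.mul_apply, e, ih, hEF, apply_pow_of_weight hZF hw, map_smul,
      ← Module.End.mul_apply, ← pow_succ', ← add_smul]
    congr 1; push_cast; ring

/-- The last nonzero `E ^ r w` is primitive of weight `z + 2r`. If `F ^ k` is the last power of `F`
not killing it, then `E F^(k+1) = 0` on it, and `apply_pow_succ_of_primitive` forces `z + 2r = k`.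
No finite dimensionality is involved. -/
theorem exists_nat_of_isLocNilpotent (hEF : ⁅E, F⁆ = Z) (hZE : ⁅Z, E⁆ = (2 : ℂ) • E)
    (hZF : ⁅Z, F⁆ = -((2 : ℂ) • F)) (hE : IsLocNilpotent E) (hF : IsLocNilpotent F) {w : V} {z : ℂ}
    (hw0 : w ≠ 0) (hw : Z w = z • w) :
    ∃ r k : ℕ, z + 2 * r = k ∧ ∀ s ≤ k, (F ^ s) ((E ^ r) w) ≠ 0 := by
  obtain ⟨r, hr, hr'⟩ := Nat.exists_not_and_succ_of_not_zero_of_exists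
    (p := fun n => (E ^ n) w = 0) (by simpa using hw0) (hE w)
  obtain ⟨k, hk, hk'⟩ := Nat.exists_not_and_succ_of_not_zero_of_exists
    (p := fun n => (F ^ n) ((E ^ r) w) = 0) (by simpa using hr) (hF _)
  -- Relative to `-Z`, the operator `E` is the lowering one.
  have hZ : (-Z) ((E ^ r) w) = (-z - 2 * r) • (E ^ r) w :=
    apply_pow_of_weight (by rw [neg_lie, hZE]) (by rw [LinearMap.neg_apply, hw, neg_smul]) r
  have hZ' : Z ((E ^ r) w) = (z + 2 * r) • (E ^ r) w := by
    rw [LinearMap.neg_apply, neg_eq_iff_eq_neg, ← neg_smul] at hZ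
    rw [hZ]; congr 1; ring
  have hE' : E ((E ^ r) w) = 0 := by rwa [← Module.End.mul_apply, ← pow_succ']
  have h := apply_pow_succ_of_primitive hEF hZF hZ' hE' k
  rw [hk', map_zero, eq_comm, smul_eq_zero_iff_left hk, mul_eq_zero, sub_eq_zero] at h
  exact ⟨r, k, h.resolve_left (Nat.cast_add_one_ne_zero k),
    fun s hs hs' => hk (pow_apply_eq_zero_of_le hs hs')⟩

/-- In a module on which `E` and `F` act locally nilpotently, a weight vector of weight `z` gives a
nonzero vector of the reflected weight. -/
theorem exists_reflect_ne_zero (hEF : ⁅E, F⁆ = Z) (hZE : ⁅Z, E⁆ = (2 : ℂ) • E)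
    (hZF : ⁅Z, F⁆ = -((2 : ℂ) • F)) (hE : IsLocNilpotent E) (hF : IsLocNilpotent F) {w : V} {z : ℂ}
    (hw0 : w ≠ 0) (hw : Z w = z • w) :
    ∃ r s : ℕ, ((s : ℂ) - r = z ∧ (F ^ s) ((E ^ r) w) ≠ 0) ∨
      ((r : ℂ) - s = z ∧ (E ^ s) ((F ^ r) w) ≠ 0) := by
  obtain ⟨r, k, hk, hne⟩ := exists_nat_of_isLocNilpotent hEF hZE hZF hE hF hw0 hw
  rcases le_or_gt r k with hrk | hrk
  · refine ⟨r, k - r, Or.inl ⟨?_, hne _ (Nat.sub_le k r)⟩⟩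
    rw [Nat.cast_sub hrk]; linear_combination -hk
  -- If `k < r`, the string through `w` is too short on this side, and the triple `(F, E, -Z)` is
  -- used. Adding the two weight equations gives `k + k' = 2r + 2r'`, so now `r' ≤ k'`.
  · obtain ⟨r', k', hk', hne'⟩ := exists_nat_of_isLocNilpotent (E := F) (F := E) (Z := -Z)
      (by rw [← lie_skew, hEF]) (by rw [neg_lie, hZF, neg_neg]) (by rw [neg_lie, hZE]) hF hE hw0
      (z := -z) (by rw [LinearMap.neg_apply, hw, neg_smul])
    have h1 : ((k + k' : ℕ) : ℂ) = ((2 * r + 2 * r' : ℕ) : ℂ) := by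
      push_cast; linear_combination -hk - hk'
    have h2 : k + k' = 2 * r + 2 * r' := by exact_mod_cast h1
    have h3 : r' ≤ k' := by omega
    refine ⟨r', k' - r', Or.inr ⟨?_, hne' _ (Nat.sub_le k' r')⟩⟩
    rw [Nat.cast_sub h3]; linear_combination hk'

end Sl2

end LinearAlgebra

/-! ### Heights and the highest root of `g`. -/

section Roots

open LieAlgebra.IsKilling LieAlgebra

attribute [local instance 100] LieRing.ofAssociativeRing

variable {g : Type*} [LieRing g] [LieAlgebra ℂ g] [FiniteDimensional ℂ g] [LieAlgebra.IsSimple ℂ g]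
  {H : LieSubalgebra ℂ g} [H.IsCartanSubalgebra] (b : (rootSystem H).Base)

theorem isPos_or_exists_eq_neg (i : H.root) :
    b.IsPos i ∨ ∃ j, b.IsPos j ∧ (rootSystem H).root i = -(rootSystem H).root j := by
  let := (rootSystem H).indexNeg
  rcases RootPairing.Base.IsPos.or_neg b i with h | h
  · exact Or.inl h
  · refine Or.inr ⟨-i, h, ?_⟩
    change _ = -(rootSystem H).root ((rootSystem H).reflectionPerm i i)
    rw [RootPairing.root_reflectionPerm, RootPairing.reflection_apply_self, neg_neg]

theorem exists_root_eq_neg (i : H.root) :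
    ∃ j, (rootSystem H).root j = -(rootSystem H).root i ∧ b.height j = -b.height i := by
  let := (rootSystem H).indexNeg
  refine ⟨-i, ?_, b.height_reflectionPerm_self i⟩
  change (rootSystem H).root ((rootSystem H).reflectionPerm i i) = _
  rw [RootPairing.root_reflectionPerm, RootPairing.reflection_apply_self]

theorem exists_root_eq_sum_of_isPos {i : H.root} (hi : b.IsPos i) :
    ∃ f : H.root → ℕ, (rootSystem H).root i = ∑ j ∈ b.support, f j • (rootSystem H).root j ∧
      b.height i = ∑ j ∈ b.support, (f j : ℤ) := by
  obtain ⟨f, -, hf, hsum⟩ := b.exists_root_eq_sum_int i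
  have hht := b.height_eq_sum hsum
  have hf0 : 0 ≤ f := by
    rcases hf with hf | hf
    · exact hf.le
    · have : b.height i ≤ 0 := hht ▸ Finset.sum_nonpos fun j _ => hf.le j
      exact absurd hi (not_lt.mpr this)
  refine ⟨fun j => (f j).toNat, ?_, ?_⟩
  · rw [hsum]
    refine Finset.sum_congr rfl fun j _ => ?_
    rw [← natCast_zsmul, Int.toNat_of_nonneg (hf0 j)]
  · rw [hht]
    exact Finset.sum_congr rfl fun j _ => (Int.toNat_of_nonneg (hf0 j)).symm

theorem root_mem_closure_of_isPos {i : H.root} (hi : b.IsPos i) :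
    (rootSystem H).root i ∈ AddSubmonoid.closure ((rootSystem H).root '' b.support) := by
  obtain ⟨f, hf, -⟩ := exists_root_eq_sum_of_isPos b hi
  rw [hf]
  exact sum_mem fun j hj => nsmul_mem (AddSubmonoid.subset_closure (Set.mem_image_of_mem _ hj)) _

theorem exists_apply_simpleRoot_eq (f : H.root → ℂ) :
    ∃ h : H, ∀ j ∈ b.support, (rootSystem H).root j h = f j := by
  refine ⟨(Module.evalEquiv ℂ H).symm (b.toWeightBasis.constr ℂ fun j : b.support => f j),
    fun j hj => ?_⟩
  rw [Module.apply_evalEquiv_symm_apply]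
  have := b.toWeightBasis.constr_basis ℂ (fun j : b.support => f j) ⟨j, hj⟩
  simpa using this

/-- The element `ρ^∨`, on which each root takes its height as value. -/
theorem exists_apply_root_eq_height :
    ∃ h : H, ∀ i, (rootSystem H).root i h = b.height i := by
  obtain ⟨h, hh⟩ := exists_apply_simpleRoot_eq b fun _ => 1
  refine ⟨h, fun i => ?_⟩
  obtain ⟨f, -, -, hsum⟩ := b.exists_root_eq_sum_int i
  rw [b.height_eq_sum hsum, hsum, LinearMap.sum_apply]
  push_cast
  refine Finset.sum_congr rfl fun j hj => ?_
  rw [LinearMap.smul_apply, hh j hj]; simp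

/-- An element on which the simple root `j` vanishes and every other positive root takes a positive
value, at most its height. -/
theorem exists_parabolic_element {j : H.root} (hj : j ∈ b.support) :
    ∃ h : H, (rootSystem H).root j h = 0 ∧ ∀ i, b.IsPos i → ∃ n : ℕ,
      (rootSystem H).root i h = n ∧ (n : ℤ) ≤ b.height i ∧ (n = 0 → i = j) := by
  classical
  -- This `h` counts the simple summands other than `j`. A positive root with count `0` is a
  -- multiple of the root `j`, hence equal to it.
  obtain ⟨h, hh⟩ := exists_apply_simpleRoot_eq b fun k => if k = j then 0 else 1
  refine ⟨h, by simpa using hh j hj, fun i hi => ?_⟩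
  obtain ⟨f, hf, hht⟩ := exists_root_eq_sum_of_isPos b hi
  refine ⟨∑ k ∈ b.support, if k = j then 0 else f k, ?_, ?_, fun h0 => ?_⟩
  · rw [hf, LinearMap.sum_apply]
    push_cast
    refine Finset.sum_congr rfl fun k hk => ?_
    rw [LinearMap.smul_apply, hh k hk]
    split_ifs <;> simp
  · rw [hht]
    push_cast
    refine Finset.sum_le_sum fun k _ => ?_
    split_ifs <;> simp
  · have h1 : ∀ k ∈ b.support, k ≠ j → f k = 0 := fun k hk hkj => by
      simpa [hkj] using (Finset.sum_eq_zero_iff.mp h0) k hk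
    have h2 : (rootSystem H).root i = (f j : ℂ) • (rootSystem H).root j := by
      rw [hf, Finset.sum_eq_single_of_mem j hj fun k hk hkj => by rw [h1 k hk hkj, zero_smul],
        Nat.cast_smul_eq_nsmul]
    have : IsAddTorsionFree (Module.Dual ℂ H) := .of_isTorsionFree ℂ _
    have : IsAddTorsionFree H := .of_isTorsionFree ℂ _
    rcases b.eq_one_or_neg_one_of_mem_support_of_smul_mem j hj (f j) ⟨i, h2⟩ with h3 | h3
    · rw [h3, one_smul] at h2
      exact (rootSystem H).root.injective h2
    · have h4 : ((f j + 1 : ℕ) : ℂ) = ((0 : ℕ) : ℂ) := by push_cast; rw [h3]; ring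
      have h5 : f j + 1 = 0 := by exact_mod_cast h4
      omega

theorem nonempty_root : Nonempty H.root := by
  have := (inferInstance : (rootSystem H).IsIrreducible)
  have := this.nontrivial
  by_contra hne
  rw [not_nonempty_iff] at hne
  have h1 := RootPairing.IsRootSystem.span_root_eq_top (P := rootSystem H)
  rw [Set.range_eq_empty, Submodule.span_empty] at h1
  exact bot_ne_top h1

theorem iSup_rootSpace_induction {p : g → Prop} (hadd : ∀ x y, p x → p y → p (x + y))
    (h : ∀ χ : LieModule.Weight ℂ H g, ∀ x ∈ rootSpace H χ, p x) (x : g) : p x := by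
  have hx : x ∈ ⨆ χ : LieModule.Weight ℂ H g, rootSpace H χ := by
    rw [LieModule.iSup_genWeightSpace_eq_top']; trivial
  induction hx using LieSubmodule.iSup_induction' with
  | zero => exact h (nonempty_root (H := H)).some.1 0 (zero_mem _)
  | mem χ x hx => exact h χ x hx
  | add x y _ _ hx hy => exact hadd x y hx hy

theorem weight_eq_zero_or_root (χ : LieModule.Weight ℂ H g) :
    χ.toLinear = 0 ∨ ∃ i : H.root, (rootSystem H).root i = χ.toLinear := by
  by_cases h : χ.IsZero
  · left; ext x; simp [h.eq]
  · right
    exact ⟨⟨χ, by simpa using h⟩, rfl⟩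

/-- Take `θ` of maximal height. In the adjoint representation its root space is stable under the
Borel subalgebra, so what it generates under the negative root vectors is an ideal with all weights
in `θ - Q`. By simplicity this ideal is `g`, and since root spaces are independent, every root is
one of these weights. -/
theorem exists_isHighestRoot : ∃ θ : H.root, IsHighestRoot b θ := by
  obtain ⟨θ, hθ⟩ := @Finite.exists_max _ _ _ (nonempty_root (H := H)) _ (fun i => b.height i)
  refine ⟨θ, fun β => ?_⟩
  set Q := AddSubmonoid.closure ((rootSystem H).root '' b.support)
  let N : Submodule ℂ g := Submodule.span ℂ
    {x | ∃ i, b.IsPos i ∧ x ∈ rootSpace H (-(rootSystem H).root i)}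
  let bb : Submodule ℂ g := Submodule.span ℂ
    {x | x ∈ H ∨ ∃ i, b.IsPos i ∧ x ∈ rootSpace H ((rootSystem H).root i)}
  let T : Submodule ℂ g := Submodule.span ℂ
    {x | ∃ χ : LieModule.Weight ℂ H g, (rootSystem H).root θ - χ.toLinear ∈ Q ∧ x ∈ rootSpace H χ}
  have hNb : N ⊔ bb = ⊤ := by
    rw [eq_top_iff]
    rintro x -
    refine iSup_rootSpace_induction (H := H) (fun x y => add_mem) (fun χ x hx => ?_) x
    rcases weight_eq_zero_or_root χ with h | ⟨i, hi⟩
    · refine le_sup_right (a := N) (Submodule.subset_span (Or.inl ?_))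
      have h' : (χ : H → ℂ) = 0 := by ext y; exact LinearMap.congr_fun h y
      rw [h'] at hx
      simpa using hx
    · have h' : (χ : H → ℂ) = (rootSystem H).root i := by rw [hi]; rfl
      rw [h'] at hx
      rcases isPos_or_exists_eq_neg b i with hp | ⟨j, hj, hij⟩
      · exact le_sup_right (a := N) (Submodule.subset_span (Or.inr ⟨i, hp, hx⟩))
      · exact le_sup_left (b := bb) (Submodule.subset_span ⟨j, hj, by rw [hij] at hx; exact hx⟩)
  have hW : ∀ x ∈ bb, ∀ w ∈ (rootSpace H ((rootSystem H).root θ)).toSubmodule,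
      LieAlgebra.ad ℂ g x w ∈ (rootSpace H ((rootSystem H).root θ)).toSubmodule := by
    intro x hx w hw
    induction hx using Submodule.span_induction with
    | zero => simp
    | add x y _ _ hx hy => rw [map_add]; exact add_mem hx hy
    | smul r x _ hx => rw [map_smul]; exact Submodule.smul_mem _ r hx
    | mem x hx =>
      rcases hx with hx | ⟨i, hi, hx⟩
      · exact LieSubmodule.lie_mem (x := (⟨x, hx⟩ : H)) _ hw
      · have h1 : ⁅x, w⁆ ∈ rootSpace H (((rootSystem H).root i : H → ℂ) + (rootSystem H).root θ) :=
          LieAlgebra.lie_mem_genWeightSpace_of_mem_genWeightSpace hx hw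
        by_cases h2 : rootSpace H (((rootSystem H).root i : H → ℂ) + (rootSystem H).root θ) = ⊥
        · rw [h2] at h1
          rw [LieAlgebra.ad_apply, (LieSubmodule.mem_bot _).1 h1]
          exact zero_mem _
        · exfalso
          let χ : LieModule.Weight ℂ H g := ⟨_, h2⟩
          have hχ : χ.toLinear = (rootSystem H).root i + (rootSystem H).root θ := by
            ext y; rfl
          obtain ⟨hρ, hhρ⟩ := exists_apply_root_eq_height b
          have hpos : 0 < b.height i := hi
          have hθpos : 0 < b.height θ := lt_of_lt_of_le hpos (hθ i)
          -- The weight `i + θ` has height greater than that of `θ`, which is positive. It can be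
          -- neither `0` nor a root.
          rcases weight_eq_zero_or_root χ with h | ⟨k, hk⟩
          · rw [h] at hχ
            have := LinearMap.congr_fun hχ hρ
            rw [LinearMap.add_apply, hhρ, hhρ, LinearMap.zero_apply] at this
            have h3 : (0 : ℤ) = b.height i + b.height θ := by exact_mod_cast this
            omega
          · have h3 := b.height_add (hk.trans hχ)
            have h4 := hθ k
            omega
  have hWT : (rootSpace H ((rootSystem H).root θ)).toSubmodule ≤ T := fun x hx =>
    Submodule.subset_span ⟨θ.1, by
      have : (rootSystem H).root θ - θ.1.toLinear = 0 := sub_self _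
      rw [this]; exact zero_mem _, hx⟩
  have hT : ∀ x ∈ N, ∀ w ∈ T, LieAlgebra.ad ℂ g x w ∈ T := by
    intro x hx w hw
    induction hx using Submodule.span_induction with
    | zero => simp
    | add x y _ _ hx hy => rw [map_add]; exact add_mem hx hy
    | smul r x _ hx => rw [map_smul]; exact Submodule.smul_mem _ r hx
    | mem x hx =>
      obtain ⟨i, hi, hx⟩ := hx
      induction hw using Submodule.span_induction with
      | zero => simp
      | add x y _ _ hx hy => rw [map_add]; exact add_mem hx hy
      | smul r x _ hx => rw [map_smul]; exact Submodule.smul_mem _ r hx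
      | mem w hw =>
        obtain ⟨χ, hχ, hw⟩ := hw
        have h1 : ⁅x, w⁆ ∈ rootSpace H (-((rootSystem H).root i : H → ℂ) + χ) :=
          LieAlgebra.lie_mem_genWeightSpace_of_mem_genWeightSpace hx hw
        by_cases h2 : rootSpace H (-((rootSystem H).root i : H → ℂ) + χ) = ⊥
        · rw [h2] at h1
          rw [LieAlgebra.ad_apply, (LieSubmodule.mem_bot _).1 h1]
          exact zero_mem _
        · let χ' : LieModule.Weight ℂ H g := ⟨_, h2⟩
          have hχ' : χ'.toLinear = -(rootSystem H).root i + χ.toLinear := by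
            ext y; rfl
          refine Submodule.subset_span ⟨χ', ?_, h1⟩
          rw [hχ', show ∀ a b c : Module.Dual ℂ H, a - (-b + c) = (a - c) + b by intros; abel]
          exact add_mem hχ (root_mem_closure_of_isPos b hi)
  obtain ⟨U, hWU, hUT, hU⟩ := exists_stable_of_triangular (LieAlgebra.ad ℂ g) N bb hNb
    (rootSpace H ((rootSystem H).root θ)).toSubmodule T hW hWT hT
  let U' : LieIdeal ℂ g := { U with lie_mem := fun {x m} hm => hU x m hm }
  have hUtop : U = ⊤ := by
    rcases LieAlgebra.IsSimple.eq_bot_or_eq_top (R := ℂ) U' with h | h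
    · exfalso
      obtain ⟨x, hx, hx0⟩ := θ.1.exists_ne_zero
      have : x ∈ U' := hWU hx
      rw [h] at this
      exact hx0 ((LieSubmodule.mem_bot _).1 this)
    · have : U'.toSubmodule = ⊤ := by rw [h]; rfl
      exact this
  by_contra hβ
  have hind := LieModule.iSupIndep_genWeightSpace' ℂ H g β.1
  have hle : rootSpace H β.1 ≤ ⨆ χ, ⨆ (_ : χ ≠ β.1), rootSpace H (χ : LieModule.Weight ℂ H g) := by
    intro x _
    have hxT : x ∈ T := hUT (hUtop ▸ Submodule.mem_top)
    have hTle : T ≤ (⨆ χ, ⨆ (_ : χ ≠ β.1),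
        rootSpace H (χ : LieModule.Weight ℂ H g)).toSubmodule := by
      refine Submodule.span_le.2 ?_
      rintro y ⟨χ, hχ, hy⟩
      refine (le_iSup₂ (f := fun (χ : LieModule.Weight ℂ H g) (_ : χ ≠ β.1) => rootSpace H χ)
        χ ?_) hy
      rintro rfl
      exact hβ hχ
    exact hTle hxT
  exact β.1.2 (disjoint_self.1 (hind.mono_right hle))

/-- Pairing with `ρ^∨` counts the simple summands of an element of the closure, and an empty sum is
`0`. -/
theorem IsHighestRoot.height_le {θ : H.root} (hθ : IsHighestRoot b θ) (i : H.root) :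
    ∃ n : ℕ, (b.height θ : ℤ) - b.height i = n ∧
      (n = 0 → (rootSystem H).root i = (rootSystem H).root θ) := by
  obtain ⟨hρ, hhρ⟩ := exists_apply_root_eq_height b
  have key : ∀ x ∈ AddSubmonoid.closure ((rootSystem H).root '' b.support),
      ∃ n : ℕ, x hρ = n ∧ (n = 0 → x = 0) := by
    intro x hx
    induction hx using AddSubmonoid.closure_induction with
    | zero => exact ⟨0, by simp⟩
    | add x y _ _ hx hy =>
      obtain ⟨n, hn, hn'⟩ := hx
      obtain ⟨m, hm, hm'⟩ := hy
      refine ⟨n + m, by rw [LinearMap.add_apply, hn, hm]; push_cast; ring, fun h => ?_⟩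
      rw [hn' (by omega), hm' (by omega), add_zero]
    | mem x hx =>
      obtain ⟨j, hj, rfl⟩ := hx
      exact ⟨1, by rw [hhρ, b.height_one_of_mem_support hj]; simp, by simp⟩
  obtain ⟨n, hn, hn'⟩ := key _ (hθ i)
  refine ⟨n, ?_, fun h => (sub_eq_zero.1 (hn' h)).symm⟩
  rw [LinearMap.sub_apply, hhρ, hhρ] at hn
  exact_mod_cast hn

theorem IsHighestRoot.isPos {θ : H.root} (hθ : IsHighestRoot b θ) : b.IsPos θ := by
  obtain ⟨j, hj, hj'⟩ := exists_root_eq_neg b θ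
  obtain ⟨n, hn, -⟩ := hθ.height_le b j
  have := b.height_ne_zero θ
  have h : 0 ≤ b.height θ := by omega
  exact lt_of_le_of_ne h (Ne.symm this)

end Roots

/-! ### Homogeneous elements of `AffVir B` and their weights. -/

section Letters

set_option linter.unusedSectionVars false

open LieAlgebra.IsKilling LieAlgebra

attribute [local instance 100] LieRing.ofAssociativeRing

variable {g : Type*} [LieRing g] [LieAlgebra ℂ g] [FiniteDimensional ℂ g] [LieAlgebra.IsSimple ℂ g]
  (B : InvariantForm g) {H : LieSubalgebra ℂ g} [H.IsCartanSubalgebra]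

/-- The homogeneous elements `x ⊗ tᵐ` (with `x` in a root space or in `H`), `dₘ`, `K` and `C` of
`AffVir B`, with their weights. -/
inductive IsHomogeneous : Module.Dual ℂ H → ℤ → AffVir B → Prop
  | loop (χ : LieModule.Weight ℂ H g) (m : ℤ) (x : g) (hx : x ∈ rootSpace H χ) :
    IsHomogeneous χ.toLinear m (AffVir.loop B m x)
  | d (m : ℤ) : IsHomogeneous 0 m (AffVir.d B m)
  | K : IsHomogeneous 0 0 (AffVir.K B)
  | C : IsHomogeneous 0 0 (AffVir.C B)

variable {B}

theorem homogeneous_induction (H : LieSubalgebra ℂ g) [H.IsCartanSubalgebra] {p : AffVir B → Prop}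
    (hzero : p 0) (hadd : ∀ X Y, p X → p Y → p (X + Y)) (hsmul : ∀ (r : ℂ) X, p X → p (r • X))
    (h : ∀ (wt : Module.Dual ℂ H) m X, IsHomogeneous B wt m X → p X) (X : AffVir B) : p X := by
  have hloop : ∀ f : ℤ →₀ g, p ⟨f, 0, 0, 0⟩ := by
    intro f
    induction f using Finsupp.induction_linear with
    | zero => exact hzero
    | add f f' hf hf' =>
      have e : (⟨f + f', 0, 0, 0⟩ : AffVir B) = ⟨f, 0, 0, 0⟩ + ⟨f', 0, 0, 0⟩ := by ext1 <;> simp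
      rw [e]; exact hadd _ _ hf hf'
    | single m x =>
      refine iSup_rootSpace_induction (H := H) (p := fun x => p ⟨Finsupp.single m x, 0, 0, 0⟩)
        (fun x y hx hy => ?_) (fun χ x hx => h _ _ _ (IsHomogeneous.loop χ m x hx)) x
      have e : (⟨Finsupp.single m (x + y), 0, 0, 0⟩ : AffVir B) =
        ⟨Finsupp.single m x, 0, 0, 0⟩ + ⟨Finsupp.single m y, 0, 0, 0⟩ := by ext1 <;> simp
      rw [e]; exact hadd _ _ hx hy
  have hvir : ∀ u : ℤ →₀ ℂ, p ⟨0, 0, u, 0⟩ := by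
    intro u
    induction u using Finsupp.induction_linear with
    | zero => exact hzero
    | add f f' hf hf' =>
      have e : (⟨0, 0, f + f', 0⟩ : AffVir B) = ⟨0, 0, f, 0⟩ + ⟨0, 0, f', 0⟩ := by ext1 <;> simp
      rw [e]; exact hadd _ _ hf hf'
    | single m r =>
      have e : (⟨0, 0, Finsupp.single m r, 0⟩ : AffVir B) = r • AffVir.d B m := by ext1 <;> simp
      rw [e]; exact hsmul _ _ (h _ _ _ (IsHomogeneous.d m))
  have e : X = ((⟨X.loopPart, 0, 0, 0⟩ + X.kPart • AffVir.K B) + ⟨0, 0, X.virPart, 0⟩)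
    + X.cPart • AffVir.C B := by ext1 <;> simp
  rw [e]
  exact hadd _ _ (hadd _ _ (hadd _ _ (hloop _) (hsmul _ _ (h _ _ _ IsHomogeneous.K))) (hvir _))
    (hsmul _ _ (h _ _ _ IsHomogeneous.C))

/-- The element `h + c d₀` of `AffVir B`. -/
def gradingElement (B : InvariantForm g) (h : H) (c : ℂ) : AffVir B :=
  AffVir.loop B 0 (h : g) + c • AffVir.d B 0

theorem gradingElement_eq (h : H) (c : ℂ) :
    gradingElement B h c = cartanIncl B ((h, 0), c, 0) := by
  simp [gradingElement, cartanIncl]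

theorem cartanIncl_mk (h : H) (k s c : ℂ) : cartanIncl B ((h, k), s, c) =
    gradingElement B h s + k • AffVir.K B + c • AffVir.C B := by
  simp only [gradingElement, cartanIncl, LinearMap.coe_mk, AddHom.coe_mk]
  abel

theorem IsHomogeneous.lie_gradingElement {wt : Module.Dual ℂ H} {m : ℤ} {X : AffVir B}
    (hX : IsHomogeneous B wt m X) (h : H) (c : ℂ) :
    ⁅gradingElement B h c, X⁆ = (wt h + c * m) • X := by
  rw [gradingElement, add_lie, smul_lie]
  cases hX with
  | loop χ m x hx =>
    have h1 : ⁅(h : g), x⁆ = χ h • x := lie_eq_smul_of_mem_rootSpace hx h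
    rw [AffVir.loop_lie_loop, AffVir.d_lie_loop, h1]
    simp [add_smul, mul_smul]
  | d m =>
    rw [← lie_skew, AffVir.d_lie_loop, AffVir.d_lie_d]
    simp [mul_smul]
  | K => rw [← lie_skew, ← lie_skew (AffVir.d B 0), AffVir.K_lie, AffVir.K_lie]; simp
  | C => rw [← lie_skew, ← lie_skew (AffVir.d B 0), AffVir.C_lie, AffVir.C_lie]; simp

theorem IsHomogeneous.lie_cartanIncl {wt : Module.Dual ℂ H} {m : ℤ} {X : AffVir B}
    (hX : IsHomogeneous B wt m X) (y : ExtCartan H) :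
    ⁅cartanIncl B y, X⁆ = (wt y.1.1 + y.2.1 * m) • X := by
  obtain ⟨⟨h, k⟩, s, c⟩ := y
  rw [cartanIncl_mk, add_lie, add_lie, smul_lie, smul_lie, AffVir.K_lie, AffVir.C_lie,
    hX.lie_gradingElement]
  simp

variable (B) in
/-- The affine part `g ⊗ ℂ[t, t⁻¹] ⊕ ℂ K`. -/
def affinePart : Submodule ℂ (AffVir B) where
  carrier := {X | X.virPart = 0 ∧ X.cPart = 0}
  add_mem' hX hY := ⟨by rw [AffVir.add_virPart, hX.1, hY.1, add_zero],
    by rw [AffVir.add_cPart, hX.2, hY.2, add_zero]⟩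
  zero_mem' := ⟨rfl, rfl⟩
  smul_mem' r X hX := ⟨by rw [AffVir.smul_virPart, hX.1, smul_zero],
    by rw [AffVir.smul_cPart, hX.2, mul_zero]⟩

theorem loop_mem_affinePart (m : ℤ) (x : g) : AffVir.loop B m x ∈ affinePart B := ⟨rfl, rfl⟩

theorem K_mem_affinePart : AffVir.K B ∈ affinePart B := ⟨rfl, rfl⟩

theorem lie_mem_affinePart (X : AffVir B) {Y : AffVir B} (hY : Y ∈ affinePart B) :
    ⁅X, Y⁆ ∈ affinePart B :=
  ⟨by rw [AffVir.lie_virPart, hY.1, map_zero], by rw [AffVir.lie_cPart, hY.1, map_zero]⟩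

/-- Only the affine part is controlled by `√I`. The letters outside it commute with `H`, which is
what makes the eigenspaces of `e ⊗ H` usable on all of `V`. -/
theorem IsHomogeneous.mem_affinePart_or {wt : Module.Dual ℂ H} {m : ℤ} {X : AffVir B}
    (hX : IsHomogeneous B wt m X) : X ∈ affinePart B ∨ wt = 0 := by
  cases hX with
  | loop χ m x hx => exact Or.inl (loop_mem_affinePart m x)
  | d m => exact Or.inr rfl
  | K => exact Or.inr rfl
  | C => exact Or.inr rfl

theorem affinePart_le_span (H : LieSubalgebra ℂ g) [H.IsCartanSubalgebra] :
    affinePart B ≤ Submodule.span ℂ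
      {X | X ∈ affinePart B ∧ ∃ (wt : Module.Dual ℂ H) (m : ℤ), IsHomogeneous B wt m X} := by
  intro X hX
  -- Dropping the Virasoro components is linear and sends each homogeneous element to itself or to
  -- `0`, so the induction can run over all of `AffVir B`.
  have key : ∀ X : AffVir B, X - ⟨0, 0, X.virPart, X.cPart⟩ ∈ Submodule.span ℂ
      {X | X ∈ affinePart B ∧ ∃ (wt : Module.Dual ℂ H) (m : ℤ), IsHomogeneous B wt m X} := by
    intro X
    induction X using homogeneous_induction H with
    | hzero =>
      have e : (0 : AffVir B) - ⟨0, 0, (0 : AffVir B).virPart, (0 : AffVir B).cPart⟩ = 0 := by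
        rw [zero_sub, neg_eq_zero]; rfl
      rw [e]; exact zero_mem _
    | hadd X Y hX hY =>
      have e : (⟨0, 0, (X + Y).virPart, (X + Y).cPart⟩ : AffVir B) =
        ⟨0, 0, X.virPart, X.cPart⟩ + ⟨0, 0, Y.virPart, Y.cPart⟩ := by ext1 <;> simp
      rw [e, add_sub_add_comm]; exact add_mem hX hY
    | hsmul r X hX =>
      have e : (⟨0, 0, (r • X).virPart, (r • X).cPart⟩ : AffVir B) =
        r • ⟨0, 0, X.virPart, X.cPart⟩ := by ext1 <;> simp
      rw [e, ← smul_sub]; exact Submodule.smul_mem _ r hX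
    | h wt m X hX =>
      cases hX with
      | loop χ m x hx =>
        have e : (⟨0, 0, (AffVir.loop B m x).virPart, (AffVir.loop B m x).cPart⟩ : AffVir B) = 0 :=
          rfl
        rw [e, sub_zero]
        exact Submodule.subset_span ⟨loop_mem_affinePart m x, _, _, IsHomogeneous.loop χ m x hx⟩
      | d m =>
        have e : (⟨0, 0, (AffVir.d B m).virPart, (AffVir.d B m).cPart⟩ : AffVir B) = AffVir.d B m :=
          rfl
        rw [e, sub_self]; exact zero_mem _
      | K =>
        have e : (⟨0, 0, (AffVir.K B).virPart, (AffVir.K B).cPart⟩ : AffVir B) = 0 := rfl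
        rw [e, sub_zero]
        exact Submodule.subset_span ⟨K_mem_affinePart, _, _, IsHomogeneous.K⟩
      | C =>
        have e : (⟨0, 0, (AffVir.C B).virPart, (AffVir.C B).cPart⟩ : AffVir B) = AffVir.C B := rfl
        rw [e, sub_self]; exact zero_mem _
  have e : (⟨0, 0, X.virPart, X.cPart⟩ : AffVir B) = 0 := by rw [hX.1, hX.2]; rfl
  have := key X
  rwa [e, sub_zero] at this

/-! ### Positive and negative weights, and gradings adapted to the affine simple roots. -/

section Types

variable (b : (rootSystem H).Base)

/-- The weights of the homogeneous elements of `n₊ ⊕ Vir⁺`. -/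
def IsPosWeight (wt : Module.Dual ℂ H) (m : ℤ) : Prop :=
  0 < m ∨ (m = 0 ∧ ∃ i, b.IsPos i ∧ wt = (rootSystem H).root i)

/-- The weights of the homogeneous elements of `n₋ ⊕ Vir⁻`. -/
def IsNegWeight (wt : Module.Dual ℂ H) (m : ℤ) : Prop :=
  m < 0 ∨ (m = 0 ∧ ∃ i, b.IsPos i ∧ wt = -(rootSystem H).root i)

variable {b}

theorem IsHomogeneous.eq_zero_or_root {wt : Module.Dual ℂ H} {m : ℤ} {X : AffVir B}
    (hX : IsHomogeneous B wt m X) : wt = 0 ∨ ∃ i, wt = (rootSystem H).root i := by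
  cases hX with
  | loop χ m x hx =>
    rcases weight_eq_zero_or_root χ with h | ⟨i, hi⟩
    · exact Or.inl h
    · exact Or.inr ⟨i, hi.symm⟩
  | d m => exact Or.inl rfl
  | K => exact Or.inl rfl
  | C => exact Or.inl rfl

theorem IsHomogeneous.trichotomy (b : (rootSystem H).Base) {wt : Module.Dual ℂ H} {m : ℤ}
    {X : AffVir B} (hX : IsHomogeneous B wt m X) :
    IsPosWeight b wt m ∨ (wt = 0 ∧ m = 0) ∨ IsNegWeight b wt m := by
  rcases lt_trichotomy m 0 with h | rfl | h
  · exact Or.inr (Or.inr (Or.inl h))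
  · rcases hX.eq_zero_or_root with h0 | ⟨i, hi⟩
    · exact Or.inr (Or.inl ⟨h0, rfl⟩)
    · rcases isPos_or_exists_eq_neg b i with hp | ⟨j, hj, hij⟩
      · exact Or.inl (Or.inr ⟨rfl, i, hp, hi⟩)
      · exact Or.inr (Or.inr (Or.inr ⟨rfl, j, hj, hi.trans hij⟩))
  · exact Or.inl (Or.inl h)

theorem IsHomogeneous.mem_posPart {wt : Module.Dual ℂ H} {m : ℤ} {X : AffVir B}
    (hX : IsHomogeneous B wt m X) (hp : IsPosWeight b wt m) : X ∈ posPart B b := by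
  rcases hp with hm | ⟨rfl, i, hi, hwt⟩
  · cases hX with
    | loop χ m x hx => exact Submodule.subset_span (Or.inl (Or.inr ⟨m, hm, x, rfl⟩))
    | d m => exact Submodule.subset_span (Or.inr ⟨m, hm, rfl⟩)
    | K => exact absurd hm (lt_irrefl _)
    | C => exact absurd hm (lt_irrefl _)
  · have hne := (rootSystem H).ne_zero i
    cases hX with
    | loop χ m x hx =>
      have h' : (χ : H → ℂ) = i.1 := by
        ext y; exact LinearMap.congr_fun hwt y
      rw [h'] at hx
      exact Submodule.subset_span (Or.inl (Or.inl ⟨i, hi, x, hx, rfl⟩))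
    | d m => exact absurd hwt.symm hne
    | K => exact absurd hwt.symm hne
    | C => exact absurd hwt.symm hne

theorem IsHomogeneous.mem_range_cartanIncl {m : ℤ} {X : AffVir B}
    (hX : IsHomogeneous B (0 : Module.Dual ℂ H) m X) (hm : m = 0) :
    X ∈ LinearMap.range (cartanIncl B : ExtCartan H →ₗ[ℂ] AffVir B) := by
  generalize hwt : (0 : Module.Dual ℂ H) = wt at hX
  cases hX with
  | loop χ m x hx =>
    have h' : (χ : H → ℂ) = 0 := by ext y; exact (LinearMap.congr_fun hwt y).symm
    rw [h'] at hx
    have hxH : x ∈ H := by simpa using hx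
    exact ⟨((⟨x, hxH⟩, 0), 0, 0), by simp [cartanIncl, hm]⟩
  | d m => exact ⟨((0, 0), 1, 0), by simp [cartanIncl, hm]⟩
  | K => exact ⟨((0, 1), 0, 0), by simp [cartanIncl]⟩
  | C => exact ⟨((0, 0), 0, 1), by simp [cartanIncl]⟩

/-- A pair `(h, c)` is weakly positive if each positive weight has on `h + c d₀` a non-negative
integer as value. -/
def IsWeaklyPositive (b : (rootSystem H).Base) (h : H) (c : ℂ) : Prop :=
  ∀ (wt : Module.Dual ℂ H) (m : ℤ), (wt = 0 ∨ ∃ i, wt = (rootSystem H).root i) →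
    IsPosWeight b wt m → ∃ n : ℕ, wt h + c * m = n

theorem IsNegWeight.neg {wt : Module.Dual ℂ H} {m : ℤ} (h : IsNegWeight b wt m) :
    IsPosWeight b (-wt) (-m) := by
  rcases h with h | ⟨rfl, i, hi, rfl⟩
  · exact Or.inl (by omega)
  · exact Or.inr ⟨by simp, i, hi, by simp⟩

theorem neg_eq_zero_or_root {wt : Module.Dual ℂ H} (b : (rootSystem H).Base)
    (h : wt = 0 ∨ ∃ i, wt = (rootSystem H).root i) :
    -wt = 0 ∨ ∃ i, -wt = (rootSystem H).root i := by
  rcases h with rfl | ⟨i, rfl⟩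
  · exact Or.inl neg_zero
  · obtain ⟨j, hj, -⟩ := exists_root_eq_neg b i
    exact Or.inr ⟨j, hj.symm⟩

theorem IsWeaklyPositive.of_isNegWeight {h : H} {c : ℂ} (hc : IsWeaklyPositive b h c)
    {wt : Module.Dual ℂ H} {m : ℤ} (hwt : wt = 0 ∨ ∃ i, wt = (rootSystem H).root i)
    (hn : IsNegWeight b wt m) : ∃ n : ℕ, wt h + c * m = -(n : ℂ) := by
  obtain ⟨n, hn⟩ := hc (-wt) (-m) (neg_eq_zero_or_root b hwt) hn.neg
  refine ⟨n, ?_⟩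
  rw [← hn, LinearMap.neg_apply]; push_cast; ring

theorem height_abs_le {θ : H.root} (hθ : IsHighestRoot b θ) (i : H.root) :
    |b.height i| ≤ b.height θ := by
  obtain ⟨n, hn, -⟩ := hθ.height_le b i
  obtain ⟨j, -, hj⟩ := exists_root_eq_neg b i
  obtain ⟨n', hn', -⟩ := hθ.height_le b j
  rw [abs_le]
  constructor <;> omega

/-- The principal grading is positive: the value of a positive weight is a positive integer. -/
theorem principal_pos {θ : H.root} (hθ : IsHighestRoot b θ) {hρ : H}
    (hhρ : ∀ i, (rootSystem H).root i hρ = b.height i) {wt : Module.Dual ℂ H} {m : ℤ}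
    (hwt : wt = 0 ∨ ∃ i, wt = (rootSystem H).root i) (hp : IsPosWeight b wt m) :
    ∃ n : ℕ, wt hρ + ((b.height θ + 1 : ℤ) : ℂ) * m = (n + 1 : ℕ) := by
  have hθ0 : 0 < b.height θ := hθ.isPos b
  -- The factor `height θ + 1` at `d₀` exceeds the absolute height of every root, so a level `m > 0`
  -- outweighs the finite part.
  suffices h : ∃ k : ℤ, wt hρ = k ∧ 0 < k + (b.height θ + 1) * m by
    obtain ⟨k, hk, hpos⟩ := h
    obtain ⟨n, hn⟩ := Int.eq_ofNat_of_zero_le (show 0 ≤ k + (b.height θ + 1) * m - 1 by omega)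
    refine ⟨n, ?_⟩
    rw [hk]
    have : k + (b.height θ + 1) * m = ((n + 1 : ℕ) : ℤ) := by push_cast; omega
    exact_mod_cast this
  rcases hp with hm | ⟨rfl, i, hi, rfl⟩
  · rcases hwt with rfl | ⟨i, rfl⟩
    · exact ⟨0, by simp, by positivity⟩
    · refine ⟨_, hhρ i, ?_⟩
      have := (abs_le.1 (height_abs_le hθ i)).1
      nlinarith
  · exact ⟨_, hhρ i, by rw [mul_zero, add_zero]; exact hi⟩

theorem principal_weaklyPositive {θ : H.root} (hθ : IsHighestRoot b θ) {hρ : H}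
    (hhρ : ∀ i, (rootSystem H).root i hρ = b.height i) :
    IsWeaklyPositive b hρ ((b.height θ + 1 : ℤ) : ℂ) := fun wt m hwt hp => by
  obtain ⟨n, hn⟩ := principal_pos hθ hhρ hwt hp
  exact ⟨n + 1, hn⟩

/-- For each simple root of `g`, there is a weakly positive grading that vanishes on this weight,
and is positive on the others. -/
theorem exists_grading_simple {θ : H.root} (hθ : IsHighestRoot b θ) {j : H.root}
    (hj : j ∈ b.support) : ∃ (h : H) (c : ℂ), IsWeaklyPositive b h c ∧
      (rootSystem H).root j h + c * (0 : ℤ) = 0 ∧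
      ∀ (wt : Module.Dual ℂ H) (m : ℤ), (wt = 0 ∨ ∃ i, wt = (rootSystem H).root i) →
        IsPosWeight b wt m → wt h + c * m = 0 → wt = (rootSystem H).root j ∧ m = 0 := by
  obtain ⟨h, hj0, hh⟩ := exists_parabolic_element b hj
  have hθ0 : 0 < b.height θ := hθ.isPos b
  -- The values of the parabolic element are bounded by the heights, so the factor `height θ + 1`
  -- again makes all positive levels strictly positive. Zeros can occur at level `0` only.
  have key : ∀ i, ∃ k : ℤ, (rootSystem H).root i h = k ∧ |k| ≤ b.height θ := by
    intro i
    rcases isPos_or_exists_eq_neg b i with hi | ⟨i', hi', hii'⟩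
    · obtain ⟨n, hn, hle, -⟩ := hh i hi
      refine ⟨n, by simpa using hn, ?_⟩
      rw [abs_of_nonneg (by positivity)]
      exact hle.trans ((le_abs_self _).trans (height_abs_le hθ i))
    · obtain ⟨n, hn, hle, -⟩ := hh i' hi'
      refine ⟨-n, by rw [hii', LinearMap.neg_apply, hn]; simp, ?_⟩
      rw [abs_neg, abs_of_nonneg (by positivity)]
      exact hle.trans ((le_abs_self _).trans (height_abs_le hθ i'))
  have hpos : ∀ (wt : Module.Dual ℂ H) (m : ℤ), (wt = 0 ∨ ∃ i, wt = (rootSystem H).root i) →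
      IsPosWeight b wt m → ∃ n : ℕ, wt h + ((b.height θ + 1 : ℤ) : ℂ) * m = n ∧
        (n = 0 → wt = (rootSystem H).root j ∧ m = 0) := by
    intro wt m hwt hp
    rcases hp with hm | ⟨rfl, i, hi, rfl⟩
    · suffices hs : ∃ k : ℤ, wt h = k ∧ 0 < k + (b.height θ + 1) * m by
        obtain ⟨k, hk, hkpos⟩ := hs
        obtain ⟨n, hn⟩ := Int.eq_ofNat_of_zero_le hkpos.le
        refine ⟨n, ?_, fun h0 => by omega⟩
        rw [hk]
        exact_mod_cast hn
      rcases hwt with rfl | ⟨i, rfl⟩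
      · exact ⟨0, by simp, by positivity⟩
      · obtain ⟨k, hk, hkle⟩ := key i
        refine ⟨k, hk, ?_⟩
        have := (abs_le.1 hkle).1
        nlinarith
    · obtain ⟨n, hn, -, hn0⟩ := hh i hi
      exact ⟨n, by rw [hn]; simp, fun h0 => ⟨by rw [hn0 h0], rfl⟩⟩
  refine ⟨h, ((b.height θ + 1 : ℤ) : ℂ), fun wt m hwt hp => ?_, by rw [hj0]; simp,
    fun wt m hwt hp h0 => ?_⟩
  · obtain ⟨n, hn, -⟩ := hpos wt m hwt hp
    exact ⟨n, hn⟩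
  · obtain ⟨n, hn, hn0⟩ := hpos wt m hwt hp
    exact hn0 (by rw [h0] at hn; exact_mod_cast hn.symm)

/-- The same for the affine simple root `δ - θ`. -/
theorem exists_grading_affine {θ : H.root} (hθ : IsHighestRoot b θ) :
    ∃ (h : H) (c : ℂ), IsWeaklyPositive b h c ∧
      -(rootSystem H).root θ h + c * (1 : ℤ) = 0 ∧
      ∀ (wt : Module.Dual ℂ H) (m : ℤ), (wt = 0 ∨ ∃ i, wt = (rootSystem H).root i) →
        IsPosWeight b wt m → wt h + c * m = 0 → wt = -(rootSystem H).root θ ∧ m = 1 := by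
  obtain ⟨h, hh⟩ := exists_apply_root_eq_height b
  have hθ0 : 0 < b.height θ := hθ.isPos b
  -- Here the factor is exactly `height θ`, so that `δ - θ` has degree `0`. Another zero would need
  -- a root of height `-m (height θ)` with `m > 0`, which forces `m = 1` and the root `-θ`.
  have hpos : ∀ (wt : Module.Dual ℂ H) (m : ℤ), (wt = 0 ∨ ∃ i, wt = (rootSystem H).root i) →
      IsPosWeight b wt m → ∃ n : ℕ, wt h + ((b.height θ : ℤ) : ℂ) * m = n ∧
        (n = 0 → wt = -(rootSystem H).root θ ∧ m = 1) := by
    intro wt m hwt hp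
    rcases hp with hm | ⟨rfl, i, hi, rfl⟩
    · suffices hs : ∃ k : ℤ, wt h = k ∧ 0 ≤ k + b.height θ * m ∧
          (k + b.height θ * m = 0 → wt = -(rootSystem H).root θ ∧ m = 1) by
        obtain ⟨k, hk, hkpos, hk0⟩ := hs
        obtain ⟨n, hn⟩ := Int.eq_ofNat_of_zero_le hkpos
        refine ⟨n, ?_, fun h0 => hk0 (by omega)⟩
        rw [hk]
        exact_mod_cast hn
      rcases hwt with rfl | ⟨i, rfl⟩
      · have : 0 < b.height θ * m := by positivity
        exact ⟨0, by simp, by omega, fun h0 => by omega⟩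
      · have h1 := (abs_le.1 (height_abs_le hθ i)).1
        refine ⟨b.height i, hh i, by nlinarith, fun h0 => ?_⟩
        have hm1 : m = 1 := by nlinarith
        subst hm1
        obtain ⟨i', hi', hii'⟩ := exists_root_eq_neg b i
        obtain ⟨n, hn, hn0⟩ := hθ.height_le b i'
        refine ⟨?_, rfl⟩
        rw [← hn0 (by omega), hi', neg_neg]
    · have hi' : 0 < b.height i := hi
      refine ⟨(b.height i).toNat, ?_, fun h0 => by omega⟩
      rw [hh]
      have : (((b.height i).toNat : ℤ) : ℂ) = b.height i := by rw [Int.toNat_of_nonneg hi'.le]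
      rw [Int.cast_natCast] at this
      rw [this]; simp
  refine ⟨h, ((b.height θ : ℤ) : ℂ), fun wt m hwt hp => ?_, by rw [hh]; simp,
    fun wt m hwt hp h0 => ?_⟩
  · obtain ⟨n, hn, -⟩ := hpos wt m hwt hp
    exact ⟨n, hn⟩
  · obtain ⟨n, hn, hn0⟩ := hpos wt m hwt hp
    exact hn0 (by rw [h0] at hn; exact_mod_cast hn.symm)

end Types

/-! ### Finite dimensionality of the graded pieces. -/

section Finiteness

/-- For `c ≠ 0`, the homogeneous elements of given degree with respect to `h + c d₀` lie in a finite
dimensional space. -/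
theorem exists_fg_of_degree (B : InvariantForm g) (h : H) {c : ℂ} (hc : c ≠ 0) (z : ℂ) :
    ∃ S : Submodule ℂ (AffVir B), S.FG ∧ ∀ (wt : Module.Dual ℂ H) m X, IsHomogeneous B wt m X →
      wt h + c * m = z → X ∈ S := by
  classical
  -- The only level `m` with `c m = y`. The default `0` is harmless: no letter uses it, and it only
  -- enlarges `S`.
  let mf : ℂ → ℤ := fun y => if hy : ∃ m : ℤ, c * m = y then hy.choose else 0
  have hmf : ∀ (m : ℤ) (y : ℂ), c * m = y → mf y = m := by
    intro m y hm
    have hy : ∃ m : ℤ, c * m = y := ⟨m, hm⟩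
    have h1 : c * (mf y : ℂ) = y := by
      simp only [mf, dif_pos hy]; exact hy.choose_spec
    have h2 := mul_left_cancel₀ hc (h1.trans hm.symm)
    exact_mod_cast h2
  refine ⟨(⨆ χ : LieModule.Weight ℂ H g, LinearMap.range (AffVir.loop B (mf (z - χ h)))) ⊔
    Submodule.span ℂ {AffVir.d B (mf z), AffVir.K B, AffVir.C B}, ?_, ?_⟩
  · refine Submodule.FG.sup (Submodule.fg_iSup _ fun χ => ?_) (Submodule.fg_span (by simp))
    exact Module.Finite.range _ |>.fg_top |> fun h => (Submodule.fg_top _).1 h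
  · intro wt m X hX hz
    cases hX with
    | loop χ m x hx =>
      refine le_sup_left (α := Submodule ℂ (AffVir B)) (le_iSup
        (fun χ : LieModule.Weight ℂ H g => LinearMap.range (AffVir.loop B (mf (z - χ h)))) χ ?_)
      rw [hmf m (z - χ h) (by rw [← hz]; simp)]
      exact ⟨x, rfl⟩
    | d m =>
      refine le_sup_right (α := Submodule ℂ (AffVir B)) (Submodule.subset_span ?_)
      rw [hmf m z (by rw [← hz]; simp)]
      simp
    | K => exact le_sup_right (α := Submodule ℂ (AffVir B)) (Submodule.subset_span (by simp))
    | C => exact le_sup_right (α := Submodule ℂ (AffVir B)) (Submodule.subset_span (by simp))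

end Finiteness

end Letters

/-! ### Consequences of irreducibility. -/

section HighestWeight

set_option linter.unusedSectionVars false

open LieAlgebra.IsKilling LieAlgebra

attribute [local instance 100] LieRing.ofAssociativeRing

variable {g : Type*} [LieRing g] [LieAlgebra ℂ g] [FiniteDimensional ℂ g] [LieAlgebra.IsSimple ℂ g]
  {B : InvariantForm g} {H : LieSubalgebra ℂ g} [H.IsCartanSubalgebra]
  {A : Type*} [CommRing A] [Algebra ℂ A] {V : Type*} [AddCommGroup V] [Module ℂ V]

theorem apply_mem_of_mem_iSup {ι : Sort*} {S : ι → Submodule ℂ V} {T : Submodule ℂ V}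
    {f : Module.End ℂ V} (h : ∀ i, ∀ w ∈ S i, f w ∈ T) {w : V} (hw : w ∈ iSup S) : f w ∈ T :=
  (iSup_le fun i w hw => h i w hw : iSup S ≤ T.comap f) hw

/-- An irreducible highest weight representation, with highest weight vector `v`. -/
structure IsIrrHighestWeight (b : (rootSystem H).Base) (ψ : A ⊗[ℂ] ExtCartan H →ₗ[ℂ] ℂ)
    (ρ : LoopAffVir B A →ₗ⁅ℂ⁆ Module.End ℂ V) (v : V) : Prop where
  pos : ∀ a : A, ∀ X ∈ posPart B b, ρ (a ⊗ₜ X) v = 0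
  weight : ∀ (a : A) (y : ExtCartan H), ρ (a ⊗ₜ cartanIncl B y) v = ψ (a ⊗ₜ y) • v
  cyclic : ∀ U : Submodule ℂ V, v ∈ U → (∀ x, ∀ u ∈ U, ρ x u ∈ U) → U = ⊤
  simple : ∀ U : Submodule ℂ V, (∀ x, ∀ u ∈ U, ρ x u ∈ U) → U ≠ ⊤ → U = ⊥

variable (ρ : LoopAffVir B A →ₗ⁅ℂ⁆ Module.End ℂ V)

theorem apply_apply_tmul (a a' : A) (X Y : AffVir B) (w : V) :
    ρ (a ⊗ₜ X) (ρ (a' ⊗ₜ Y) w) = ρ ((a * a') ⊗ₜ ⁅X, Y⁆) w + ρ (a' ⊗ₜ Y) (ρ (a ⊗ₜ X) w) := by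
  have e : ⁅(a ⊗ₜ[ℂ] X : LoopAffVir B A), a' ⊗ₜ[ℂ] Y⁆ = (a * a') ⊗ₜ ⁅X, Y⁆ := by
    simp
  rw [← e, LieHom.map_lie, Ring.lie_def, LinearMap.sub_apply]
  simp

theorem stable_of_homogeneous (H : LieSubalgebra ℂ g) [H.IsCartanSubalgebra] {U T : Submodule ℂ V}
    (h : ∀ (a : A) (wt : Module.Dual ℂ H) m X, IsHomogeneous B wt m X →
      ∀ u ∈ U, ρ (a ⊗ₜ X) u ∈ T) :
    ∀ x, ∀ u ∈ U, ρ x u ∈ T := by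
  intro x u hu
  induction x using TensorProduct.induction_on with
  | zero => simp
  | add x y hx hy => rw [map_add, LinearMap.add_apply]; exact add_mem hx hy
  | tmul a X =>
    induction X using homogeneous_induction H with
    | hzero => simp
    | hadd X Y hX hY =>
      rw [TensorProduct.tmul_add, map_add, LinearMap.add_apply]; exact add_mem hX hY
    | hsmul r X hX =>
      rw [TensorProduct.tmul_smul, map_smul, LinearMap.smul_apply]; exact Submodule.smul_mem _ r hX
    | h wt m X hX => exact h a wt m X hX u hu

theorem apply_mem_eigenspace (a : A) {D X : AffVir B} {s z : ℂ} (hX : ⁅D, X⁆ = s • X) {w : V}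
    (hw : w ∈ (ρ ((1 : A) ⊗ₜ D)).eigenspace z) :
    ρ (a ⊗ₜ X) w ∈ (ρ ((1 : A) ⊗ₜ D)).eigenspace (z + s) := by
  rw [Module.End.mem_eigenspace_iff] at hw ⊢
  rw [apply_apply_tmul, hw, hX, one_mul, map_smul, TensorProduct.tmul_smul, map_smul,
    LinearMap.smul_apply, add_smul, add_comm]

/-- Eigenspaces are independent, so one outside a family that already spans is zero. -/
theorem eigenspace_eq_bot_of_iSup_eq_top {ι : Type*} {f : Module.End ℂ V} {c : ι → ℂ}
    (h : ⨆ i, f.eigenspace (c i) = ⊤) {z : ℂ} (hz : ∀ i, z ≠ c i) : f.eigenspace z = ⊥ := by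
  have h1 := f.eigenspaces_iSupIndep z
  refine disjoint_self.1 (h1.mono_right ?_)
  refine le_top.trans (h ▸ iSup_le fun i => ?_)
  exact le_iSup₂ (f := fun (y : ℂ) (_ : y ≠ z) => f.eigenspace y) (c i) (hz i).symm

variable {ρ} {b : (rootSystem H).Base} {ψ : A ⊗[ℂ] ExtCartan H →ₗ[ℂ] ℂ} {v : V}

/-- The span of the homogeneous elements of negative weight. -/
def negLoop (B : InvariantForm g) (b : (rootSystem H).Base) (A : Type*) [CommRing A] [Algebra ℂ A] :
    Submodule ℂ (LoopAffVir B A) :=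
  Submodule.span ℂ {x | ∃ (a : A) (wt : Module.Dual ℂ H) (m : ℤ) (X : AffVir B),
    IsHomogeneous B wt m X ∧ IsNegWeight b wt m ∧ x = a ⊗ₜ X}

/-- The span of `A ⊗ (h̄ ⊕ n₊ ⊕ Vir⁺)`. -/
def borelLoop (B : InvariantForm g) (b : (rootSystem H).Base) (A : Type*) [CommRing A]
    [Algebra ℂ A] : Submodule ℂ (LoopAffVir B A) :=
  Submodule.span ℂ {x | ∃ (a : A) (X : AffVir B), (X ∈ posPart B b ∨
    X ∈ LinearMap.range (cartanIncl B : ExtCartan H →ₗ[ℂ] AffVir B)) ∧ x = a ⊗ₜ X}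

theorem negLoop_sup_borelLoop : negLoop B b A ⊔ borelLoop B b A = ⊤ := by
  rw [eq_top_iff]
  rintro x -
  induction x using TensorProduct.induction_on with
  | zero => simp
  | add x y hx hy => exact add_mem hx hy
  | tmul a X =>
    induction X using homogeneous_induction H with
    | hzero => simp
    | hadd X Y hX hY => rw [TensorProduct.tmul_add]; exact add_mem hX hY
    | hsmul r X hX => rw [TensorProduct.tmul_smul]; exact Submodule.smul_mem _ r hX
    | h wt m X hX =>
      rcases hX.trichotomy b with h | ⟨rfl, h⟩ | h
      · exact Submodule.mem_sup_right (Submodule.subset_span ⟨a, X, Or.inl (hX.mem_posPart h), rfl⟩)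
      · exact Submodule.mem_sup_right
          (Submodule.subset_span ⟨a, X, Or.inr (hX.mem_range_cartanIncl h), rfl⟩)
      · exact Submodule.mem_sup_left (Submodule.subset_span ⟨a, wt, m, X, hX, h, rfl⟩)

theorem apply_mem_of_mem_span {S : Set (LoopAffVir B A)} {W T : Submodule ℂ V}
    (h : ∀ x ∈ S, ∀ w ∈ W, ρ x w ∈ T) : ∀ x ∈ Submodule.span ℂ S, ∀ w ∈ W, ρ x w ∈ T := by
  intro x hx w hw
  induction hx using Submodule.span_induction with
  | zero => simp
  | add x y _ _ hx hy => rw [map_add, LinearMap.add_apply]; exact add_mem hx hy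
  | smul r x _ hx => rw [map_smul, LinearMap.smul_apply]; exact Submodule.smul_mem _ r hx
  | mem x hx => exact h x hx w hw

/-- The smallest subspace that contains `W` and is stable under the negative part is a
subrepresentation if `W` is stable under the Borel part. -/
theorem exists_stable_of_borel_stable {W T : Submodule ℂ V}
    (hpos : ∀ a : A, ∀ X ∈ posPart B b, ∀ w ∈ W, ρ (a ⊗ₜ X) w ∈ W)
    (hcartan : ∀ (a : A) (y : ExtCartan H), ∀ w ∈ W, ρ (a ⊗ₜ cartanIncl B y) w ∈ W) (hWT : W ≤ T)
    (hT : ∀ (a : A) (wt : Module.Dual ℂ H) m X, IsHomogeneous B wt m X → IsNegWeight b wt m →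
      ∀ w ∈ T, ρ (a ⊗ₜ X) w ∈ T) :
    ∃ U : Submodule ℂ V, W ≤ U ∧ U ≤ T ∧ ∀ x, ∀ u ∈ U, ρ x u ∈ U := by
  refine exists_stable_of_triangular ρ (negLoop B b A) (borelLoop B b A) negLoop_sup_borelLoop W T
    (apply_mem_of_mem_span ?_) hWT (apply_mem_of_mem_span ?_)
  · rintro x ⟨a, X, hX | ⟨y, rfl⟩, rfl⟩ w hw
    · exact hpos a X hX w hw
    · exact hcartan a y w hw
  · rintro x ⟨a, wt, m, X, hX, hneg, rfl⟩ w hw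
    exact hT a wt m X hX hneg w hw

namespace IsIrrHighestWeight

variable (hv : IsIrrHighestWeight b ψ ρ v)
include hv

/-- The line of `v` is stable under the Borel part. Hence the smallest negatively stable subspace
containing it is a submodule, inside `T` and containing `v`. This is `V = U(n₋) v` without PBW. -/
theorem eq_top_of_neg_stable {T : Submodule ℂ V} (hvT : v ∈ T)
    (hT : ∀ (a : A) (wt : Module.Dual ℂ H) m X, IsHomogeneous B wt m X → IsNegWeight b wt m →
      ∀ w ∈ T, ρ (a ⊗ₜ X) w ∈ T) : T = ⊤ := by
  have hpos : ∀ a : A, ∀ X ∈ posPart B b, ∀ w ∈ Submodule.span ℂ {v},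
      ρ (a ⊗ₜ X) w ∈ Submodule.span ℂ {v} := by
    intro a X hX w hw
    obtain ⟨r, rfl⟩ := Submodule.mem_span_singleton.1 hw
    rw [map_smul, hv.pos a X hX, smul_zero]
    exact zero_mem _
  have hcartan : ∀ (a : A) (y : ExtCartan H), ∀ w ∈ Submodule.span ℂ {v},
      ρ (a ⊗ₜ cartanIncl B y) w ∈ Submodule.span ℂ {v} := by
    intro a y w hw
    obtain ⟨r, rfl⟩ := Submodule.mem_span_singleton.1 hw
    rw [map_smul, hv.weight]
    exact Submodule.smul_mem _ _ (Submodule.smul_mem _ _ (Submodule.mem_span_singleton_self v))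
  obtain ⟨U, hWU, hUT, hU⟩ := exists_stable_of_borel_stable hpos hcartan
    ((Submodule.span_singleton_le_iff_mem _ _).2 hvT) hT
  have := hv.cyclic U (hWU (Submodule.mem_span_singleton_self v)) hU
  exact top_le_iff.1 (this ▸ hUT)

theorem mem_eigenspace (h : H) (c : ℂ) : v ∈ (ρ ((1 : A) ⊗ₜ gradingElement B h c)).eigenspace
    (ψ ((1 : A) ⊗ₜ ((h, 0), c, 0))) := by
  rw [Module.End.mem_eigenspace_iff, gradingElement_eq, hv.weight]

/-- The vector `v` has the top eigenvalue, and negative letters lower it by natural numbers,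
possibly by `0`. -/
theorem iSup_eigenspace {h : H} {c : ℂ} (hc : IsWeaklyPositive b h c) :
    ⨆ n : ℕ, (ρ ((1 : A) ⊗ₜ gradingElement B h c)).eigenspace
      (ψ ((1 : A) ⊗ₜ ((h, 0), c, 0)) - n) = ⊤ := by
  refine hv.eq_top_of_neg_stable (Submodule.mem_iSup_of_mem 0 ?_) ?_
  · simpa using hv.mem_eigenspace h c
  · intro a wt m X hX hneg w hw
    refine apply_mem_of_mem_iSup (fun n w hw => ?_) hw
    obtain ⟨k, hk⟩ := hc.of_isNegWeight hX.eq_zero_or_root hneg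
    refine Submodule.mem_iSup_of_mem (n + k) ?_
    have := apply_mem_eigenspace ρ a (hX.lie_gradingElement h c) hw
    rw [hk] at this
    convert this using 2
    push_cast; ring

theorem eigenspace_eq_bot {h : H} {c : ℂ} (hc : IsWeaklyPositive b h c) {z : ℂ}
    (hz : ∀ n : ℕ, z ≠ ψ ((1 : A) ⊗ₜ ((h, 0), c, 0)) - n) :
    (ρ ((1 : A) ⊗ₜ gradingElement B h c)).eigenspace z = ⊥ :=
  eigenspace_eq_bot_of_iSup_eq_top (hv.iSup_eigenspace hc) hz

section Principal

variable {θ : H.root} (hθ : IsHighestRoot b θ) {hρ : H}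
  (hhρ : ∀ i, (rootSystem H).root i hρ = b.height i)
include hθ hhρ

/-- A subspace below the highest weight that is stable under the Borel part is zero. -/
theorem eq_bot_of_borel_stable {W : Submodule ℂ V}
    (hpos : ∀ a : A, ∀ X ∈ posPart B b, ∀ w ∈ W, ρ (a ⊗ₜ X) w ∈ W)
    (hcartan : ∀ (a : A) (y : ExtCartan H), ∀ w ∈ W, ρ (a ⊗ₜ cartanIncl B y) w ∈ W)
    (hW : W ≤ ⨆ n : ℕ, (ρ ((1 : A) ⊗ₜ gradingElement B hρ (b.height θ + 1 : ℤ))).eigenspace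
      (ψ ((1 : A) ⊗ₜ ((hρ, 0), ((b.height θ + 1 : ℤ) : ℂ), 0)) - (n + 1 : ℕ))) : W = ⊥ := by
  have hneg : ∀ (a : A) (wt : Module.Dual ℂ H) m X, IsHomogeneous B wt m X → IsNegWeight b wt m →
      ∀ w ∈ ⨆ n : ℕ, (ρ ((1 : A) ⊗ₜ gradingElement B hρ (b.height θ + 1 : ℤ))).eigenspace
        (ψ ((1 : A) ⊗ₜ ((hρ, 0), ((b.height θ + 1 : ℤ) : ℂ), 0)) - (n + 1 : ℕ)),
      ρ (a ⊗ₜ X) w ∈ ⨆ n : ℕ,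
        (ρ ((1 : A) ⊗ₜ gradingElement B hρ (b.height θ + 1 : ℤ))).eigenspace
          (ψ ((1 : A) ⊗ₜ ((hρ, 0), ((b.height θ + 1 : ℤ) : ℂ), 0)) - (n + 1 : ℕ)) := by
    intro a wt m X hX hneg w hw
    refine apply_mem_of_mem_iSup (fun n w hw => ?_) hw
    obtain ⟨k, hk⟩ := (principal_weaklyPositive hθ hhρ).of_isNegWeight hX.eq_zero_or_root hneg
    refine Submodule.mem_iSup_of_mem (n + k) ?_
    have := apply_mem_eigenspace ρ a (hX.lie_gradingElement hρ (b.height θ + 1 : ℤ)) hw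
    rw [hk] at this
    convert this using 2
    push_cast; ring
  obtain ⟨U, hWU, hUT, hU⟩ := exists_stable_of_borel_stable hpos hcartan hW hneg
  -- `U = ⊤` puts `v` both in its own degree and in lower ones, so `v = 0` and `V = 0`. The
  -- conclusion holds in that case too.
  by_cases htop : U = ⊤
  · have hv1 := hUT (htop ▸ Submodule.mem_top : v ∈ U)
    have hv2 := hv.mem_eigenspace hρ (b.height θ + 1 : ℤ)
    have hind := (ρ ((1 : A) ⊗ₜ gradingElement B hρ (b.height θ + 1 : ℤ))).eigenspaces_iSupIndep
      (ψ ((1 : A) ⊗ₜ ((hρ, 0), ((b.height θ + 1 : ℤ) : ℂ), 0)))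
    have hv0 : v = 0 := by
      refine Submodule.disjoint_def.1 hind v hv2 ((iSup_le fun n => ?_ :
        _ ≤ ⨆ (y : ℂ), ⨆ (_ : y ≠ _), Module.End.eigenspace _ y) hv1)
      refine le_iSup₂ (f := fun (y : ℂ) (_ : y ≠ _) => Module.End.eigenspace _ y) _ ?_
      rw [ne_eq, sub_eq_self]
      exact_mod_cast Nat.succ_ne_zero n
    have hbot := hv.cyclic ⊥ (by simpa using hv0) (fun x u hu => by
      rw [(Submodule.mem_bot ℂ).1 hu, map_zero]; exact zero_mem _)
    exact le_bot_iff.1 (hbot ▸ le_top)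
  · exact le_bot_iff.1 (hv.simple U hU htop ▸ hWU)

/-- If `P` is a graded ideal of `AffVir B` and `ψ` vanishes on `J ⊗ (P ∩ h̄)`, then `J ⊗ P` acts by
zero. -/
theorem apply_eq_zero_of_ideal (J : Ideal A) (P : Submodule ℂ (AffVir B))
    (hP : ∀ (X Y : AffVir B), Y ∈ P → ⁅X, Y⁆ ∈ P)
    (hP' : P ≤ Submodule.span ℂ
      {X | X ∈ P ∧ ∃ (wt : Module.Dual ℂ H) (m : ℤ), IsHomogeneous B wt m X})
    (hψ : ∀ a ∈ J, ∀ y : ExtCartan H, cartanIncl B y ∈ P → ψ (a ⊗ₜ y) = 0) :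
    ∀ a ∈ J, ∀ X ∈ P, ρ (a ⊗ₜ X) = 0 := by
  let W : Submodule ℂ V := Submodule.span ℂ {w | ∃ a ∈ J, ∃ X ∈ P, w = ρ (a ⊗ₜ X) v}
  have hmem : ∀ a ∈ J, ∀ X ∈ P, ρ (a ⊗ₜ X) v ∈ W := fun a ha X hX =>
    Submodule.subset_span ⟨a, ha, X, hX, rfl⟩
  -- The Borel elements have `v` as eigenvector, and `J ⊗ P` is an ideal, so commuting them past `j
  -- ⊗ X` stays inside `(J ⊗ P)v`.
  have hstab : ∀ (a : A) (Y : AffVir B), (∃ r : ℂ, ρ (a ⊗ₜ Y) v = r • v) →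
      ∀ w ∈ W, ρ (a ⊗ₜ Y) w ∈ W := by
    rintro a Y ⟨r, hr⟩ w hw
    induction hw using Submodule.span_induction with
    | zero => simp
    | add x y _ _ hx hy => rw [map_add]; exact add_mem hx hy
    | smul r x _ hx => rw [map_smul]; exact Submodule.smul_mem _ r hx
    | mem w hw =>
      obtain ⟨j, hj, X, hX, rfl⟩ := hw
      rw [apply_apply_tmul, hr, map_smul]
      exact add_mem (hmem _ (J.mul_mem_left a hj) _ (hP Y X hX))
        (Submodule.smul_mem _ r (hmem j hj X hX))
  have hW : W = ⊥ := by
    refine hv.eq_bot_of_borel_stable hθ hhρ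
      (fun a X hX => hstab a X ⟨0, by rw [hv.pos a X hX, zero_smul]⟩)
      (fun a y => hstab a _ ⟨_, hv.weight a y⟩) (Submodule.span_le.2 ?_)
    rintro w ⟨a, ha, X, hX, rfl⟩
    have hX' := hP' hX
    clear hX
    induction hX' using Submodule.span_induction with
    | zero => simp
    | add x y _ _ hx hy =>
      rw [TensorProduct.tmul_add, map_add, LinearMap.add_apply]; exact add_mem hx hy
    | smul r x _ hx =>
      rw [TensorProduct.tmul_smul, map_smul, LinearMap.smul_apply]
      exact Submodule.smul_mem _ r hx
    | mem X hX =>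
      obtain ⟨hXP, wt, m, hX⟩ := hX
      rcases hX.trichotomy b with h | ⟨rfl, h⟩ | h
      · rw [hv.pos a X (hX.mem_posPart h)]; exact zero_mem _
      · obtain ⟨y, rfl⟩ := hX.mem_range_cartanIncl h
        rw [hv.weight, hψ a ha y hXP, zero_smul]; exact zero_mem _
      · obtain ⟨k, hk⟩ := principal_pos hθ hhρ (neg_eq_zero_or_root b hX.eq_zero_or_root) h.neg
        refine Submodule.mem_iSup_of_mem k ?_
        have := apply_mem_eigenspace ρ a (hX.lie_gradingElement hρ (b.height θ + 1 : ℤ))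
          (hv.mem_eigenspace hρ (b.height θ + 1 : ℤ))
        rw [sub_eq_add_neg, ← hk]
        convert this using 2
        rw [LinearMap.neg_apply]; push_cast; ring
  -- The vectors annihilated by the ideal `J ⊗ P` form a submodule. It contains `v` because `W = ⊥`.
  let U : Submodule ℂ V :=
    { carrier := {w | ∀ a ∈ J, ∀ X ∈ P, ρ (a ⊗ₜ X) w = 0}
      add_mem' := fun hx hy a ha X hX => by rw [map_add, hx a ha X hX, hy a ha X hX, add_zero]
      zero_mem' := fun a _ X _ => map_zero _
      smul_mem' := fun r x hx a ha X hX => by rw [map_smul, hx a ha X hX, smul_zero] }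
  have hU : U = ⊤ := by
    refine hv.cyclic U (fun a ha X hX => ?_) (stable_of_homogeneous ρ H
      fun a wt m Y _ u hu j hj X hX => ?_)
    · have := hmem a ha X hX
      rw [hW] at this
      exact (Submodule.mem_bot ℂ).1 this
    · rw [apply_apply_tmul, hu j hj X hX, map_zero, add_zero, ← lie_skew, TensorProduct.tmul_neg,
        map_neg, LinearMap.neg_apply, hu _ (J.mul_mem_right a hj) _ (hP Y X hX), neg_zero]
  intro a ha X hX
  ext w
  exact (hU ▸ Submodule.mem_top : w ∈ U) a ha X hX

end Principal

end IsIrrHighestWeight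

end HighestWeight

/-! ### Weight decomposition and finite multiplicities. -/

section WeightModule

set_option linter.unusedSectionVars false

open LieAlgebra.IsKilling LieAlgebra

attribute [local instance 100] LieRing.ofAssociativeRing

variable {g : Type*} [LieRing g] [LieAlgebra ℂ g] [FiniteDimensional ℂ g] [LieAlgebra.IsSimple ℂ g]
  {B : InvariantForm g} {H : LieSubalgebra ℂ g} [H.IsCartanSubalgebra]
  {A : Type*} [CommRing A] [Algebra ℂ A] {V : Type*} [AddCommGroup V] [Module ℂ V]

theorem cartanIncl_lie_cartanIncl (y y' : ExtCartan H) :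
    ⁅cartanIncl B y, cartanIncl B y'⁆ = 0 := by
  obtain ⟨⟨h, k⟩, s, c⟩ := y
  obtain ⟨⟨h', k'⟩, s', c'⟩ := y'
  have h1 : ⁅(h : g), (h' : g)⁆ = 0 := by
    have : ⁅h, h'⁆ = 0 := trivial_lie_zero H H h h'
    rw [← LieSubalgebra.coe_bracket, this]; rfl
  have h2 : ∀ X : AffVir B, ⁅X, AffVir.K B⁆ = 0 := fun X => by rw [← lie_skew, AffVir.K_lie, neg_zero]
  have h3 : ∀ X : AffVir B, ⁅X, AffVir.C B⁆ = 0 := fun X => by rw [← lie_skew, AffVir.C_lie, neg_zero]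
  have h4 : ∀ x : g, ⁅AffVir.loop B 0 x, AffVir.d B 0⁆ = 0 := fun x => by
    rw [← lie_skew, AffVir.d_lie_loop]; simp
  simp [cartanIncl, h2, h3, h4, AffVir.loop_lie_loop, AffVir.d_lie_loop, h1, AffVir.K_lie,
    AffVir.C_lie]

theorem mem_weightSpace_iff (ρ : LoopAffVir B A →ₗ⁅ℂ⁆ Module.End ℂ V)
    (μ : Module.Dual ℂ (ExtCartan H)) (w : V) :
    w ∈ weightSpace B ρ μ ↔ ∀ h : ExtCartan H, ρ ((1 : A) ⊗ₜ[ℂ] cartanIncl B h) w = μ h • w :=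
  Iff.rfl

/-- `A ⊗ h̄` acts by commuting operators, so weight spaces sit in simultaneous generalized
eigenspaces, which are independent. -/
theorem iSupIndep_weightSpace (ρ : LoopAffVir B A →ₗ⁅ℂ⁆ Module.End ℂ V) :
    iSupIndep fun μ : Module.Dual ℂ (ExtCartan H) => weightSpace B ρ μ := by
  have h1 := Module.End.independent_iInf_maxGenEigenspace_of_forall_mapsTo
    (fun h : ExtCartan H => ρ ((1 : A) ⊗ₜ[ℂ] cartanIncl B h)) (fun h h' z =>
      Module.End.mapsTo_maxGenEigenspace_of_comm (by
        ext w
        rw [Module.End.mul_apply, Module.End.mul_apply, apply_apply_tmul,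
          cartanIncl_lie_cartanIncl]
        simp) z)
  have h2 := h1.comp (f := fun μ : Module.Dual ℂ (ExtCartan H) => (μ : ExtCartan H → ℂ))
    DFunLike.coe_injective
  refine h2.mono fun μ w hw => ?_
  refine (Submodule.mem_iInf _).2 fun h => ?_
  exact (Module.End.mem_maxGenEigenspace _ _ _).2
    ⟨1, by simp [(mem_weightSpace_iff ρ μ w).1 hw h]⟩

variable {ρ : LoopAffVir B A →ₗ⁅ℂ⁆ Module.End ℂ V} {b : (rootSystem H).Base}
  {ψ : A ⊗[ℂ] ExtCartan H →ₗ[ℂ] ℂ} {v : V}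

namespace IsIrrHighestWeight

variable (hv : IsIrrHighestWeight b ψ ρ v)
include hv

theorem iSup_weightSpace :
    ⨆ μ : Module.Dual ℂ (ExtCartan H), weightSpace B ρ μ = ⊤ := by
  refine hv.eq_top_of_neg_stable ?_ ?_
  · exact Submodule.mem_iSup_of_mem (ψ ∘ₗ TensorProduct.mk ℂ A (ExtCartan H) 1)
      ((mem_weightSpace_iff _ _ _).2 fun h => hv.weight 1 h)
  · intro a wt m X hX _ w hw
    refine apply_mem_of_mem_iSup (fun μ w hw => ?_) hw
    refine Submodule.mem_iSup_of_mem (μ + (wt ∘ₗ LinearMap.fst ℂ H ℂ ∘ₗ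
      LinearMap.fst ℂ (DerivedCartan H) (ℂ × ℂ) + (m : ℂ) • (LinearMap.fst ℂ ℂ ℂ ∘ₗ
        LinearMap.snd ℂ (DerivedCartan H) (ℂ × ℂ)))) ((mem_weightSpace_iff _ _ _).2 fun h => ?_)
    have h1 := apply_mem_eigenspace ρ a (hX.lie_cartanIncl h)
      (Module.End.mem_eigenspace_iff.2 ((mem_weightSpace_iff _ _ _).1 hw h))
    rw [Module.End.mem_eigenspace_iff] at h1
    rw [h1]
    congr 1
    simp [mul_comm]

section Finiteness

variable {θ : H.root} (hθ : IsHighestRoot b θ) {hρ : H}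
  (hhρ : ∀ i, (rootSystem H).root i hρ = b.height i) {I : Ideal A}
  (hI : FiniteDimensional ℂ (A ⧸ I))

/-- The vectors obtained from `v` by applying negative homogeneous elements, of total degree `-n`
with respect to `D`. -/
inductive IsWord (ρ : LoopAffVir B A →ₗ⁅ℂ⁆ Module.End ℂ V) (v : V) (h : H) (c : ℂ) : ℕ → V → Prop
  | base : IsWord ρ v h c 0 v
  | step (n k : ℕ) (w : V) (a : A) (wt : Module.Dual ℂ H) (m : ℤ) (X : AffVir B)
    (hw : IsWord ρ v h c n w) (hX : IsHomogeneous B wt m X)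
    (hk : wt h + c * m = -((k + 1 : ℕ) : ℂ)) : IsWord ρ v h c (n + k + 1) (ρ (a ⊗ₜ X) w)

omit hv in
theorem exists_fg_sup_eq_top (hI : FiniteDimensional ℂ (A ⧸ I)) :
    ∃ S : Submodule ℂ A, S.FG ∧ ∀ a : A, ∃ s ∈ S, a - s ∈ I := by
  classical
  obtain ⟨s, hs⟩ := hI.fg_top
  choose f hf using Ideal.Quotient.mk_surjective (I := I)
  refine ⟨Submodule.span ℂ (s.image f), ⟨s.image f, rfl⟩, fun a => ?_⟩
  have ha : Ideal.Quotient.mk I a ∈ Submodule.span ℂ (s : Set (A ⧸ I)) := hs ▸ Submodule.mem_top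
  have key : ∀ x ∈ Submodule.span ℂ (s : Set (A ⧸ I)),
      ∃ y ∈ Submodule.span ℂ ((s.image f : Finset A) : Set A), Ideal.Quotient.mk I y = x := by
    intro x hx
    induction hx using Submodule.span_induction with
    | zero => exact ⟨0, zero_mem _, map_zero _⟩
    | add x y _ _ hx hy =>
      obtain ⟨x', hx', rfl⟩ := hx
      obtain ⟨y', hy', rfl⟩ := hy
      exact ⟨x' + y', add_mem hx' hy', map_add _ _ _⟩
    | smul r x _ hx =>
      obtain ⟨x', hx', rfl⟩ := hx
      exact ⟨r • x', Submodule.smul_mem _ r hx', rfl⟩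
    | mem x hx =>
      exact ⟨f x, Submodule.subset_span (by simpa using ⟨x, hx, rfl⟩), hf x⟩
  obtain ⟨y, hy, hya⟩ := key _ ha
  exact ⟨y, hy, Ideal.Quotient.eq.1 hya.symm⟩

omit hv in
-- Every letter lowers the degree by at least one, so strong induction applies: a word of degree `n`
-- is `v` or a letter applied to a shorter degree `j < n`. The letter runs over `S ⊗ T`, with `T`
-- finite dimensional for the given degree and `S` representing `A` modulo `I`.
theorem finiteDimensional_span_isWord (hI : FiniteDimensional ℂ (A ⧸ I))
    (hρI : ∀ a ∈ I, ∀ X, ρ (a ⊗ₜ X) = 0) (h : H) {c : ℂ} (hc : c ≠ 0) (n : ℕ) :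
    (Submodule.span ℂ {w | IsWord ρ v h c n w}).FG := by
  obtain ⟨S, hS, hSI⟩ := exists_fg_sup_eq_top hI
  choose T hT hT' using exists_fg_of_degree B h hc
  let Φ : A →ₗ[ℂ] AffVir B →ₗ[ℂ] Module.End ℂ V :=
    (TensorProduct.mk ℂ A (AffVir B)).compr₂ (ρ : LoopAffVir B A →ₗ[ℂ] Module.End ℂ V)
  have hΦ : ∀ a X, Φ a X = ρ (a ⊗ₜ X) := fun a X => rfl
  induction n using Nat.strong_induction_on with
  | _ n ih =>
    have hle : Submodule.span ℂ {w | IsWord ρ v h c n w} ≤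
        Submodule.span ℂ {v} ⊔ ⨆ j : Fin n, Submodule.map₂ (LinearMap.id : Module.End ℂ V →ₗ[ℂ] _)
          (Submodule.map₂ Φ S (T (-((n - j : ℕ) : ℂ))))
          (Submodule.span ℂ {w | IsWord ρ v h c j w}) := by
      refine Submodule.span_le.2 fun w hw => ?_
      cases hw with
      | base => exact Submodule.mem_sup_left (Submodule.mem_span_singleton_self v)
      | step n k w a wt m X hw hX hk =>
        refine Submodule.mem_sup_right (Submodule.mem_iSup_of_mem ⟨n, by omega⟩ ?_)
        obtain ⟨s, hs, has⟩ := hSI a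
        have e : ρ (a ⊗ₜ X) = Φ s X := by
          rw [hΦ, ← sub_eq_zero, ← map_sub, ← TensorProduct.sub_tmul, hρI _ has]
        rw [e]
        refine Submodule.apply_mem_map₂ (LinearMap.id : Module.End ℂ V →ₗ[ℂ] _)
          (Submodule.apply_mem_map₂ _ hs (hT' _ wt m X hX ?_)) (Submodule.subset_span hw)
        rw [hk, show n + k + 1 - n = k + 1 by omega]
    have hfg : (Submodule.span ℂ {v} ⊔ ⨆ j : Fin n,
        Submodule.map₂ (LinearMap.id : Module.End ℂ V →ₗ[ℂ] _)
          (Submodule.map₂ Φ S (T (-((n - j : ℕ) : ℂ))))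
          (Submodule.span ℂ {w | IsWord ρ v h c j w})).FG :=
      (Submodule.fg_span_singleton v).sup (Submodule.fg_iSup _ fun j =>
        ((hS.map₂ Φ (hT _)).map₂ _ (ih j j.2)))
    have : FiniteDimensional ℂ _ := Module.Finite.iff_fg.2 hfg
    exact Module.Finite.iff_fg.1 (Submodule.finiteDimensional_of_le hle)

include hθ hhρ hI in
-- The words of degree `n` lie in one eigenspace each and together span `V`. By independence they
-- fill that eigenspace.
theorem finiteDimensional_eigenspace (hρI : ∀ a ∈ I, ∀ X, ρ (a ⊗ₜ X) = 0) (z : ℂ) :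
    FiniteDimensional ℂ
      ((ρ ((1 : A) ⊗ₜ gradingElement B hρ (b.height θ + 1 : ℤ))).eigenspace z) := by
  have hθ0 : 0 < b.height θ := hθ.isPos b
  have hc : ((b.height θ + 1 : ℤ) : ℂ) ≠ 0 := by
    exact_mod_cast (by omega : b.height θ + 1 ≠ 0)
  set c : ℂ := ((b.height θ + 1 : ℤ) : ℂ) with hcdef
  set z0 := ψ ((1 : A) ⊗ₜ ((hρ, 0), c, 0)) with hz0
  set D := ρ ((1 : A) ⊗ₜ gradingElement B hρ c) with hD
  let W : ℕ → Submodule ℂ V := fun n => Submodule.span ℂ {w | IsWord ρ v hρ c n w}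
  have hWE : ∀ n, W n ≤ D.eigenspace (z0 - n) := by
    refine fun n => Submodule.span_le.2 fun w hw => ?_
    induction hw with
    | base => simpa using hv.mem_eigenspace hρ c
    | step n k w a wt m X hw hX hk ih =>
      have := apply_mem_eigenspace ρ a (hX.lie_gradingElement hρ c) ih
      rw [hk] at this
      change _ ∈ D.eigenspace _
      convert this using 2
      push_cast; ring
  have hWtop : ⨆ n, W n = ⊤ := by
    refine hv.eq_top_of_neg_stable (Submodule.mem_iSup_of_mem 0
      (Submodule.subset_span IsWord.base)) fun a wt m X hX hneg w hw => ?_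
    refine apply_mem_of_mem_iSup (fun n w hw => ?_) hw
    obtain ⟨k, hk⟩ := principal_pos hθ hhρ (neg_eq_zero_or_root b hX.eq_zero_or_root) hneg.neg
    rw [← hcdef] at hk
    refine Submodule.mem_iSup_of_mem (n + k + 1) ?_
    induction hw using Submodule.span_induction with
    | zero => simp
    | add x y _ _ hx hy => rw [map_add]; exact add_mem hx hy
    | smul r x _ hx => rw [map_smul]; exact Submodule.smul_mem _ r hx
    | mem w hw =>
      refine Submodule.subset_span (IsWord.step n k w a wt m X hw hX ?_)
      rw [← hk, LinearMap.neg_apply]; push_cast; ring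
  by_cases hz : ∃ n : ℕ, z = z0 - n
  · obtain ⟨n, rfl⟩ := hz
    have hle : D.eigenspace (z0 - n) ≤ W n := by
      have h1 : D.eigenspace (z0 - n) ⊓ ⨆ (y : ℂ), ⨆ (_ : y ≠ z0 - n), D.eigenspace y = ⊥ :=
        disjoint_iff.1 (D.eigenspaces_iSupIndep (z0 - n))
      have h2 : W n ⊔ ⨆ (y : ℂ), ⨆ (_ : y ≠ z0 - n), D.eigenspace y = ⊤ := by
        rw [eq_top_iff, ← hWtop]
        refine iSup_le fun k => ?_
        rcases eq_or_ne k n with rfl | hkn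
        · exact le_sup_left
        · refine le_trans ((hWE k).trans ?_) le_sup_right
          refine le_iSup₂ (f := fun (y : ℂ) (_ : y ≠ z0 - n) => D.eigenspace y) (z0 - k) ?_
          intro h
          have h' : (k : ℂ) = n := by linear_combination -h
          exact hkn (by exact_mod_cast h')
      -- Modular law: `W n` lies in the eigenspace and has with the other eigenspaces the sum `⊤`,
      -- while the eigenspace meets them in `⊥`.
      calc D.eigenspace (z0 - n) = D.eigenspace (z0 - n) ⊓
            (W n ⊔ ⨆ (y : ℂ), ⨆ (_ : y ≠ z0 - n), D.eigenspace y) := by rw [h2, inf_top_eq]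
        _ = W n := by rw [inf_comm, sup_inf_assoc_of_le _ (hWE n), inf_comm, h1, sup_bot_eq]
        _ ≤ W n := le_rfl
    have : FiniteDimensional ℂ (W n) :=
      Module.Finite.iff_fg.2 (finiteDimensional_span_isWord hI hρI hρ hc n)
    exact Submodule.finiteDimensional_of_le hle
  · have hbot := hv.eigenspace_eq_bot (principal_weaklyPositive hθ hhρ) (z := z)
      (fun n hn => hz ⟨n, hn⟩)
    rw [hD, hbot]
    infer_instance

include hI in
theorem finiteDimensional_weightSpace (hρI : ∀ a ∈ I, ∀ X, ρ (a ⊗ₜ X) = 0)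
    (μ : Module.Dual ℂ (ExtCartan H)) : FiniteDimensional ℂ (weightSpace B ρ μ) := by
  obtain ⟨θ, hθ⟩ := exists_isHighestRoot b
  obtain ⟨hρ, hhρ⟩ := exists_apply_root_eq_height b
  have := hv.finiteDimensional_eigenspace hθ hhρ hI hρI
    (μ ((hρ, 0), ((b.height θ + 1 : ℤ) : ℂ), 0))
  refine Submodule.finiteDimensional_of_le (S₂ := (ρ ((1 : A) ⊗ₜ gradingElement B hρ
    (b.height θ + 1 : ℤ))).eigenspace (μ ((hρ, 0), ((b.height θ + 1 : ℤ) : ℂ), 0))) fun w hw => ?_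
  rw [Module.End.mem_eigenspace_iff, gradingElement_eq]
  exact (mem_weightSpace_iff _ _ _).1 hw _

end Finiteness

end IsIrrHighestWeight

end WeightModule

/-! ### One factor of `A/√I`, and the affine simple roots. -/

section Factor

set_option linter.unusedSectionVars false

open LieAlgebra.IsKilling LieAlgebra

attribute [local instance 100] LieRing.ofAssociativeRing

variable {g : Type*} [LieRing g] [LieAlgebra ℂ g] [FiniteDimensional ℂ g] [LieAlgebra.IsSimple ℂ g]
  {B : InvariantForm g} {H : LieSubalgebra ℂ g} [H.IsCartanSubalgebra]
  {A : Type*} [CommRing A] [Algebra ℂ A] {V : Type*} [AddCommGroup V] [Module ℂ V]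

theorem posPart_le_span (b : (rootSystem H).Base) : posPart B b ≤ Submodule.span ℂ
    {X | ∃ (wt : Module.Dual ℂ H) (m : ℤ), IsHomogeneous B wt m X ∧ IsPosWeight b wt m} := by
  refine Submodule.span_le.2 ?_
  rintro X ((⟨i, hi, x, hx, rfl⟩ | ⟨n, hn, x, rfl⟩) | ⟨n, hn, rfl⟩)
  · exact Submodule.subset_span ⟨_, 0, IsHomogeneous.loop i.1 0 x hx, Or.inr ⟨rfl, i, hi, rfl⟩⟩
  · refine iSup_rootSpace_induction (H := H) (p := fun x => AffVir.loop B n x ∈ Submodule.span ℂ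
      {X | ∃ (wt : Module.Dual ℂ H) (m : ℤ), IsHomogeneous B wt m X ∧ IsPosWeight b wt m})
      (fun x y hx hy => by rw [map_add]; exact add_mem hx hy) (fun χ x hx => ?_) x
    exact Submodule.subset_span ⟨_, n, IsHomogeneous.loop χ n x hx, Or.inl hn⟩
  · exact Submodule.subset_span ⟨_, n, IsHomogeneous.d n, Or.inl hn⟩

theorem root_isNonZero (i : H.root) : i.1.IsNonZero := by
  obtain ⟨α, hα⟩ := i
  simpa using hα

theorem isHomogeneous_loop_root (i : H.root) (m : ℤ) {x : g} (hx : x ∈ rootSpace H i.1) :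
    IsHomogeneous B ((rootSystem H).root i) m (AffVir.loop B m x) :=
  IsHomogeneous.loop i.1 m x hx

theorem isHomogeneous_loop_neg_root (i : H.root) (m : ℤ) {x : g} (hx : x ∈ rootSpace H (-i.1)) :
    IsHomogeneous B (-(rootSystem H).root i) m (AffVir.loop B m x) :=
  IsHomogeneous.loop (-i.1) m x hx

/-- Root vectors `x` and `y` of the roots `i` and `-i` with `[x, y]` the coroot. -/
structure IsRootPair (B : InvariantForm g) (i : H.root) (x y : g) : Prop where
  mem_pos : x ∈ rootSpace H i.1
  mem_neg : y ∈ rootSpace H (-i.1)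
  lie : ⁅x, y⁆ = ((rootSystem H).coroot i : g)
  lie_pos : ⁅((rootSystem H).coroot i : g), x⁆ = (2 : ℂ) • x
  lie_neg : ⁅((rootSystem H).coroot i : g), y⁆ = -((2 : ℂ) • y)
  form : B.form x y = B.form ((rootSystem H).coroot i : g) ((rootSystem H).coroot i : g) / 2
  span_pos : ∀ x' ∈ rootSpace H i.1, ∃ r : ℂ, x' = r • x

theorem exists_eq_smul_of_mem_rootSpace {α : LieModule.Weight ℂ H g} (hα : α.IsNonZero) {x : g}
    (hx : x ∈ rootSpace H α) (hx0 : x ≠ 0) : ∀ x' ∈ rootSpace H α, ∃ r : ℂ, x' = r • x := by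
  intro x' hx'
  have h1 := finrank_rootSpace_eq_one α hα
  obtain ⟨r, hr⟩ := (finrank_eq_one_iff_of_nonzero' (⟨x, hx⟩ : rootSpace H α)
    (fun h => hx0 (congrArg Subtype.val h))).1 h1 ⟨x', hx'⟩
  exact ⟨r, (congrArg Subtype.val hr).symm⟩

/-- By invariance `⟨h, h⟩ = ⟨[x, y], h⟩ = ⟨x, [y, h]⟩ = 2⟨x, y⟩`, where `h` is the coroot. This
makes the central term of `[x ⊗ t, y ⊗ t⁻¹]` the coefficient of `K` in `affineCoroot`. -/
theorem exists_isRootPair (B : InvariantForm g) (i : H.root) : ∃ x y, IsRootPair B i x y := by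
  have hi : i.1.IsNonZero := root_isNonZero i
  obtain ⟨h, x, y, ht, hx, hy⟩ := exists_isSl2Triple_of_weight_isNonZero hi
  have hh : h = ((rootSystem H).coroot i : g) := ht.h_eq_coroot hi hx hy
  subst hh
  refine ⟨x, y, hx, hy, ht.lie_e_f, ht.lie_h_e_smul ℂ, ht.lie_lie_smul_f ℂ, ?_,
    exists_eq_smul_of_mem_rootSpace hi hx ht.e_ne_zero⟩
  have e : B.form ((rootSystem H).coroot i : g) ((rootSystem H).coroot i : g) =
      2 * B.form x y := by
    calc B.form ((rootSystem H).coroot i : g) ((rootSystem H).coroot i : g)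
        = B.form ⁅x, y⁆ ((rootSystem H).coroot i : g) := by rw [ht.lie_e_f]
      _ = B.form x ⁅y, ((rootSystem H).coroot i : g)⁆ := B.invariant _ _ _
      _ = 2 * B.form x y := by
        rw [← lie_skew, ht.lie_lie_smul_f ℂ, neg_neg, map_smul, smul_eq_mul]
  rw [e]; ring

variable (ρ : LoopAffVir B A →ₗ⁅ℂ⁆ Module.End ℂ V)

/-- Modulo the annihilator of `V`, the element `e` is the unit of a factor `ℂ` of `A`, for the
action of the affine part. -/
structure IsFactorOf (e : A) (χ : A →ₐ[ℂ] ℂ) : Prop where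
  unit : χ e = 1
  act : ∀ a : A, ∀ X ∈ affinePart B, ρ ((a * e) ⊗ₜ X) = χ a • ρ (e ⊗ₜ X)

variable {ρ} {e : A} {χ : A →ₐ[ℂ] ℂ}

theorem IsFactorOf.apply_apply (he : IsFactorOf ρ e χ) (a : A) (X : AffVir B) {Y : AffVir B}
    (hY : Y ∈ affinePart B) (w : V) :
    ρ (a ⊗ₜ X) (ρ (e ⊗ₜ Y) w) = χ a • ρ (e ⊗ₜ ⁅X, Y⁆) w + ρ (e ⊗ₜ Y) (ρ (a ⊗ₜ X) w) := by
  rw [apply_apply_tmul, he.act a _ (lie_mem_affinePart X hY), LinearMap.smul_apply]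

/-- Since `χ e = 1`, the products `e * e` and `e` act alike on the affine part, so `X ↦ e ⊗ X`
respects brackets there although `e` need not be idempotent. -/
theorem IsFactorOf.lie_eq (he : IsFactorOf ρ e χ) (X : AffVir B) {Y : AffVir B}
    (hY : Y ∈ affinePart B) : ⁅ρ (e ⊗ₜ X), ρ (e ⊗ₜ Y)⁆ = ρ (e ⊗ₜ ⁅X, Y⁆) := by
  ext w
  rw [Ring.lie_def, LinearMap.sub_apply, Module.End.mul_apply, Module.End.mul_apply,
    he.apply_apply e X hY, he.unit, one_smul, add_sub_cancel_right]

theorem lie_ad_pow_tmul (X Z : AffVir B) (e a : A) (n : ℕ) :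
    ((LieAlgebra.ad ℂ (Module.End ℂ V) (ρ (e ⊗ₜ X))) ^ n) (ρ (a ⊗ₜ Z)) =
      ρ ((e ^ n * a) ⊗ₜ ((LieAlgebra.ad ℂ (AffVir B) X) ^ n) Z) := by
  induction n with
  | zero => simp
  | succ n ih =>
    rw [pow_succ', Module.End.mul_apply, ih, LieAlgebra.ad_apply, ← LieHom.map_lie,
      LieAlgebra.ExtendScalars.bracket_tmul, ← LieAlgebra.ad_apply ℂ, ← Module.End.mul_apply,
      ← pow_succ', ← mul_assoc, ← pow_succ']

/-- On loops the iterates are those of `ad y`, which is nilpotent, up to multiples of `K`. On `dₗ`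
the first bracket is a multiple of `y ⊗ t^(l+m)`, and the second is central. -/
theorem exists_ad_loop_pow_eq_zero {i : LieModule.Weight ℂ H g} (hi : i.IsNonZero) {y : g}
    (hy : y ∈ rootSpace H i) (m : ℤ) (Z : AffVir B) :
    ∃ n : ℕ, ((LieAlgebra.ad ℂ (AffVir B) (AffVir.loop B m y)) ^ n) Z = 0 := by
  set D := LieAlgebra.ad ℂ (AffVir B) (AffVir.loop B m y) with hD
  have hDK : D (AffVir.K B) = 0 := by rw [hD, LieAlgebra.ad_apply, ← lie_skew, AffVir.K_lie, neg_zero]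
  have hDC : D (AffVir.C B) = 0 := by rw [hD, LieAlgebra.ad_apply, ← lie_skew, AffVir.C_lie, neg_zero]
  have hDloop : ∀ (l : ℤ) (z : g), ∃ r : ℂ, D (AffVir.loop B l z) =
      AffVir.loop B (m + l) ⁅y, z⁆ + r • AffVir.K B := fun l z =>
    ⟨_, by rw [hD, LieAlgebra.ad_apply, AffVir.loop_lie_loop]⟩
  suffices h : Z ∈ D.maxGenEigenspace 0 by
    obtain ⟨n, hn⟩ := (Module.End.mem_maxGenEigenspace _ _ _).1 h
    exact ⟨n, by simpa using hn⟩
  have hmem : ∀ (n : ℕ) (Z : AffVir B), (D ^ n) Z = 0 → Z ∈ D.maxGenEigenspace 0 := fun n Z h =>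
    (Module.End.mem_maxGenEigenspace _ _ _).2 ⟨n, by simpa using h⟩
  induction Z using homogeneous_induction H with
  | hzero => exact zero_mem _
  | hadd X Y hX hY => exact add_mem hX hY
  | hsmul r X hX => exact Submodule.smul_mem _ r hX
  | h wt l X hX =>
    cases hX with
    | loop χ l x hx =>
      have hpow : ∀ n : ℕ, ∃ r : ℂ, (D ^ n) (AffVir.loop B l x) =
          AffVir.loop B (n * m + l) (((LieAlgebra.ad ℂ g y) ^ n) x) + r • AffVir.K B := by
        intro n
        induction n with
        | zero => exact ⟨0, by simp⟩
        | succ n ih =>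
          obtain ⟨r, hr⟩ := ih
          obtain ⟨s, hs⟩ := hDloop (n * m + l) (((LieAlgebra.ad ℂ g y) ^ n) x)
          refine ⟨s, ?_⟩
          rw [pow_succ', Module.End.mul_apply, hr, map_add, map_smul, hDK, smul_zero, add_zero, hs,
            pow_succ', Module.End.mul_apply, LieAlgebra.ad_apply]
          congr 3
          push_cast; ring
      obtain ⟨n, hn⟩ := LieAlgebra.isNilpotent_ad_of_mem_rootSpace (K := ℂ) H
        (χ := (i : H → ℂ)) hi hy
      obtain ⟨r, hr⟩ := hpow n
      -- One application more than for `ad y`, to remove the leftover multiple of `K`.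
      refine hmem (n + 1) _ ?_
      rw [pow_succ', Module.End.mul_apply, hr, hn, LinearMap.zero_apply, map_zero, zero_add,
        map_smul, hDK, smul_zero]
    | d l =>
      obtain ⟨r, hr⟩ := hDloop (l + m) y
      refine hmem 3 _ ?_
      have h1 : D (AffVir.d B l) = -((m : ℂ) • AffVir.loop B (l + m) y) := by
        rw [hD, LieAlgebra.ad_apply, ← lie_skew, AffVir.d_lie_loop]
      rw [pow_succ, pow_two, Module.End.mul_apply, h1, map_neg, Module.End.mul_apply, map_smul, hr,
        lie_self, map_zero, zero_add, map_smul, map_smul, hDK, smul_zero, smul_zero,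
        neg_zero]
    | K => exact hmem 1 _ (by simpa using hDK)
    | C => exact hmem 1 _ (by simpa using hDC)

theorem isLocNilpotent_iff {E : Module.End ℂ V} : IsLocNilpotent E ↔ E.maxGenEigenspace 0 = ⊤ := by
  rw [Submodule.eq_top_iff']
  refine forall_congr' fun w => ?_
  rw [Module.End.mem_maxGenEigenspace]
  simp

variable {b : (rootSystem H).Base} {ψ : A ⊗[ℂ] ExtCartan H →ₗ[ℂ] ℂ} {v : V}

namespace IsIrrHighestWeight

variable (hv : IsIrrHighestWeight b ψ ρ v)
include hv

/-- As the root vector is locally `ad`-nilpotent, the vectors killed by its powers form a submodule.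
Containing `v`, it is everything. -/
theorem isLocNilpotent_of_pow_eq_zero {i : LieModule.Weight ℂ H g} (hi : i.IsNonZero) {y : g}
    (hy : y ∈ rootSpace H i) (m : ℤ) (e : A) {n : ℕ}
    (hn : (ρ (e ⊗ₜ AffVir.loop B m y) ^ n) v = 0) :
    IsLocNilpotent (ρ (e ⊗ₜ AffVir.loop B m y)) := by
  rw [isLocNilpotent_iff]
  refine hv.cyclic _ ((Module.End.mem_maxGenEigenspace _ _ _).2 ⟨n, by simpa using hn⟩)
    (stable_of_homogeneous ρ H fun a wt l X _ u hu => ?_)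
  obtain ⟨k, hk⟩ := exists_ad_loop_pow_eq_zero (B := B) hi hy m X
  exact mem_maxGenEigenspace_of_ad_pow ⟨k, by
    rw [lie_ad_pow_tmul, hk, TensorProduct.tmul_zero, map_zero]⟩ hu

/-- An eigenspace of a central element is a submodule. -/
theorem apply_K (a : A) (w : V) :
    ρ (a ⊗ₜ AffVir.K B) w = ψ (a ⊗ₜ ((0, 1), 0, 0)) • w := by
  let U := (ρ (a ⊗ₜ AffVir.K B)).eigenspace (ψ (a ⊗ₜ ((0, 1), 0, 0)))
  have hU : U = ⊤ := by
    refine hv.cyclic U (Module.End.mem_eigenspace_iff.2 ?_) (stable_of_homogeneous ρ H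
      fun a' wt m X hX u hu => Module.End.mem_eigenspace_iff.2 ?_)
    · rw [← hv.weight]; simp [cartanIncl]
    · rw [apply_apply_tmul, Module.End.mem_eigenspace_iff.1 hu, AffVir.K_lie,
        TensorProduct.tmul_zero, map_zero, LinearMap.zero_apply, zero_add, map_smul]
  exact Module.End.mem_eigenspace_iff.1 (hU ▸ Submodule.mem_top : w ∈ U)

section RealRoot

variable (he : IsFactorOf ρ e χ) {i : H.root} {x y : g} (hxy : IsRootPair B i x y) (m : ℤ)

include he hxy

omit hv in
/-- The `sl₂`-triple of a real root of the affine algebra. -/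
theorem sl2_relations :
    ⁅ρ (e ⊗ₜ AffVir.loop B m x), ρ (e ⊗ₜ AffVir.loop B (-m) y)⁆ =
      ρ (e ⊗ₜ (AffVir.loop B 0 ((rootSystem H).coroot i : g) +
        ((m : ℂ) * B.form x y) • AffVir.K B)) ∧
    ⁅ρ (e ⊗ₜ (AffVir.loop B 0 ((rootSystem H).coroot i : g) +
        ((m : ℂ) * B.form x y) • AffVir.K B)), ρ (e ⊗ₜ AffVir.loop B m x)⁆ =
      (2 : ℂ) • ρ (e ⊗ₜ AffVir.loop B m x) ∧
    ⁅ρ (e ⊗ₜ (AffVir.loop B 0 ((rootSystem H).coroot i : g) +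
        ((m : ℂ) * B.form x y) • AffVir.K B)), ρ (e ⊗ₜ AffVir.loop B (-m) y)⁆ =
      -((2 : ℂ) • ρ (e ⊗ₜ AffVir.loop B (-m) y)) := by
  refine ⟨?_, ?_, ?_⟩
  · rw [he.lie_eq _ (loop_mem_affinePart _ _), AffVir.loop_lie_loop, hxy.lie]
    simp
  · rw [he.lie_eq _ (loop_mem_affinePart _ _), add_lie, smul_lie, AffVir.K_lie,
      AffVir.loop_lie_loop, hxy.lie_pos]
    simp
  · rw [he.lie_eq _ (loop_mem_affinePart _ _), add_lie, smul_lie, AffVir.K_lie,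
      AffVir.loop_lie_loop, hxy.lie_neg]
    simp [TensorProduct.tmul_neg]

/-- For a simple root of the affine algebra, with dominant integral highest weight, the negative
root vector acts locally nilpotently. -/
theorem isLocNilpotent_of_simple (hpos : IsPosWeight b ((rootSystem H).root i) m) {h : H} {c : ℂ}
    (hc : IsWeaklyPositive b h c) (hc0 : (rootSystem H).root i h + c * m = 0)
    (hc' : ∀ (wt : Module.Dual ℂ H) (m' : ℤ), (wt = 0 ∨ ∃ i, wt = (rootSystem H).root i) →
      IsPosWeight b wt m' → wt h + c * m' = 0 → wt = (rootSystem H).root i ∧ m' = m)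
    {k : ℕ} (hk : ψ (e ⊗ₜ (((rootSystem H).coroot i, (m : ℂ) * B.form x y), 0, 0)) = k) :
    IsLocNilpotent (ρ (e ⊗ₜ AffVir.loop B (-m) y)) := by
  obtain ⟨θ, hθ⟩ := exists_isHighestRoot b
  obtain ⟨hρ, hhρ⟩ := exists_apply_root_eq_height b
  have hi : i.1.IsNonZero := root_isNonZero i
  set E := ρ (e ⊗ₜ AffVir.loop B m x) with hE
  set F := ρ (e ⊗ₜ AffVir.loop B (-m) y) with hF
  have hFh : IsHomogeneous B (-(rootSystem H).root i) (-m) (AffVir.loop B (-m) y) :=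
    isHomogeneous_loop_neg_root i (-m) hxy.mem_neg
  obtain ⟨hEF, hZE, hZF⟩ := sl2_relations he hxy m
  rw [← hE, ← hF] at hEF
  rw [← hF] at hZF
  have hZ : ρ (e ⊗ₜ (AffVir.loop B 0 ((rootSystem H).coroot i : g) +
      ((m : ℂ) * B.form x y) • AffVir.K B)) v = (k : ℂ) • v := by
    rw [← hk, ← hv.weight]
    simp [cartanIncl]
  have hEv : E v = 0 :=
    hv.pos e _ ((isHomogeneous_loop_root i m hxy.mem_pos).mem_posPart hpos)
  have hEF0 : E ((F ^ (k + 1)) v) = 0 := by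
    rw [apply_pow_succ_of_primitive hEF hZF hZ hEv k, sub_self, mul_zero, zero_smul]
  suffices hw : (F ^ (k + 1)) v = 0 from
    hv.isLocNilpotent_of_pow_eq_zero (i := -i.1) hi.neg hxy.mem_neg (-m) e hw
  -- Used for two gradings: the one adapted to the simple root, where `F` has degree `0`, and the
  -- principal one, where `F` strictly lowers the degree.
  have hgrade : ∀ (h : H) (c s : ℂ), -(rootSystem H).root i h + c * (-m : ℤ) = s → ∀ n : ℕ,
      (F ^ n) v ∈ (ρ ((1 : A) ⊗ₜ gradingElement B h c)).eigenspace
        (ψ ((1 : A) ⊗ₜ ((h, 0), c, 0)) + n * s) := by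
    intro h c s hs n
    induction n with
    | zero => simpa using hv.mem_eigenspace h c
    | succ n ih =>
      rw [pow_succ', Module.End.mul_apply]
      have h1 := hFh.lie_gradingElement h c
      rw [LinearMap.neg_apply, hs] at h1
      convert apply_mem_eigenspace ρ e h1 ih using 2
      push_cast; ring
  -- It remains to see that `F^(k+1) v` is killed by `A ⊗ 𝔏⁺`, is an eigenvector of `A ⊗ h̄`, and
  -- has lower principal degree than `v`.
  have hbot := hv.eq_bot_of_borel_stable hθ hhρ (W := Submodule.span ℂ {(F ^ (k + 1)) v}) ?_ ?_ ?_
  · exact (Submodule.span_singleton_eq_bot).1 hbot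
  · have hzero : ∀ (a : A), ∀ X ∈ posPart B b, ρ (a ⊗ₜ X) ((F ^ (k + 1)) v) = 0 := by
      intro a X hX
      have hX' := posPart_le_span b hX
      clear hX
      induction hX' using Submodule.span_induction with
      | zero => simp
      | add X Y _ _ hX hY =>
        rw [TensorProduct.tmul_add, map_add, LinearMap.add_apply, hX, hY, add_zero]
      | smul r X _ hX =>
        rw [TensorProduct.tmul_smul, map_smul, LinearMap.smul_apply, hX, smul_zero]
      | mem X hX =>
        obtain ⟨wt, m', hX, hXpos⟩ := hX
        obtain ⟨n, hn⟩ := hc wt m' hX.eq_zero_or_root hXpos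
        rcases Nat.eq_zero_or_pos n with rfl | hn0
        · have h0 := hn
          rw [Nat.cast_zero] at h0
          obtain ⟨rfl, rfl⟩ := hc' wt m' hX.eq_zero_or_root hXpos h0
          -- Degree `0` leaves only the root space of the simple root itself. There `a` splits into
          -- `χ a • e`, handled by the `sl₂`-formula, and a part killed by `χ`, which commutes with
          -- `F` and so can be applied to `v` first.
          have hcomm : ρ ((a - χ a • e) ⊗ₜ X) ((F ^ (k + 1)) v) =
              (F ^ (k + 1)) (ρ ((a - χ a • e) ⊗ₜ X) v) := by
            have hc1 : Commute (ρ ((a - χ a • e) ⊗ₜ X)) F := by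
              ext w
              rw [Module.End.mul_apply, Module.End.mul_apply, hF,
                he.apply_apply _ _ (loop_mem_affinePart _ _), map_sub, map_smul, he.unit,
                smul_eq_mul, mul_one, sub_self, zero_smul, zero_add]
            exact LinearMap.congr_fun (hc1.pow_right (k + 1)).eq v
          rw [hv.pos _ _ (hX.mem_posPart hXpos), map_zero, TensorProduct.sub_tmul, map_sub,
            LinearMap.sub_apply, sub_eq_zero] at hcomm
          rw [hcomm, ← TensorProduct.smul_tmul', map_smul, LinearMap.smul_apply]
          have hEX : ∃ r : ℂ, ρ (e ⊗ₜ X) = r • E := by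
            have hne := (rootSystem H).ne_zero i
            generalize hwt : (rootSystem H).root i = wt at hX
            cases hX with
            | loop χ m x' hx' =>
              have h' : (χ : H → ℂ) = i.1 := by
                ext z; exact (LinearMap.congr_fun hwt z).symm
              rw [h'] at hx'
              obtain ⟨r, rfl⟩ := hxy.span_pos x' hx'
              exact ⟨r, by rw [map_smul, TensorProduct.tmul_smul, map_smul]⟩
            | d m => exact absurd hwt hne
            | K => exact absurd hwt hne
            | C => exact absurd hwt hne
          obtain ⟨r, hr⟩ := hEX
          rw [hr, LinearMap.smul_apply, hEF0, smul_zero, smul_zero]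
        -- In the adapted grading `F^(k+1) v` still has the degree of `v`. A letter of positive
        -- degree would lead above the top.
        · have h1 := apply_mem_eigenspace ρ a (hX.lie_gradingElement h c)
            (hgrade h c 0 (by push_cast; linear_combination -hc0) (k + 1))
          rw [hn, mul_zero, add_zero, hv.eigenspace_eq_bot hc fun n' hn' => ?_] at h1
          · exact (Submodule.mem_bot ℂ).1 h1
          · have h2 : ((n + n' : ℕ) : ℂ) = (0 : ℕ) := by push_cast; linear_combination hn'
            have h3 : n + n' = 0 := by exact_mod_cast h2
            omega
    intro a X hX w hw
    obtain ⟨r, rfl⟩ := Submodule.mem_span_singleton.1 hw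
    rw [map_smul, hzero a X hX, smul_zero]
    exact zero_mem _
  · intro a z w hw
    obtain ⟨r, rfl⟩ := Submodule.mem_span_singleton.1 hw
    have hev : ∀ n : ℕ, ∃ s : ℂ, ρ (a ⊗ₜ cartanIncl B z) ((F ^ n) v) = s • (F ^ n) v := by
      intro n
      induction n with
      | zero => exact ⟨_, by simpa using hv.weight a z⟩
      | succ n ih =>
        obtain ⟨s, hs⟩ := ih
        rw [pow_succ', Module.End.mul_apply, hF, he.apply_apply _ _ (loop_mem_affinePart _ _), ← hF,
          hs, hFh.lie_cartanIncl, TensorProduct.tmul_smul, map_smul, ← hF, map_smul,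
          LinearMap.smul_apply, smul_smul, ← add_smul]
        exact ⟨_, rfl⟩
    obtain ⟨s, hs⟩ := hev (k + 1)
    rw [map_smul, hs]
    exact Submodule.smul_mem _ _ (Submodule.smul_mem _ _ (Submodule.mem_span_singleton_self _))
  · rw [Submodule.span_singleton_le_iff_mem]
    obtain ⟨n, hn⟩ := principal_pos hθ hhρ (Or.inr ⟨i, rfl⟩) hpos
    have h1 := hgrade hρ (b.height θ + 1 : ℤ) (-((n + 1 : ℕ) : ℂ))
      (by rw [← hn]; push_cast; ring) (k + 1)
    -- `(k + 1)(n + 1) = (k n + k + n) + 1`.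
    refine Submodule.mem_iSup_of_mem (k * n + k + n) ?_
    convert h1 using 2
    push_cast; ring

end RealRoot

end IsIrrHighestWeight

end Factor

/-! ### Bounded directions and reflections: all real roots. -/

section Weyl

set_option linter.unusedSectionVars false

open LieAlgebra.IsKilling LieAlgebra

attribute [local instance 100] LieRing.ofAssociativeRing

variable {g : Type*} [LieRing g] [LieAlgebra ℂ g] [FiniteDimensional ℂ g] [LieAlgebra.IsSimple ℂ g]
  {B : InvariantForm g} {H : LieSubalgebra ℂ g} [H.IsCartanSubalgebra]
  {A : Type*} [CommRing A] [Algebra ℂ A] {V : Type*} [AddCommGroup V] [Module ℂ V]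

/-- The joint eigenspaces of `e ⊗ H` and of `1 ⊗ (h + c d₀)`. -/
def factorWeightSpace (ρ : LoopAffVir B A →ₗ⁅ℂ⁆ Module.End ℂ V) (e : A) (h : H) (c : ℂ)
    (μ : Module.Dual ℂ H × ℂ) : Submodule ℂ V :=
  (⨅ h' : H, (ρ (e ⊗ₜ AffVir.loop B 0 (h' : g))).eigenspace (μ.1 h')) ⊓
    (ρ ((1 : A) ⊗ₜ gradingElement B h c)).eigenspace μ.2

/-- The weight `(wt, m)` in the coordinates of `factorWeightSpace`. -/
def affineWeight (h : H) (c : ℂ) (wt : Module.Dual ℂ H) (m : ℂ) : Module.Dual ℂ H × ℂ :=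
  (wt, wt h + c * m)

theorem affineWeight_sub_smul (h : H) (c : ℂ) (wt wt' : Module.Dual ℂ H) (m m' r : ℂ) :
    affineWeight h c wt m - r • affineWeight h c wt' m' =
      affineWeight h c (wt - r • wt') (m - r * m') := by
  refine Prod.ext rfl ?_
  simp only [affineWeight, Prod.snd_sub, Prod.smul_snd, LinearMap.sub_apply, LinearMap.smul_apply,
    smul_eq_mul]
  ring

variable {ρ : LoopAffVir B A →ₗ⁅ℂ⁆ Module.End ℂ V} {e : A} {χ : A →ₐ[ℂ] ℂ} {h : H} {c : ℂ}

theorem mem_factorWeightSpace {μ : Module.Dual ℂ H × ℂ} {w : V} :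
    w ∈ factorWeightSpace ρ e h c μ ↔ (∀ h' : H, ρ (e ⊗ₜ AffVir.loop B 0 (h' : g)) w = μ.1 h' • w) ∧
      ρ ((1 : A) ⊗ₜ gradingElement B h c) w = μ.2 • w := by
  rw [factorWeightSpace, Submodule.mem_inf, Submodule.mem_iInf, Module.End.mem_eigenspace_iff]
  simp only [Module.End.mem_eigenspace_iff]

theorem IsFactorOf.apply_loop_zero (he : IsFactorOf ρ e χ) (a : A) {wt : Module.Dual ℂ H} {m : ℤ}
    {X : AffVir B} (hX : IsHomogeneous B wt m X) (h' : H) (w : V) :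
    ρ (e ⊗ₜ AffVir.loop B 0 (h' : g)) (ρ (a ⊗ₜ X) w) =
      (χ a * wt h') • ρ (e ⊗ₜ X) w + ρ (a ⊗ₜ X) (ρ (e ⊗ₜ AffVir.loop B 0 (h' : g)) w) := by
  have h1 : ⁅AffVir.loop B 0 (h' : g), X⁆ = wt h' • X := by
    have := hX.lie_gradingElement h' 0
    simpa [gradingElement] using this
  rw [apply_apply_tmul, h1, TensorProduct.tmul_smul, map_smul, LinearMap.smul_apply]
  congr 1
  rcases hX.mem_affinePart_or with h2 | rfl
  · rw [mul_comm e a, he.act a X h2, LinearMap.smul_apply, smul_smul, mul_comm]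
  · simp

theorem IsFactorOf.apply_mem (he : IsFactorOf ρ e χ) {wt : Module.Dual ℂ H} {m : ℤ}
    {X : AffVir B} (hX : IsHomogeneous B wt m X) {μ : Module.Dual ℂ H × ℂ} {w : V}
    (hw : w ∈ factorWeightSpace ρ e h c μ) :
    ρ (e ⊗ₜ X) w ∈ factorWeightSpace ρ e h c (μ + affineWeight h c wt m) := by
  rw [mem_factorWeightSpace] at hw ⊢
  refine ⟨fun h' => ?_, ?_⟩
  · rw [he.apply_loop_zero e hX, hw.1, he.unit, one_mul, map_smul, ← add_smul, add_comm]
    rfl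
  · exact Module.End.mem_eigenspace_iff.1 (apply_mem_eigenspace ρ e (hX.lie_gradingElement h c)
      (Module.End.mem_eigenspace_iff.2 hw.2))

/-- If `χ a = 0`, then `(a * e) ⊗ X` acts by zero on the affine part, so `a ⊗ X` commutes with `e ⊗
H` and changes the degree only. -/
theorem IsFactorOf.apply_mem' (he : IsFactorOf ρ e χ) {a : A} (ha : χ a = 0)
    {wt : Module.Dual ℂ H} {m : ℤ} {X : AffVir B} (hX : IsHomogeneous B wt m X)
    {μ : Module.Dual ℂ H × ℂ} {w : V} (hw : w ∈ factorWeightSpace ρ e h c μ) :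
    ρ (a ⊗ₜ X) w ∈ factorWeightSpace ρ e h c (μ + (0, wt h + c * m)) := by
  rw [mem_factorWeightSpace] at hw ⊢
  refine ⟨fun h' => ?_, ?_⟩
  · rw [he.apply_loop_zero a hX, hw.1, ha, zero_mul, zero_smul, zero_add, map_smul]
    simp
  · exact Module.End.mem_eigenspace_iff.1 (apply_mem_eigenspace ρ a (hX.lie_gradingElement h c)
      (Module.End.mem_eigenspace_iff.2 hw.2))

theorem IsFactorOf.pow_apply_mem (he : IsFactorOf ρ e χ) {wt : Module.Dual ℂ H} {m : ℤ}
    {X : AffVir B} (hX : IsHomogeneous B wt m X) {μ : Module.Dual ℂ H × ℂ} {w : V}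
    (hw : w ∈ factorWeightSpace ρ e h c μ) (n : ℕ) :
    (ρ (e ⊗ₜ X) ^ n) w ∈ factorWeightSpace ρ e h c (μ + (n : ℂ) • affineWeight h c wt m) := by
  induction n with
  | zero => simpa using hw
  | succ n ih =>
    rw [pow_succ', Module.End.mul_apply]
    have key := he.apply_mem hX ih
    rwa [show μ + (n : ℂ) • affineWeight h c wt m + affineWeight h c wt m =
      μ + ((n + 1 : ℕ) : ℂ) • affineWeight h c wt m by push_cast; module] at key

/-- The weights in the direction `γ` are bounded: for each `μ`, `μ + N γ` is a weight for finitely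
many `N` only. -/
def IsBoundedDirection (ρ : LoopAffVir B A →ₗ⁅ℂ⁆ Module.End ℂ V) (e : A) (h : H) (c : ℂ)
    (γ : Module.Dual ℂ H × ℂ) : Prop :=
  ∀ μ, ∃ N₀ : ℕ, ∀ N ≥ N₀, factorWeightSpace ρ e h c (μ + (N : ℂ) • γ) = ⊥

variable {b : (rootSystem H).Base} {ψ : A ⊗[ℂ] ExtCartan H →ₗ[ℂ] ℂ} {v : V}

namespace IsIrrHighestWeight

variable (hv : IsIrrHighestWeight b ψ ρ v) (he : IsFactorOf ρ e χ)
include hv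

theorem isBoundedDirection_of_pos (hc : IsWeaklyPositive b h c) {γ : Module.Dual ℂ H × ℂ} {n : ℕ}
    (hγ : γ.2 = (n + 1 : ℕ)) : IsBoundedDirection ρ e h c γ := by
  intro μ
  -- Nonzero degrees are of the form top minus a natural number. If `μ + N γ` lies `k` below the
  -- top, then `k + 1` further steps, each raising the degree by at least one, go past it. Otherwise
  -- no `μ + N γ` is a weight.
  by_cases hex : ∃ N k : ℕ, μ.2 + N * γ.2 = ψ ((1 : A) ⊗ₜ ((h, 0), c, 0)) - k
  · obtain ⟨N, k, hNk⟩ := hex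
    refine ⟨N + k + 1, fun M hM => ?_⟩
    refine le_bot_iff.1 (inf_le_right.trans (le_bot_iff.2 (hv.eigenspace_eq_bot hc fun k' hk' => ?_)))
    have h1 : μ.2 + M * γ.2 = ψ ((1 : A) ⊗ₜ ((h, 0), c, 0)) - k' := by simpa using hk'
    rw [hγ] at hNk h1
    have h2 : ((M * (n + 1) + k' : ℕ) : ℂ) = ((N * (n + 1) + k : ℕ) : ℂ) := by
      push_cast at hNk h1 ⊢; linear_combination h1 - hNk
    have h3 : M * (n + 1) + k' = N * (n + 1) + k := by exact_mod_cast h2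
    have h4 : (N + k + 1) * (n + 1) ≤ M * (n + 1) := Nat.mul_le_mul_right _ hM
    nlinarith
  · push Not at hex
    refine ⟨0, fun M _ => ?_⟩
    refine le_bot_iff.1 (inf_le_right.trans (le_bot_iff.2 (hv.eigenspace_eq_bot hc fun k' hk' => ?_)))
    exact hex M k' (by simpa using hk')

include he

/-- Write `a = (a - χ a • e) + χ a • e`: each of the two parts maps weight vectors to weight
vectors, with different shifts. -/
theorem iSup_factorWeightSpace : ⨆ μ, factorWeightSpace ρ e h c μ = ⊤ := by
  refine hv.eq_top_of_neg_stable ?_ ?_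
  · refine Submodule.mem_iSup_of_mem (ψ ∘ₗ TensorProduct.mk ℂ A (ExtCartan H) e ∘ₗ
      LinearMap.inl ℂ (DerivedCartan H) (ℂ × ℂ) ∘ₗ LinearMap.inl ℂ H ℂ,
      ψ ((1 : A) ⊗ₜ ((h, 0), c, 0))) (mem_factorWeightSpace.2 ⟨fun h' => ?_, ?_⟩)
    · have := hv.weight e ((h', 0), 0, 0)
      rwa [show cartanIncl B ((h', 0), 0, 0) = AffVir.loop B 0 (h' : g) by
        simp [cartanIncl]] at this
    · exact Module.End.mem_eigenspace_iff.1 (hv.mem_eigenspace h c)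
  · intro a wt m X hX _ w hw
    refine apply_mem_of_mem_iSup (fun μ w hw => ?_) hw
    have e1 : ρ (a ⊗ₜ X) w = ρ ((a - χ a • e) ⊗ₜ X) w + χ a • ρ (e ⊗ₜ X) w := by
      rw [TensorProduct.sub_tmul, map_sub, LinearMap.sub_apply, ← TensorProduct.smul_tmul',
        map_smul, LinearMap.smul_apply, sub_add_cancel]
    rw [e1]
    refine add_mem (Submodule.mem_iSup_of_mem _ (he.apply_mem' ?_ hX hw))
      (Submodule.smul_mem _ _ (Submodule.mem_iSup_of_mem _ (he.apply_mem hX hw)))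
    rw [map_sub, map_smul, he.unit, smul_eq_mul, mul_one, sub_self]

theorem isLocNilpotent_of_isBoundedDirection {wt : Module.Dual ℂ H} {m : ℤ} {X : AffVir B}
    (hX : IsHomogeneous B wt m X) (hγ : IsBoundedDirection ρ e h c (affineWeight h c wt m)) :
    IsLocNilpotent (ρ (e ⊗ₜ X)) := by
  rw [isLocNilpotent_iff, eq_top_iff, ← hv.iSup_factorWeightSpace he (h := h) (c := c)]
  refine iSup_le fun μ w hw => ?_
  obtain ⟨N, hN⟩ := hγ μ
  have h1 := he.pow_apply_mem hX hw N
  rw [hN N le_rfl, Submodule.mem_bot] at h1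
  exact (Module.End.mem_maxGenEigenspace _ _ _).2 ⟨N, by simpa using h1⟩

/-- If the root vectors of a real root and of its negative act locally nilpotently, then the
reflection in this root preserves the bounded directions. -/
theorem isBoundedDirection_reflect {i : H.root} {x y : g} (hxy : IsRootPair B i x y) {m : ℤ}
    (hE : IsLocNilpotent (ρ (e ⊗ₜ AffVir.loop B m x)))
    (hF : IsLocNilpotent (ρ (e ⊗ₜ AffVir.loop B (-m) y))) {γ : Module.Dual ℂ H × ℂ}
    (hγ : IsBoundedDirection ρ e h c γ) :
    IsBoundedDirection ρ e h c (γ - γ.1 ((rootSystem H).coroot i) •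
      affineWeight h c ((rootSystem H).root i) m) := by
  intro μ
  set a := affineWeight h c ((rootSystem H).root i) m with ha
  set hi := (rootSystem H).coroot i with hhi
  have ha2 : a.1 hi = 2 := by
    have := (rootSystem H).root_coroot_two i
    exact this
  obtain ⟨hEF, hZE, hZF⟩ := sl2_relations he hxy m
  -- The point is the reflection of `μ`; the constant added to `μ.1 hi` is the contribution of `K`
  -- to the coroot. Reflection maps `μ + N s(γ)` to this point plus `N γ`, so a nonzero vector of
  -- the former weight would give one of the latter, which is excluded for `N ≥ N₀`.
  obtain ⟨N₀, hN₀⟩ := hγ (μ - (μ.1 hi + m * B.form x y * ψ (e ⊗ₜ ((0, 1), 0, 0))) • a)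
  refine ⟨N₀, fun N hN => ?_⟩
  by_contra hne
  obtain ⟨w, hw, hw0⟩ := (Submodule.ne_bot_iff _).1 hne
  have hZ : ρ (e ⊗ₜ (AffVir.loop B 0 (hi : g) + ((m : ℂ) * B.form x y) • AffVir.K B)) w =
      (μ.1 hi - N * γ.1 hi + m * B.form x y * ψ (e ⊗ₜ ((0, 1), 0, 0))) • w := by
    rw [TensorProduct.tmul_add, TensorProduct.tmul_smul, map_add, map_smul, LinearMap.add_apply,
      LinearMap.smul_apply, hv.apply_K, (mem_factorWeightSpace.1 hw).1, smul_smul, ← add_smul]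
    congr 2
    simp only [Prod.fst_add, Prod.smul_fst, Prod.fst_sub, LinearMap.add_apply, LinearMap.smul_apply,
      LinearMap.sub_apply, ha2, smul_eq_mul]
    ring
  have hEh := isHomogeneous_loop_root (B := B) i m hxy.mem_pos
  have hFh := isHomogeneous_loop_neg_root (B := B) i (-m) hxy.mem_neg
  have haneg : affineWeight h c (-(rootSystem H).root i) ((-m : ℤ) : ℂ) = -a := by
    refine Prod.ext rfl ?_
    simp only [ha, affineWeight, LinearMap.neg_apply, Prod.snd_neg]; push_cast; ring
  have key : ∀ r s : ℂ, s - r = μ.1 hi - N * γ.1 hi + m * B.form x y * ψ (e ⊗ₜ ((0, 1), 0, 0)) →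
      factorWeightSpace ρ e h c (μ + (N : ℂ) • (γ - γ.1 hi • a) + (r - s) • a) = ⊥ := by
    intro r s hrs
    rw [← hN₀ N hN]
    congr 1
    have : r - s = -(μ.1 hi - N * γ.1 hi + m * B.form x y * ψ (e ⊗ₜ ((0, 1), 0, 0))) := by
      rw [← hrs]; ring
    rw [this]
    module
  obtain ⟨r, s, ⟨hrs, hne'⟩ | ⟨hrs, hne'⟩⟩ := exists_reflect_ne_zero hEF hZE hZF hE hF hw0 hZ
  · have h1 := he.pow_apply_mem hFh (he.pow_apply_mem hEh hw r) s
    rw [haneg, ← ha, show ∀ (p q : Module.Dual ℂ H × ℂ), p + (r : ℂ) • q + (s : ℂ) • -q =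
      p + ((r : ℂ) - s) • q by intros; module, key r s hrs, Submodule.mem_bot] at h1
    exact hne' h1
  · have h1 := he.pow_apply_mem hEh (he.pow_apply_mem hFh hw r) s
    rw [haneg, ← ha, show ∀ (p q : Module.Dual ℂ H × ℂ), p + (r : ℂ) • -q + (s : ℂ) • q =
      p + ((s : ℂ) - r) • q by intros; module, key s r hrs, Submodule.mem_bot] at h1
    exact hne' h1

/-- With a dominant integral highest weight, the real root vectors of the affine algebra act locally
nilpotently. -/
theorem isLocNilpotent_of_dominant
    (hsimple : ∀ j ∈ b.support, ∃ k : ℕ, ψ (e ⊗ₜ (((rootSystem H).coroot j, 0), 0, 0)) = k)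
    (haff : ∀ θ : H.root, IsHighestRoot b θ → ∃ k : ℕ, ψ (e ⊗ₜ (affineCoroot B θ, 0, 0)) = k)
    (i : H.root) (m : ℤ) {x : g} (hx : x ∈ rootSpace H i.1) :
    IsLocNilpotent (ρ (e ⊗ₜ AffVir.loop B m x)) := by
  obtain ⟨θ, hθ⟩ := exists_isHighestRoot b
  obtain ⟨h, hhρ⟩ := exists_apply_root_eq_height b
  set c : ℂ := ((b.height θ + 1 : ℤ) : ℂ)
  -- `P wt m` says that `wt + m δ` is a bounded direction.
  let P : Module.Dual ℂ H → ℂ → Prop := fun wt m =>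
    IsBoundedDirection ρ e h c (affineWeight h c wt m)
  have hposdir : ∀ (i : H.root) (m : ℤ), IsPosWeight b ((rootSystem H).root i) m →
      P ((rootSystem H).root i) m := by
    intro i m hp
    obtain ⟨n, hn⟩ := principal_pos hθ hhρ (Or.inr ⟨i, rfl⟩) hp
    exact hv.isBoundedDirection_of_pos (principal_weaklyPositive hθ hhρ) (n := n) hn
  have hreflect : ∀ (i : H.root) (m : ℤ) (x y : g), IsRootPair B i x y →
      IsLocNilpotent (ρ (e ⊗ₜ AffVir.loop B m x)) →
      IsLocNilpotent (ρ (e ⊗ₜ AffVir.loop B (-m) y)) → ∀ (wt : Module.Dual ℂ H) (n : ℂ), P wt n →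
      P (wt - wt ((rootSystem H).coroot i) • (rootSystem H).root i)
        (n - wt ((rootSystem H).coroot i) * m) := by
    intro i m x y hxy hE hF wt n hP
    have := hv.isBoundedDirection_reflect he hxy hE hF hP
    rw [affineWeight_sub_smul] at this
    exact this
  have hpos_nil : ∀ (i : H.root) (m : ℤ) (x : g), x ∈ rootSpace H i.1 →
      P ((rootSystem H).root i) m → IsLocNilpotent (ρ (e ⊗ₜ AffVir.loop B m x)) :=
    fun i m x hx hP => hv.isLocNilpotent_of_isBoundedDirection he (isHomogeneous_loop_root i m hx) hP
  have hneg_nil : ∀ (i : H.root) (m : ℤ) (x : g), x ∈ rootSpace H (-i.1) →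
      P (-(rootSystem H).root i) m → IsLocNilpotent (ρ (e ⊗ₜ AffVir.loop B m x)) :=
    fun i m x hx hP =>
      hv.isLocNilpotent_of_isBoundedDirection he (isHomogeneous_loop_neg_root i m hx) hP
  have hperm : ∀ i j : H.root, (rootSystem H).root ((rootSystem H).reflectionPerm j i) =
      (rootSystem H).root i - (rootSystem H).root i ((rootSystem H).coroot j) •
        (rootSystem H).root j := by
    intro i j
    rw [RootPairing.root_reflectionPerm]
    exact RootPairing.reflection_apply _ _ _
  have hself : ∀ i : H.root, (rootSystem H).root i -
      (rootSystem H).root i ((rootSystem H).coroot i) • (rootSystem H).root i =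
        -(rootSystem H).root i := by
    intro i
    have : (rootSystem H).root i ((rootSystem H).coroot i) = 2 := (rootSystem H).root_coroot_two i
    rw [this]; module
  have hsimple_refl : ∀ j ∈ b.support, ∀ (wt : Module.Dual ℂ H) (n : ℂ), P wt n →
      P (wt - wt ((rootSystem H).coroot j) • (rootSystem H).root j) n := by
    intro j hj wt n hP
    obtain ⟨x, y, hxy⟩ := exists_isRootPair B j
    have hjpos : IsPosWeight b ((rootSystem H).root j) 0 :=
      Or.inr ⟨rfl, j, b.isPos_of_mem_support hj, rfl⟩
    obtain ⟨h', c', hc', hc0, hcu⟩ := exists_grading_simple hθ hj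
    obtain ⟨k, hk⟩ := hsimple j hj
    have := hreflect j 0 x y hxy (hpos_nil j 0 x hxy.mem_pos (hposdir j 0 hjpos))
      (hv.isLocNilpotent_of_simple he hxy 0 hjpos hc' hc0 hcu (k := k) (by simpa using hk)) wt n hP
    simpa using this
  -- Simple reflections generate the finite Weyl group. Including the negative root makes the
  -- statement invariant under `i ↦ -i`, as the induction requires.
  have hlevel0 : ∀ i : H.root, P ((rootSystem H).root i) 0 ∧ P (-(rootSystem H).root i) 0 := by
    intro i
    refine b.induction_reflect i (p := fun i => P ((rootSystem H).root i) 0 ∧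
      P (-(rootSystem H).root i) 0) (fun i hi => ?_) (fun j hj => ?_) (fun i j hi hj => ?_)
    · rw [hperm, hself, neg_neg]
      exact ⟨hi.2, hi.1⟩
    · have h1 : P ((rootSystem H).root j) 0 := by
        have := hposdir j 0 (Or.inr ⟨rfl, j, b.isPos_of_mem_support hj, rfl⟩)
        simpa using this
      have h2 := hsimple_refl j hj _ _ h1
      rw [hself] at h2
      exact ⟨h1, h2⟩
    · rw [hperm]
      refine ⟨hsimple_refl j hj _ _ hi.1, ?_⟩
      have := hsimple_refl j hj _ _ hi.2
      rw [LinearMap.neg_apply] at this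
      convert this using 1
      module
  have hfin_refl : ∀ (j : H.root) (wt : Module.Dual ℂ H) (n : ℂ), P wt n →
      P (wt - wt ((rootSystem H).coroot j) • (rootSystem H).root j) n := by
    intro j wt n hP
    obtain ⟨x, y, hxy⟩ := exists_isRootPair B j
    have := hreflect j 0 x y hxy (hpos_nil j 0 x hxy.mem_pos (by simpa using (hlevel0 j).1))
      (hneg_nil j (-0) y hxy.mem_neg (by simpa using (hlevel0 j).2)) wt n hP
    simpa using this
  -- The reflection in `δ - θ`, taken as the root `-θ` at level `1`. Its coroot is `-θ^∨` plus the
  -- multiple of `K` in `affineCoroot`, so dominance applies.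
  have haff_refl : ∀ (wt : Module.Dual ℂ H) (n : ℂ), P wt n →
      P (wt - wt ((rootSystem H).coroot θ) • (rootSystem H).root θ)
        (n + wt ((rootSystem H).coroot θ)) := by
    intro wt n hP
    obtain ⟨i, hi, -⟩ := exists_root_eq_neg b θ
    have hico : (rootSystem H).coroot i = -(rootSystem H).coroot θ := by
      have : i = (rootSystem H).reflectionPerm θ θ := by
        refine (rootSystem H).root.injective ?_
        rw [hperm, hself, hi]
      rw [this, RootPairing.coroot_reflectionPerm]
      exact (rootSystem H).coreflection_apply_self θ
    obtain ⟨x, y, hxy⟩ := exists_isRootPair B i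
    have hipos : IsPosWeight b ((rootSystem H).root i) 1 := Or.inl one_pos
    obtain ⟨h', c', hc', hc0, hcu⟩ := exists_grading_affine hθ
    obtain ⟨k, hk⟩ := haff θ hθ
    rw [← LinearMap.neg_apply, ← hi] at hc0
    rw [← hi] at hcu
    have hform : B.form ((rootSystem H).coroot i : g) ((rootSystem H).coroot i : g) =
        B.form ((rootSystem H).coroot θ : g) ((rootSystem H).coroot θ : g) := by
      rw [hico]
      simp
    have := hreflect i 1 x y hxy (hpos_nil i 1 x hxy.mem_pos (hposdir i 1 hipos))
      (hv.isLocNilpotent_of_simple he hxy 1 hipos hc' hc0 hcu (k := k) (by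
        rw [← hk, affineCoroot, hxy.form, hform, hico]; simp)) wt n hP
    rw [hi, hico, map_neg] at this
    simpa using this
  have hθ2 : (rootSystem H).root θ ((rootSystem H).coroot θ) = 2 :=
    (rootSystem H).root_coroot_two θ
  have hinv : ∀ wt : Module.Dual ℂ H,
      (wt - wt ((rootSystem H).coroot θ) • (rootSystem H).root θ) -
        (wt - wt ((rootSystem H).coroot θ) • (rootSystem H).root θ) ((rootSystem H).coroot θ) •
          (rootSystem H).root θ = wt := by
    intro wt
    rw [LinearMap.sub_apply, LinearMap.smul_apply, hθ2, smul_eq_mul]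
    module
  -- The reflections in `θ` and `δ - θ` cancel on the finite part and together translate the level
  -- by `∓ wt(θ^∨)`, depending on their order.
  have hup : ∀ (wt : Module.Dual ℂ H) (n : ℂ), P wt (n + wt ((rootSystem H).coroot θ)) → P wt n := by
    intro wt n hP
    have h1 := haff_refl _ _ (hfin_refl θ _ _ hP)
    rw [hinv, LinearMap.sub_apply, LinearMap.smul_apply, hθ2, smul_eq_mul] at h1
    convert h1 using 1
    ring
  have hdown : ∀ (wt : Module.Dual ℂ H) (n : ℂ), P wt (n - wt ((rootSystem H).coroot θ)) →
      P wt n := by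
    intro wt n hP
    have h1 := hfin_refl θ _ _ (haff_refl _ _ hP)
    rw [hinv, sub_add_cancel] at h1
    exact h1
  have hnonorth : ∀ (i : H.root) (m : ℤ), (rootSystem H).root i ((rootSystem H).coroot θ) ≠ 0 →
      P ((rootSystem H).root i) m := by
    intro i m hne
    obtain ⟨z, hz⟩ : ∃ z : ℤ, (rootSystem H).root i ((rootSystem H).coroot θ) = z := by
      have := RootPairing.exists_value (P := rootSystem H) (S := ℤ) i θ
      obtain ⟨z, hz⟩ := this
      exact ⟨z, by simpa using hz.symm⟩
    have hz0 : z ≠ 0 := by rintro rfl; exact hne (by simpa using hz)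
    have h1 : ∀ (k : ℕ) (m : ℤ), P ((rootSystem H).root i) ((m + k * z : ℤ) : ℂ) →
        P ((rootSystem H).root i) m := by
      intro k
      induction k with
      | zero => intro m hP; simpa using hP
      | succ k ih =>
        intro m hP
        refine ih m (hup _ _ ?_)
        rw [hz]
        convert hP using 1
        push_cast; ring
    have h2 : ∀ (k : ℕ) (m : ℤ), P ((rootSystem H).root i) ((m - k * z : ℤ) : ℂ) →
        P ((rootSystem H).root i) m := by
      intro k
      induction k with
      | zero => intro m hP; simpa using hP
      | succ k ih =>
        intro m hP
        refine ih m (hdown _ _ ?_)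
        rw [hz]
        convert hP using 1
        push_cast; ring
    -- As `|z| ≥ 1`, a number `|m| + 1` of translations in the right direction reaches a positive
    -- level, where boundedness is known.
    have hm : -(m.natAbs : ℤ) ≤ m := by omega
    rcases lt_or_gt_of_ne hz0 with hzneg | hzpos
    · exact h2 (m.natAbs + 1) m (hposdir i _ (Or.inl (by
        have h3 : ((m.natAbs + 1 : ℕ) : ℤ) * 1 ≤ ((m.natAbs + 1 : ℕ) : ℤ) * -z :=
          mul_le_mul_of_nonneg_left (by omega) (by positivity)
        rw [mul_neg] at h3
        omega)))
    · exact h1 (m.natAbs + 1) m (hposdir i _ (Or.inl (by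
        have h3 : ((m.natAbs + 1 : ℕ) : ℤ) * 1 ≤ ((m.natAbs + 1 : ℕ) : ℤ) * z :=
          mul_le_mul_of_nonneg_left (by omega) (by positivity)
        omega)))
  have hall : ∀ (i : H.root) (m : ℤ), P ((rootSystem H).root i) m := by
    by_contra! hbad
    -- The exceptional roots are permuted by the finite Weyl group, so by irreducibility they span
    -- the whole dual space if there are any. But all of them vanish on `θ^∨`, whereas `θ` does not.
    let Z : Set H.root := {i | ∃ m : ℤ, ¬ P ((rootSystem H).root i) m}
    let q : Submodule ℂ (Module.Dual ℂ H) := Submodule.span ℂ ((rootSystem H).root '' Z)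
    have hZ : Z.Nonempty := hbad
    have hq : q = ⊤ := by
      refine RootPairing.IsIrreducible.eq_top_of_invtSubmodule_reflection (P := rootSystem H) q
        (fun j => ?_) ?_
      · rw [Module.End.mem_invtSubmodule]
        refine Submodule.span_le.2 ?_
        rintro - ⟨i, ⟨m, hm⟩, rfl⟩
        refine Submodule.subset_span ⟨(rootSystem H).reflectionPerm j i, ⟨m, fun hP => hm ?_⟩, ?_⟩
        · have h1 := hfin_refl j _ _ hP
          rw [← hperm, RootPairing.reflectionPerm_self] at h1
          exact h1
        · rw [RootPairing.root_reflectionPerm]; rfl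
      · obtain ⟨i, hi⟩ := hZ
        intro hbot
        have : (rootSystem H).root i ∈ q := Submodule.subset_span ⟨i, hi, rfl⟩
        rw [hbot, Submodule.mem_bot] at this
        exact (rootSystem H).ne_zero i this
    have hle : q ≤ LinearMap.ker (Module.Dual.eval ℂ H ((rootSystem H).coroot θ)) := by
      refine Submodule.span_le.2 ?_
      rintro - ⟨i, ⟨m, hm⟩, rfl⟩
      by_contra hne
      exact hm (hnonorth i m hne)
    have : (rootSystem H).root θ ∈ q := hq ▸ Submodule.mem_top
    have h0 := hle this
    rw [LinearMap.mem_ker, Module.Dual.eval_apply, hθ2] at h0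
    exact two_ne_zero h0
  exact hpos_nil i m x hx (hall i m)

end IsIrrHighestWeight

end Weyl

/-! ### From `V(ψ)` and `A/√I` to the theorem. -/

section Assembly

set_option linter.unusedSectionVars false

open LieAlgebra.IsKilling LieAlgebra

attribute [local instance 100] LieRing.ofAssociativeRing

/-- The elements preserving `U` form a subalgebra containing the image of `L`. By the universal
property the identity of the enveloping algebra factors through it. -/
theorem universalEnvelopingAlgebra_smul_mem {L W : Type*} [LieRing L] [LieAlgebra ℂ L]
    [AddCommGroup W] [Module ℂ W] [Module (UniversalEnvelopingAlgebra ℂ L) W]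
    [IsScalarTower ℂ (UniversalEnvelopingAlgebra ℂ L) W] (U : Submodule ℂ W)
    (hU : ∀ (x : L), ∀ w ∈ U, UniversalEnvelopingAlgebra.ι ℂ x • w ∈ U)
    (u : UniversalEnvelopingAlgebra ℂ L) {w : W} (hw : w ∈ U) : u • w ∈ U := by
  let S : Subalgebra ℂ (UniversalEnvelopingAlgebra ℂ L) :=
    { carrier := {u | ∀ w ∈ U, u • w ∈ U}
      mul_mem' := fun ha hb w hw => by rw [mul_smul]; exact ha _ (hb _ hw)
      add_mem' := fun ha hb w hw => by rw [add_smul]; exact add_mem (ha _ hw) (hb _ hw)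
      algebraMap_mem' := fun r w hw => by rw [algebraMap_smul]; exact U.smul_mem r hw }
  let f : L →ₗ⁅ℂ⁆ S :=
    { toFun := fun x => ⟨UniversalEnvelopingAlgebra.ι ℂ x, hU x⟩
      map_add' := fun x y => Subtype.ext (map_add (UniversalEnvelopingAlgebra.ι ℂ) x y)
      map_smul' := fun r x => Subtype.ext (map_smul (UniversalEnvelopingAlgebra.ι ℂ) r x)
      map_lie' := fun {x y} => Subtype.ext (LieHom.map_lie (UniversalEnvelopingAlgebra.ι ℂ) x y) }
  have hid : S.val.comp (UniversalEnvelopingAlgebra.lift ℂ f) =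
      AlgHom.id ℂ (UniversalEnvelopingAlgebra ℂ L) := by
    apply UniversalEnvelopingAlgebra.hom_ext
    ext x
    simp [f]
  have hu : (UniversalEnvelopingAlgebra.lift ℂ f u : UniversalEnvelopingAlgebra ℂ L) = u :=
    DFunLike.congr_fun hid u
  rw [← hu]
  exact (UniversalEnvelopingAlgebra.lift ℂ f u).2 w hw

/-! ### The factors of `A/√I`. -/

section Factors

variable {A : Type*} [CommRing A] [Algebra ℂ A]

/-- `A/M` is a finite extension of the algebraically closed field `ℂ`. -/
theorem exists_algHom_ker_eq (I : Ideal A) (hI : FiniteDimensional ℂ (A ⧸ I)) (M : Ideal A)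
    (hM : M.IsMaximal) (hIM : I ≤ M) : ∃ χ : A →ₐ[ℂ] ℂ, ∀ a, χ a = 0 ↔ a ∈ M := by
  let : Field (A ⧸ M) := Ideal.Quotient.field M
  have : FiniteDimensional ℂ (A ⧸ M) :=
    Module.Finite.of_surjective (Ideal.Quotient.factorₐ ℂ hIM).toLinearMap
      (Ideal.Quotient.factor_surjective hIM)
  let f : (A ⧸ M) →ₐ[ℂ] ℂ := IsAlgClosed.lift
  refine ⟨f.comp (Ideal.Quotient.mkₐ ℂ M), fun a => ?_⟩
  rw [AlgHom.comp_apply, map_eq_zero_iff f f.toRingHom.injective, Ideal.Quotient.mkₐ_eq_mk,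
    Ideal.Quotient.eq_zero_iff_mem]

theorem finite_maximal_of_cofinite (I : Ideal A) (hI : FiniteDimensional ℂ (A ⧸ I)) :
    {N : Ideal A | N.IsMaximal ∧ I ≤ N}.Finite := by
  have : IsArtinianRing (A ⧸ I) := IsArtinianRing.of_finite ℂ _
  refine ((IsArtinianRing.setOfPred_isMaximal_finite (A ⧸ I)).image
    (Ideal.comap (Ideal.Quotient.mk I))).subset ?_
  rintro N ⟨hN, hle⟩
  have hker : RingHom.ker (Ideal.Quotient.mk I) ≤ N := by rwa [Ideal.mk_ker]
  refine ⟨N.map (Ideal.Quotient.mk I),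
    Ideal.IsMaximal.map_of_surjective_of_ker_le Ideal.Quotient.mk_surjective hker, ?_⟩
  rw [Ideal.comap_map_of_surjective' _ Ideal.Quotient.mk_surjective]
  exact sup_eq_left.mpr hker

/-- A finitely generated algebra is a Jacobson ring: radical ideals are intersections of maximal
ones. -/
theorem mem_radical_of_forall_maximal [Algebra.FiniteType ℂ A] {I : Ideal A} {a : A}
    (h : ∀ M : Ideal A, M.IsMaximal → I.radical ≤ M → a ∈ M) : a ∈ I.radical := by
  have : IsJacobsonRing A := isJacobsonRing_of_finiteType (A := ℂ)
  rw [← IsJacobsonRing.out' _ (Ideal.radical_isRadical I)]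
  exact Ideal.mem_sInf.2 fun {M} hM => h M hM.2 hM.1

end Factors

variable {g : Type*} [LieRing g] [LieAlgebra ℂ g] [FiniteDimensional ℂ g] [LieAlgebra.IsSimple ℂ g]
  (B : InvariantForm g) {H : LieSubalgebra ℂ g} [H.IsCartanSubalgebra]
  {A : Type*} [CommRing A] [Algebra ℂ A] (b : (rootSystem H).Base)
  (ψ : A ⊗[ℂ] ExtCartan H →ₗ[ℂ] ℂ)

/-- The image of `1` in `V(ψ)`. -/
def highestWeightVector : IrrHW B b ψ :=
  (vermaMax B b ψ).mkQ ((vermaIdeal B b ψ).mkQ 1)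

theorem smul_highestWeightVector (u : UniversalEnvelopingAlgebra ℂ (LoopAffVir B A)) :
    u • highestWeightVector B b ψ = (vermaMax B b ψ).mkQ ((vermaIdeal B b ψ).mkQ u) := by
  rw [highestWeightVector, ← map_smul, ← map_smul, smul_eq_mul, mul_one]

theorem smul_highestWeightVector_eq_zero {u : UniversalEnvelopingAlgebra ℂ (LoopAffVir B A)}
    (hu : u ∈ vermaIdeal B b ψ) : u • highestWeightVector B b ψ = 0 := by
  rw [smul_highestWeightVector, Submodule.mkQ_apply (vermaIdeal B b ψ),
    (Submodule.Quotient.mk_eq_zero _).2 hu, map_zero]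

/-- For simplicity of the quotient, the preimage of a proper submodule is proper, hence inside
`vermaMax`. Nothing in `IsIrrHighestWeight` asks for `v ≠ 0`, so it need not be shown that
`vermaMax` is proper. -/
theorem isIrrHighestWeight_irrHWAction :
    IsIrrHighestWeight b ψ (irrHWAction B b ψ) (highestWeightVector B b ψ) where
  pos a X hX := smul_highestWeightVector_eq_zero B b ψ
    (Submodule.subset_span (Or.inl ⟨a, X, hX, rfl⟩))
  weight a y := by
    have h := smul_highestWeightVector_eq_zero B b ψ
      (Submodule.subset_span (Or.inr ⟨a ⊗ₜ y, rfl⟩))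
    rw [sub_smul, sub_eq_zero, algebraMap_smul, LinearMap.lTensor_tmul] at h
    exact h
  cyclic U hv hU := by
    refine Submodule.eq_top_iff'.2 fun w => ?_
    obtain ⟨w, rfl⟩ := Submodule.mkQ_surjective _ w
    obtain ⟨u, rfl⟩ := Submodule.mkQ_surjective _ w
    rw [← smul_highestWeightVector]
    exact universalEnvelopingAlgebra_smul_mem U hU u hv
  simple U hU htop := by
    let N : Submodule (UniversalEnvelopingAlgebra ℂ (LoopAffVir B A)) (IrrHW B b ψ) :=
      { U with smul_mem' := fun u w hw => universalEnvelopingAlgebra_smul_mem U hU u hw }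
    have hN : N.comap (vermaMax B b ψ).mkQ ≤ vermaMax B b ψ := by
      refine le_sSup fun h => htop (Submodule.eq_top_iff'.2 fun w => ?_)
      obtain ⟨w, rfl⟩ := Submodule.mkQ_surjective _ w
      exact (h ▸ Submodule.mem_top : w ∈ N.comap (vermaMax B b ψ).mkQ)
    refine (Submodule.eq_bot_iff _).2 fun w hw => ?_
    obtain ⟨w, rfl⟩ := Submodule.mkQ_surjective _ w
    exact (Submodule.Quotient.mk_eq_zero _).2 (hN hw)

variable {B b ψ} {V : Type*} [AddCommGroup V] [Module ℂ V]
  {ρ : LoopAffVir B A →ₗ⁅ℂ⁆ Module.End ℂ V} {v : V}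

/-- The `a` with `a ⊗ X` locally nilpotent. -/
def locNilpotentSubmodule (ρ : LoopAffVir B A →ₗ⁅ℂ⁆ Module.End ℂ V) (X : AffVir B) :
    Submodule ℂ A where
  carrier := {a | IsLocNilpotent (ρ (a ⊗ₜ X))}
  zero_mem' := by
    change IsLocNilpotent _
    rw [TensorProduct.zero_tmul, map_zero]
    exact isLocNilpotent_zero
  add_mem' {a a'} ha ha' := by
    change IsLocNilpotent _
    rw [TensorProduct.add_tmul, map_add]
    -- `a ⊗ X` and `a' ⊗ X` commute, because `⁅X, X⁆ = 0`.
    refine IsLocNilpotent.add ha ha' (LinearMap.ext fun w => ?_)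
    rw [Module.End.mul_apply, Module.End.mul_apply, apply_apply_tmul, lie_self,
      TensorProduct.tmul_zero, map_zero, LinearMap.zero_apply, zero_add]
  smul_mem' r a ha := by
    change IsLocNilpotent _
    rw [← TensorProduct.smul_tmul', map_smul]
    exact IsLocNilpotent.smul ha r

namespace IsIrrHighestWeight

variable (hv : IsIrrHighestWeight b ψ ρ v) {I : Ideal A}
include hv

theorem apply_eq_zero_of_mem (hd : ∀ a ∈ I, ψ (a ⊗ₜ[ℂ] (0, 1, 0)) = 0)
    (hC : ∀ a ∈ I, ψ (a ⊗ₜ[ℂ] (0, 0, 1)) = 0)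
    (hh : ∀ a ∈ I, ∀ x : DerivedCartan H, ψ (a ⊗ₜ[ℂ] (x, 0, 0)) = 0) :
    ∀ a ∈ I, ∀ X, ρ (a ⊗ₜ X) = 0 := by
  obtain ⟨θ, hθ⟩ := exists_isHighestRoot b
  obtain ⟨h, hhρ⟩ := exists_apply_root_eq_height b
  intro a ha X
  refine hv.apply_eq_zero_of_ideal hθ hhρ I ⊤ (fun _ _ _ => trivial) (fun X _ => ?_)
    (fun a ha y _ => ?_) a ha X trivial
  · exact homogeneous_induction H (p := fun X => X ∈ Submodule.span ℂ
      {X | X ∈ (⊤ : Submodule ℂ (AffVir B)) ∧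
        ∃ (wt : Module.Dual ℂ H) (m : ℤ), IsHomogeneous B wt m X}) (zero_mem _)
      (fun _ _ => add_mem) (fun r _ => Submodule.smul_mem _ r)
      (fun wt m X hX => Submodule.subset_span ⟨trivial, wt, m, hX⟩) X
  · obtain ⟨x, s, c⟩ := y
    have e : ((x, s, c) : ExtCartan H) = (x, 0, 0) + s • (0, 1, 0) + c • (0, 0, 1) := by
      ext <;> simp
    rw [e, TensorProduct.tmul_add, TensorProduct.tmul_add, TensorProduct.tmul_smul,
      TensorProduct.tmul_smul, map_add, map_add, map_smul, map_smul, hd a ha, hC a ha, hh a ha]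
    simp

/-- The affine part is an ideal that meets `h̄` in `h'` only, so no vanishing on `d₀` or `C` is
needed for `J`. -/
theorem apply_affinePart_eq_zero_of_mem {J : Ideal A}
    (hh : ∀ a ∈ J, ∀ x : DerivedCartan H, ψ (a ⊗ₜ[ℂ] (x, 0, 0)) = 0) :
    ∀ a ∈ J, ∀ X ∈ affinePart B, ρ (a ⊗ₜ X) = 0 := by
  obtain ⟨θ, hθ⟩ := exists_isHighestRoot b
  obtain ⟨h, hhρ⟩ := exists_apply_root_eq_height b
  refine hv.apply_eq_zero_of_ideal hθ hhρ J (affinePart B) (fun X Y => lie_mem_affinePart X)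
    (affinePart_le_span H) (fun a ha y hy => ?_)
  obtain ⟨x, s, c⟩ := y
  obtain ⟨h1, h2⟩ := hy
  have hs : s = 0 := by simpa [cartanIncl] using h1
  have hc : c = 0 := by simpa [cartanIncl] using h2
  rw [hs, hc]
  exact hh a ha x

theorem isLocNilpotent_loop [Algebra.FiniteType ℂ A] (hI : FiniteDimensional ℂ (A ⧸ I))
    (hh : ∀ a ∈ I.radical, ∀ x : DerivedCartan H, ψ (a ⊗ₜ[ℂ] (x, 0, 0)) = 0)
    (hdom : IsDominantIntegralWrt B b ψ I.radical) (i : H.root) {x : g} (hx : x ∈ rootSpace H i.1)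
    (m : ℤ) (a : A) : IsLocNilpotent (ρ (a ⊗ₜ AffVir.loop B m x)) := by
  have hrad := hv.apply_affinePart_eq_zero_of_mem hh
  have := (finite_maximal_of_cofinite I hI).to_subtype
  have hle (M : {N : Ideal A | N.IsMaximal ∧ I ≤ N}) : I.radical ≤ M.1 :=
    M.2.1.isPrime.radical_le_iff.2 M.2.2
  choose e he using fun M : {N : Ideal A | N.IsMaximal ∧ I ≤ N} =>
    exists_isFactorUnit I hI M.1 M.2.1 (hle M)
  choose χ hχ using fun M : {N : Ideal A | N.IsMaximal ∧ I ≤ N} =>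
    exists_algHom_ker_eq I hI M.1 M.2.1 M.2.2
  have hone (M) : χ M (e M) = 1 := by
    have := (hχ M _).2 (he M).1
    rwa [map_sub, map_one, sub_eq_zero] at this
  have hzero (M N) (hne : N ≠ M) : χ N (e M) = 0 :=
    (hχ N _).2 ((he M).2 N.1 N.2.1 (hle N) fun h => hne (Subtype.ext h))
  have hmem {a : A} (ha : ∀ M, χ M a = 0) : a ∈ I.radical :=
    mem_radical_of_forall_maximal fun M hM hIM =>
      (hχ ⟨M, hM, Ideal.le_radical.trans hIM⟩ a).1 (ha _)
  have hfactor (M) : IsFactorOf ρ (e M) (χ M) := by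
    refine ⟨hone M, fun a X hX => ?_⟩
    -- All characters vanish on this element: `χ M` since `χ M (e M) = 1`, the others since they
    -- kill `e M`. So it lies in the radical.
    have h0 := hrad (a * e M - χ M a • e M) (hmem fun N => ?_) X hX
    · rwa [TensorProduct.sub_tmul, map_sub, sub_eq_zero, ← TensorProduct.smul_tmul', map_smul] at h0
    · rw [map_sub, map_mul, map_smul, smul_eq_mul]
      by_cases hN : N = M
      · rw [hN, sub_self]
      · rw [hzero M N hN]; simp
  cases nonempty_fintype {N : Ideal A | N.IsMaximal ∧ I ≤ N}
  change a ∈ locNilpotentSubmodule ρ (AffVir.loop B m x)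
  have hsum : ∑ M, χ M a • e M ∈ locNilpotentSubmodule ρ (AffVir.loop B m x) :=
    Submodule.sum_mem _ fun M _ => Submodule.smul_mem _ _ <| by
      obtain ⟨hs, ha⟩ := hdom M.1 M.2.1 (hle M) (e M) (he M)
      exact hv.isLocNilpotent_of_dominant (hfactor M) hs ha i m hx
  -- The difference is in the radical, so on the affine part `a` acts as the sum over the factors.
  have hdiff : a - ∑ M, χ M a • e M ∈ locNilpotentSubmodule ρ (AffVir.loop B m x) := by
    change IsLocNilpotent _
    rw [hrad _ (hmem fun N => ?_) _ (loop_mem_affinePart m x)]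
    · exact isLocNilpotent_zero
    · rw [map_sub, map_sum, Finset.sum_eq_single N]
      · rw [map_smul, hone, smul_eq_mul, mul_one, sub_self]
      · intro M _ hne
        rw [map_smul, hzero M N hne.symm, smul_zero]
      · simp
  have := add_mem hdiff hsum
  rwa [sub_add_cancel] at this

theorem isIntegrable [Algebra.FiniteType ℂ A] (hI : FiniteDimensional ℂ (A ⧸ I))
    (hd : ∀ a ∈ I, ψ (a ⊗ₜ[ℂ] (0, 1, 0)) = 0)
    (hC : ∀ a ∈ I, ψ (a ⊗ₜ[ℂ] (0, 0, 1)) = 0)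
    (hh : ∀ a ∈ I.radical, ∀ x : DerivedCartan H, ψ (a ⊗ₜ[ℂ] (x, 0, 0)) = 0)
    (hdom : IsDominantIntegralWrt B b ψ I.radical) : IsIntegrable B H ρ where
  isWeightModule := by
    classical
    exact DirectSum.isInternal_submodule_of_iSupIndep_of_iSup_eq_top
      (iSupIndep_weightSpace ρ) hv.iSup_weightSpace
  finiteDimensional := hv.finiteDimensional_weightSpace hI
    (hv.apply_eq_zero_of_mem hd hC fun a ha => hh a (Ideal.le_radical ha))
  locallyNilpotent i _ hx m a := hv.isLocNilpotent_loop hI hh hdom i hx m a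

end IsIrrHighestWeight

end Assembly

end LoopAffineVirasoro

end

theorem mainTheorem3 {g : Type*} [LieRing g] [LieAlgebra ℂ g] [FiniteDimensional ℂ g]
    [LieAlgebra.IsSimple ℂ g] (B : LoopAffineVirasoro.InvariantForm g)
    (H : LieSubalgebra ℂ g) [H.IsCartanSubalgebra]
    (b : (LieAlgebra.IsKilling.rootSystem H).Base)
    (A : Type*) [CommRing A] [Algebra ℂ A] [Algebra.FiniteType ℂ A]
    (ψ : A ⊗[ℂ] LoopAffineVirasoro.ExtCartan H →ₗ[ℂ] ℂ)
    (I : Ideal A) (hI : FiniteDimensional ℂ (A ⧸ I))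
    (hd : ∀ a ∈ I, ψ (a ⊗ₜ[ℂ] (0, 1, 0)) = 0)
    (hC : ∀ a ∈ I, ψ (a ⊗ₜ[ℂ] (0, 0, 1)) = 0)
    (hh : ∀ a ∈ I.radical, ∀ x : LoopAffineVirasoro.DerivedCartan H, ψ (a ⊗ₜ[ℂ] (x, 0, 0)) = 0)
    (hdom : LoopAffineVirasoro.IsDominantIntegralWrt B b ψ I.radical) :
    LoopAffineVirasoro.IsIntegrable B H (LoopAffineVirasoro.irrHWAction B b ψ) :=
  LoopAffineVirasoro.IsIrrHighestWeight.isIntegrable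
    (LoopAffineVirasoro.isIrrHighestWeight_irrHWAction B b ψ) hI hd hC hh hdom
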